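/- **Model.** Let $G=(V,E)$ be a finite simple undirected graph (the footprint), $n=|V|$. Nodes are anonymous; the edges at each node $v$ carry distinct port numbers $0,\dots,\delta_v-1$, where $\delta_v$ is the degree of $v$ in $G$. Time is divided into synchronous rounds. In every round $t$ an adversary removes at most one edge of $G$, subject to the remaining graph $G_t$ on $V$ being connected. One node is a black hole: every agent that enters it is destroyed without leaving a trace. All other nodes are safe. Six agents start together at a safe node; they have distinct identifiers in $[1,n^c]$, where $c$ is a constant unknown to the agents, and they know neither $n$, nor the number of agents, nor any other parameter of the graph, nor the black hole. Every node has a whiteboard. Memories and whiteboards are initially empty. All agents run the same deterministic algorithm. In each round every agent alive and not terminated reads its identifier and memory, the degree in $G$ of its node, the whiteboard of its node, the identifiers and memories of the other agents at its node, and the outcome of its own previous move (whether an attempted move succeeded, and through which port it entered); from this it computes its new memory, may replace the contents of the whiteboard, and then stays, tries to move through a port (it moves if the edge is present in this round and stays otherwise; it cannot see beforehand whether the edge is present), or terminates with the announcement that a certain port of its current node leads to the black hole. If several agents write on the same whiteboard in the same round, the contents written by one of them prevail, according to a fixed order unknown to the agents. **Theorem.** There are a single algorithm and an absolute constant $T$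 such that for every $c$ there is a constant $M$ (depending only on $c$) with the following property. For every port-labelled footprint $G$, every black hole, every safe starting node, every assignment of distinct identifiers in $[1,n^c]$ to the six agents and every behaviour of the adversary as above: 1. some agent survives and terminates within $T\,|E|^2$ rounds, having correctly announced a port of its node that leads to the black hole; 2. no agent ever terminates with a wrong announcement; 3. until the first agent terminates, every agent uses at most $M\log_2 n$ bits of memory, and every node at most $M\log_2 n$ bits of whiteboard storage. In short, 1-BHS is solved by 6 agents from a rooted initial configuration in $O(|E|^2)$ rounds with $O(\log n)$ bits per agent and per node. -/

import Mathlib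

namespace BHS

/-! ### Agents and algorithms -/

/-- What an agent knows about its own move in the previous round: it did not try to move, it tried
and stayed where it was, or it moved and entered the current node through the given port. -/
inductive Sensor where
  | idle
  | blocked
  | arrived (port : ℕ)

/-- The local information on which an agent bases its decision in a round. It contains neither the
name of the node nor the size of the graph, nor the presence of the edges in this round. -/
structure View where
  /-- its own identifier -/
  ident : ℕ
  /-- its own memory (a bit string) -/
  mem : List Bool
  /-- the outcome of its own previous move -/
  sensor : Sensor
  /-- the degree of the current node in the footprint -/
  degree : ℕ
  /-- the contents of the whiteboard of the current node (a bit string) -/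
  board : List Bool
  /-- identifiers and memories of the other agents at the current node -/
  others : Finset (ℕ × List Bool)

/-- What an agent does at the end of its computation: stay, try to leave through a port, or
terminate with the announcement that the given port leads to the black hole. -/
inductive Action where
  | stay
  | move (port : ℕ)
  | terminate (port : ℕ)

/-- The result of a computation: the new memory, what to put on the whiteboard of the current node
in place of its contents (`none`: do not write), and the action. -/
structure Decision where
  mem : List Bool
  write : Option (List Bool)
  action : Action

/-- A deterministic algorithm, the same for all agents and all graphs. -/
abbrev Algorithm := View → Decision

/-! ### Instances of the problem -/

/-- A rooted instance of `f`-BHS with `k` agents: a port-labelled footprint on the node set `V`,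
a time-varying graph on it which is connected in every round and misses at most `f` edges of the
footprint in every round, a black hole, a safe node at which all the agents start, and distinct
identifiers of the agents. -/
structure RootedInstance (V : Type*) [Fintype V] [DecidableEq V] (f k : ℕ) where
  /-- the footprint -/
  graph : SimpleGraph V
  decAdj : DecidableRel graph.Adj
  /-- the ports `0, …, deg v - 1` at `v` and the neighbours to which they lead -/
  ports : ∀ v : V, Fin (graph.degree v) ≃ graph.neighborSet v
  /-- the graph of the edges that are present in round `t` -/
  snapshot : ℕ → SimpleGraph V
  snapshot_le : ∀ t, snapshot t ≤ graph
  snapshot_missing : ∀ t, (graph.edgeSet \ (snapshot t).edgeSet).ncard ≤ f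
  snapshot_connected : ∀ t, (snapshot t).Connected
  blackHole : V
  root : V
  root_safe : root ≠ blackHole
  ident : Fin k → ℕ
  ident_injective : Function.Injective ident

attribute [instance] RootedInstance.decAdj

/-! ### Executions -/

inductive Status where
  | active
  | destroyed
  | terminated (port : ℕ)

structure AgentState (V : Type*) where
  pos : V
  mem : List Bool
  sensor : Sensor
  status : Status

structure Config (V : Type*) (k : ℕ) where
  agent : Fin k → AgentState V
  board : V → List Bool

namespace RootedInstance

variable {V : Type*} [Fintype V] [DecidableEq V] {f k : ℕ}

/-- All agents are at the root, all memories and all whiteboards are empty. -/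
def init (I : RootedInstance V f k) : Config V k where
  agent _ := ⟨I.root, [], .idle, .active⟩
  board _ := []

open Classical in
/-- The view of agent `i`. Destroyed agents are invisible; terminated ones are still seen. -/
noncomputable def view (I : RootedInstance V f k) (c : Config V k) (i : Fin k) : View where
  ident := I.ident i
  mem := (c.agent i).mem
  sensor := (c.agent i).sensor
  degree := I.graph.degree (c.agent i).pos
  board := c.board (c.agent i).pos
  others :=
    (Finset.univ.filter fun j => j ≠ i ∧ (c.agent j).pos = (c.agent i).pos ∧
        (c.agent j).status ≠ .destroyed).image
      fun j => (I.ident j, (c.agent j).mem)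

open Classical in
/-- An active agent at `v` with new memory `m` tries to leave `v` through port `p` in round `t`.
If there is no such port, or if its edge is missing in round `t`, it stays at `v`. -/
noncomputable def tryMove (I : RootedInstance V f k) (t : ℕ) (v : V) (m : List Bool) (p : ℕ) :
    AgentState V :=
  if hp : p < I.graph.degree v then
    let w := I.ports v ⟨p, hp⟩
    if (I.snapshot t).Adj v w then
      { pos := w
        mem := m
        sensor := .arrived ((I.ports w).symm ⟨v, I.graph.adj_symm w.2⟩)
        status := if (w : V) = I.blackHole then .destroyed else .active }
    else ⟨v, m, .blocked, .active⟩
  else ⟨v, m, .blocked, .active⟩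

/-- What a decision of an active agent at `v` in round `t` makes of this agent. -/
noncomputable def apply (I : RootedInstance V f k) (t : ℕ) (v : V) (d : Decision) :
    AgentState V :=
  match d.action with
  | .stay => ⟨v, d.mem, .idle, .active⟩
  | .move p => I.tryMove t v d.mem p
  | .terminate p => ⟨v, d.mem, .idle, .terminated p⟩

open Classical in
/-- Round `t`: all active agents look simultaneously, then compute and write, then move. If
several agents write at the same node in the same round, one of them prevails; which one is
determined by the index of the agents, which is unknown to them and unrelated to their
identifiers. -/
noncomputable def step (I : RootedInstance V f k) (A : Algorithm) (t : ℕ) (c : Config V k) :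
    Config V k where
  agent i :=
    if (c.agent i).status = .active then I.apply t (c.agent i).pos (A (I.view c i))
    else c.agent i
  board v :=
    ((List.finRange k).findSome? fun i =>
      if (c.agent i).status = .active ∧ (c.agent i).pos = v then (A (I.view c i)).write
      else none).getD (c.board v)

/-- The configuration at the beginning of round `t`, that is, after `t` rounds. -/
noncomputable def run (I : RootedInstance V f k) (A : Algorithm) : ℕ → Config V k
  | 0 => I.init
  | t + 1 => I.step A t (I.run A t)

/-- Port `p` at node `v` leads to the black hole. -/
def LeadsToBlackHole (I : RootedInstance V f k) (v : V) (p : ℕ) : Prop :=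
  ∃ hp : p < I.graph.degree v, (I.ports v ⟨p, hp⟩ : V) = I.blackHole

/-- The algorithm solves the instance within `R` rounds, with at most `B` bits of memory per agent
and at most `B` bits of storage per node until then: some agent survives and terminates after it
has found an edge at the black hole. No agent ever terminates with a wrong announcement. -/
def SolvedWithin (I : RootedInstance V f k) (A : Algorithm) (R B : ℕ) : Prop :=
  (∀ t i p, ((I.run A t).agent i).status = .terminated p →
      I.LeadsToBlackHole ((I.run A t).agent i).pos p) ∧
  ∃ τ ≤ R, (∃ i p, ((I.run A τ).agent i).status = .terminated p) ∧
    ∀ t ≤ τ, (∀ i, ((I.run A t).agent i).mem.length ≤ B) ∧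
      ∀ v, ((I.run A t).board v).length ≤ B

end RootedInstance

end BHS

namespace BHS

/-! ### Data of the algorithm

The six agents form two groups of three: a scout `A`, a companion `B` and a leader `C`. -/

/-! Three agents can test an unknown edge without being misled by the adversary. The scout `A`
crosses first. Then `A` tries to return while `B` tries to cross. Both use the same edge, so in the
first round in which it is present `B` leaves and `A`, if it is alive, comes back. When the leader
`C` sees that `B` has gone, the presence of `A` proves that the far end is safe, and its absence
proves that the port leads to the black hole. A missing edge delays this test but never falsifies
it.

Two such groups perform depth-first searches. The holding group waits at its edge even if the edge
is missing, and its records (`h`) are never discarded. It cannot complete its search, since a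
completed search has reached every node, the black hole included. Its search therefore admits at
most W = `weightBound` = O(|E|) advances. While it waits at a missing edge e, all other edges are
present. The exploring group passes over an unknown edge that is missing, and starts anew if its way
back is missing. A search begun while e is missing never crosses e; hence its way back is never
blocked, and since the graph without e is connected it comes upon the black hole unless e reappears.
Only a search begun earlier can depend on e, so one restart suffices, and each wait ends after at
most 2W + 1 steps. In total there are at most W(2W + 2) + 2W + 1 = O(|E|²) steps.

The exploring group might be stuck as well, being separated over a missing edge. If the holding
group is stuck at the same time, both edges are e. Therefore, as soon as the holding group wants an
edge over which the other one is separated, the roles are exchanged: the separated group takes over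
the held search, whose next move crosses this very edge, and the other group begins a new exploring
search. If the two leaders are at different ends, the pending move is left on the whiteboard as a
token, which is picked up once the separated group is complete again. If both groups test the same
edge from its two ends, both ends are known to be safe, and the two scouts simply change groups.

The argument is carried out for an abstract system `Sys` of two leaders and the whiteboards. `Duo`
is its invariant, `Duo.pairCase` shows that the reactions of the groups match, `Duo.holdStep` and
`ExploreStep.progress` describe the two searches, and `Prog.next` makes a lexicographic potential
decrease. `Sim.order` and `Sim.record` show that the agents execute this system, one step in two
rounds. All numbers stored are ports or clock values, hence polynomial in n. -/

inductive Idx where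
  | A
  | B
  | C
  deriving DecidableEq

/-- What the leader of a group has last ordered. `probe`: `A` tries to cross an unknown edge;
`test`: `A` tries to return while `B` tries to cross; `join`: `A` and `C` try to cross an edge
known to be safe in order to meet `B`; `cross`: the whole group tries to cross an edge known to be
safe; `found`: the port leads to the black hole. -/
inductive Stage where
  | plan
  | probe
  | test
  | join
  | cross
  | found
  deriving DecidableEq

/-- The orders of a leader. The group which has `hold` insists on the edge it wants to cross; the
other one explores what can be reached without missing edges. -/
structure Ldr where
  stage : Stage
  port : ℕ
  fwd : Bool
  hold : Bool
  epoch : ℕ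

/-- The port to the parent in a depth-first search, and the next port to be tried. -/
abbrev NodeRec := Option ℕ × ℕ

/-- `h` belongs to the held search and `x`, stamped with an epoch, to the exploring one. `tok` holds
the port and direction of a move left to a group which is still separated. -/
structure Board where
  h : Option NodeRec
  x : Option (ℕ × NodeRec)
  tok : Option (ℕ × Bool)

structure Mem where
  grp : Bool
  idx : Idx
  /-- the outcome of the last move has still to be recorded -/
  fresh : Bool
  moved : Bool
  /-- the port through which the agent entered its node -/
  inp : ℕ
  ldr : Ldr
  clock : ℕ

namespace Ldr

def wants (L : Ldr) : Prop := L.stage = .probe ∨ L.stage = .cross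
def split (L : Ldr) : Prop := L.stage = .test ∨ L.stage = .join
def engaged (L : Ldr) : Prop := L.wants ∨ L.split
/-- The leader itself tries to move. -/
def moving (L : Ldr) : Prop := L.stage = .join ∨ L.stage = .cross

instance (L : Ldr) : Decidable L.wants := by unfold wants; infer_instance
instance (L : Ldr) : Decidable L.split := by unfold split; infer_instance
instance (L : Ldr) : Decidable L.engaged := by unfold engaged; infer_instance
instance (L : Ldr) : Decidable L.moving := by unfold moving; infer_instance

/-- The record of a node in the depth-first search of a group. -/
def getRec (L : Ldr) (b : Board) : Option NodeRec :=
  if L.hold then b.h else b.x.bind fun r => if r.1 = L.epoch then some r.2 else none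

/-- The clock serves as the epoch of the new search, so that records of earlier searches become void
without being erased. -/
def initial (clock : ℕ) : Ldr := ⟨.plan, 0, true, false, clock⟩

end Ldr

/-- Changes of a whiteboard. -/
structure Edit where
  h : Option NodeRec
  x : Option (ℕ × NodeRec)
  tok : Option (Option (ℕ × Bool))

namespace Edit

def nil : Edit := ⟨none, none, none⟩

def apply (e : Edit) (b : Board) : Board := ⟨e.h <|> b.h, e.x <|> b.x, e.tok.getD b.tok⟩

/-- First `e`, then `f`. -/
def comp (e f : Edit) : Edit := ⟨f.h <|> e.h, f.x <|> e.x, f.tok <|> e.tok⟩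

/-- Write a record for the depth-first search of the group. -/
def put (L : Ldr) (r : NodeRec) : Edit :=
  if L.hold then ⟨some r, none, none⟩ else ⟨none, some (L.epoch, r), none⟩

/-- The current node becomes the root of a new search of the exploring group. -/
def root (clock : ℕ) : Edit := ⟨none, some (clock, none, 0), none⟩

end Edit

/-! ### The orders of a leader -/

/-- The port to the parent is passed over without a move. The case of a holding group whose search
is complete is a dummy: such a search would have reached the black hole. -/
def planStep (deg clock : ℕ) (L : Ldr) (b : Board) : Ldr × Edit :=
  match L.getRec b with
  | none => (L, .nil)
  | some (par, next) =>
    if next < deg then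
      (if par = some next then L else { L with stage := .probe, port := next, fwd := true },
        .put L (par, next + 1))
    else match par with
      | some q => ({ L with stage := .cross, port := q, fwd := false }, .nil)
      | none => if L.hold then (L, .nil) else (.initial clock, .root clock)

/-- The group has entered a node through port `inp`. -/
def arrive (inp : ℕ) (L : Ldr) (b : Board) : Ldr × Edit :=
  if L.fwd then
    match L.getRec b with
    | none => ({ L with stage := .plan }, .put L (some inp, 0))
    | some _ => ({ L with stage := .cross, port := inp, fwd := false }, .nil)
  else ({ L with stage := .plan }, .nil)

/-- A group which is complete again takes over a token left for it. -/
def joined (inp : ℕ) (L : Ldr) (b : Board) : Ldr × Edit :=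
  match b.tok with
  | some (q, f) =>
    if q = inp then
      ({ L with stage := .cross, port := inp, fwd := f, hold := true }, ⟨none, none, some none⟩)
    else arrive inp L b
  | none => arrive inp L b

/-- The new orders, depending on the outcome of the last move; `a` and `b` tell whether `A` and `B`
are present. -/
def own (deg clock : ℕ) (moved : Bool) (inp : ℕ) (a b : Bool) (L : Ldr) (w : Board) :
    Ldr × Edit :=
  match L.stage with
  | .plan => planStep deg clock L w
  | .probe =>
    if a then (if L.hold then L else { L with stage := .plan }, .nil)
    else ({ L with stage := .test }, .nil)
  | .test =>
    if b then (L, .nil)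
    else if a then ({ L with stage := .join }, .nil) else ({ L with stage := .found }, .nil)
  | .join => if moved then joined inp L w else (L, .nil)
  | .cross =>
    if moved then arrive inp L w
    else if L.hold then (L, .nil) else (.initial clock, .root clock)
  | .found => (L, .nil)

/-- What is seen of a group at a node: nothing, its leader, or a separated member which entered
through the given port. -/
inductive Pres where
  | absent
  | lead (L : Ldr)
  | lone (q : ℕ)

/-- How the orders change because of the presence of the other group. -/
def react (clock : ℕ) (L : Ldr) : Pres → Ldr × Edit
  | .absent => (L, .nil)
  | .lead M =>
    if M.port ≠ L.port then (L, .nil)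
    else if L.hold ∧ L.wants ∧ M.split then (.initial clock, .root clock)
    else if ¬ L.hold ∧ L.split ∧ M.hold ∧ M.wants then
      ({ L with hold := true, fwd := M.fwd }, .nil)
    else if ¬ L.hold ∧ L.stage = .probe ∧ M.engaged then ({ L with stage := .plan }, .nil)
    else (L, .nil)
  | .lone q =>
    if q ≠ L.port then (L, .nil)
    else if L.stage = .test then
      ({ L with stage := if L.hold then .cross else .plan }, .nil)
    else if L.hold ∧ L.wants then
      (.initial clock, (Edit.root clock).comp ⟨none, none, some (some (q, L.fwd))⟩)
    else if ¬ L.hold ∧ L.stage = .probe then ({ L with stage := .plan }, .nil)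
    else (L, .nil)

/-- What the member `i` of a group does on orders `L`. -/
def Ldr.action (L : Ldr) (i : Idx) : Action :=
  match L.stage with
  | .plan => .stay
  | .probe => if i = .A then .move L.port else .stay
  | .test => if i = .B then .move L.port else .stay
  | .join => if i = .B then .stay else .move L.port
  | .cross => .move L.port
  | .found => if i = .C then .terminate L.port else .stay

/-! ### The joint computation of the agents at a node -/

/-- The memories of the agents at a node. -/
abbrev Gathering := Bool → Idx → Option Mem

namespace Gathering

variable (deg : ℕ) (b : Board) (J : Gathering)

/-- A terminated leader stays visible together with its memory and has to be ignored. -/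
def leader (g : Bool) : Option Mem := (J g .C).filter fun m => m.ldr.stage ≠ .found

def ownOut (g : Bool) : Option (Ldr × Edit) :=
  (J.leader g).map fun m =>
    own deg m.clock m.moved m.inp (J g .A).isSome (J g .B).isSome m.ldr b

/-- The other group is judged by its orders after its own step. Both groups thus react to the same
intermediate state, which makes their reactions compatible. -/
def pres (g : Bool) : Pres :=
  match J.ownOut deg b g with
  | some r => if r.1.stage = .found then .absent else .lead r.1
  | none => match (J g .A <|> J g .B) with
    | some m => .lone m.inp
    | none => .absent

def out (g : Bool) : Option (Ldr × Edit) :=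
  (J.leader g).bind fun m => (J.ownOut deg b g).map fun r =>
    ((react m.clock r.1 (J.pres deg b !g)).1, r.2.comp (react m.clock r.1 (J.pres deg b !g)).2)

/-- This depends only on what every agent at the node sees. All of them write the same contents, and
it does not matter whose writing prevails. -/
def newBoard : Board :=
  ((J.out deg b true).map Prod.snd |>.getD .nil).apply
    (((J.out deg b false).map Prod.snd |>.getD .nil).apply b)

/-- The leader of the other group adopts a separated agent which has come from the other end of
the edge that is just being tested. -/
def adopted (m : Mem) : Prop :=
  ∃ r, J.ownOut deg b (!m.grp) = some r ∧ r.1.stage = .test ∧ r.1.port = m.inp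

-- Without a leader at its node, an agent that is not adopted is a separated member: `A` attempts to
-- return, and `B` waits to be joined.
open Classical in
noncomputable def decideMem (m : Mem) : Mem × Action :=
  match J.out deg b m.grp with
  | some r =>
    (if m.idx = .C then { m with fresh := true, ldr := r.1, clock := m.clock + 1 }
      else { m with fresh := true }, r.1.action m.idx)
  | none =>
    if J.adopted deg b m then
      ({ m with grp := !m.grp, idx := .A, fresh := true },
        ((J.out deg b (!m.grp)).map fun r => r.1.action .A).getD .stay)
    else ({ m with fresh := true }, if m.idx = .A then .move m.inp else .stay)

end Gathering

/-! ### Encoding -/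

def Idx.code : Idx → ℕ
  | .A => 0
  | .B => 1
  | .C => 2

def Stage.code : Stage → ℕ
  | .plan => 0
  | .probe => 1
  | .test => 2
  | .join => 3
  | .cross => 4
  | .found => 5

/-- The successor keeps the empty string free for the initial memory. For whiteboards the opposite
is wanted: the blank one has to be encoded by the empty string. -/
def Mem.code (m : Mem) : ℕ :=
  Encodable.encode (m.grp, m.idx.code, m.fresh, m.moved, m.inp, m.ldr.stage.code, m.ldr.port,
    m.ldr.fwd, m.ldr.hold, m.ldr.epoch, m.clock) + 1

def Mem.bits (m : Mem) : List Bool := m.code.bits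

def Board.code (b : Board) : ℕ := Encodable.encode (b.h, b.x, b.tok)

def Board.bits (b : Board) : List Bool := b.code.bits

def Board.blank : Board := ⟨none, none, none⟩

theorem natBits_injective : Function.Injective Nat.bits := by
  intro a b h
  have := congrArg (fun l => Nat.ofDigits 2 (l.map fun c : Bool => cond c 1 0)) h
  simpa [← Nat.digits_two_eq_bits, Nat.ofDigits_digits] using this

theorem Idx.code_injective : Function.Injective Idx.code := by
  intro a b h; cases a <;> cases b <;> simp_all [Idx.code]

theorem Stage.code_injective : Function.Injective Stage.code := by
  intro a b h; cases a <;> cases b <;> simp_all [Stage.code]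

theorem Mem.bits_injective : Function.Injective Mem.bits := by
  rintro ⟨g, i, f, mv, inp, ⟨s, p, fw, hd, e⟩, c⟩ ⟨g', i', f', mv', inp', ⟨s', p', fw', hd', e'⟩, c'⟩ h
  have h1 := natBits_injective h
  simp only [Mem.code, Nat.add_right_cancel_iff] at h1
  have h2 := Encodable.encode_injective h1
  simp only [Prod.mk.injEq] at h2
  obtain ⟨rfl, hi, rfl, rfl, rfl, hs, rfl, rfl, rfl, rfl, rfl⟩ := h2
  obtain rfl := Idx.code_injective hi
  obtain rfl := Stage.code_injective hs
  rfl

theorem Mem.bits_ne_nil (m : Mem) : m.bits ≠ [] := by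
  intro h
  have : m.code = 0 := natBits_injective (by simpa [Mem.bits] using h)
  simp [Mem.code] at this

theorem Board.bits_injective : Function.Injective Board.bits := by
  rintro ⟨h, x, t⟩ ⟨h', x', t'⟩ e
  have h1 := natBits_injective e
  simp only [Board.code] at h1
  have h2 := Encodable.encode_injective h1
  simp only [Prod.mk.injEq] at h2
  obtain ⟨rfl, rfl, rfl⟩ := h2
  rfl

theorem Board.bits_blank : Board.blank.bits = [] := by
  simp [Board.bits, Board.code, Board.blank, Nat.pair]

/-! ### The algorithm -/

open Classical in
noncomputable def Mem.ofBits (l : List Bool) : Option Mem :=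
  if h : ∃ m : Mem, m.bits = l then some h.choose else none

open Classical in
noncomputable def Board.ofBits (l : List Bool) : Board :=
  if h : ∃ b : Board, b.bits = l then h.choose else .blank

theorem Mem.ofBits_bits (m : Mem) : Mem.ofBits m.bits = some m := by
  have h : ∃ m' : Mem, m'.bits = m.bits := ⟨m, rfl⟩
  rw [Mem.ofBits, dif_pos h, Mem.bits_injective h.choose_spec]

theorem Board.ofBits_bits (b : Board) : Board.ofBits b.bits = b := by
  have h : ∃ b' : Board, b'.bits = b.bits := ⟨b, rfl⟩
  rw [Board.ofBits, dif_pos h, Board.bits_injective h.choose_spec]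

open Classical in
/-- The gathering which consists of the agents with the given memories. -/
noncomputable def Gathering.ofSet (S : Finset (List Bool)) : Gathering := fun g i =>
  if h : ∃ m : Mem, m.grp = g ∧ m.idx = i ∧ m.bits ∈ S then some h.choose else none

/-- The label of the agent with the `k`-th smallest identifier. -/
def initialLabel (k : ℕ) : Bool × Idx :=
  match k with
  | 0 => (false, .A)
  | 1 => (false, .B)
  | 2 => (false, .C)
  | 3 => (true, .A)
  | 4 => (true, .B)
  | _ => (true, .C)

def initialLdr (g : Bool) : Ldr := ⟨.plan, 0, true, !g, 0⟩

def initialMem (s : Bool × Idx) : Mem :=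
  ⟨s.1, s.2, false, false, 0, initialLdr s.1, 1⟩

def initialBoard : Board := ⟨some (none, 0), some (0, none, 0), none⟩

/-- Recording the outcome of the last move. -/
def Mem.record (m : Mem) : Sensor → Mem
  | .arrived q => { m with fresh := false, moved := true, inp := q }
  | _ => { m with fresh := false, moved := false }

/-- The outcome of a move is visible to the mover alone. Rounds therefore alternate between copying
it into the memory, where the others can read it, and computing jointly. In the first round the
ranks of the identifiers distribute the six labels. -/
noncomputable def search : Algorithm := fun v =>
  match Mem.ofBits v.mem with
  | none =>
    ⟨(initialMem (initialLabel (v.others.filter fun o => o.1 < v.ident).card)).bits,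
      some initialBoard.bits, .stay⟩
  | some m =>
    if m.fresh then ⟨(m.record v.sensor).bits, none, .stay⟩
    else
      let J := Gathering.ofSet (insert v.mem (v.others.image Prod.snd))
      let b := Board.ofBits v.board
      let r := J.decideMem v.degree b m
      ⟨r.1.bits, some (J.newBoard v.degree b).bits, r.2⟩

end BHS

/-! ### Ports, edges, and the abstract system of two groups -/

namespace BHS

namespace RootedInstance

variable {V : Type*} [Fintype V] [DecidableEq V] {f k : ℕ} (I : RootedInstance V f k)

/-- The node to which port `p` at `v` leads (`v` itself if there is no such port). -/
def far (v : V) (p : ℕ) : V :=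
  if hp : p < I.graph.degree v then I.ports v ⟨p, hp⟩ else v

/-- The port at the other end of the edge at port `p` of `v`. -/
def rev (v : V) (p : ℕ) : ℕ :=
  if hp : p < I.graph.degree v then
    (I.ports (I.ports v ⟨p, hp⟩)).symm ⟨v, I.graph.adj_symm (I.ports v ⟨p, hp⟩).2⟩
  else p

variable {I}

theorem adj_far {v : V} {p : ℕ} (hp : p < I.graph.degree v) : I.graph.Adj v (I.far v p) := by
  rw [far, dif_pos hp]; exact (I.ports v ⟨p, hp⟩).2

theorem far_ne {v : V} {p : ℕ} (hp : p < I.graph.degree v) : I.far v p ≠ v :=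
  (adj_far hp).ne'

theorem far_eq {v : V} {p : ℕ} (hp : p < I.graph.degree v) :
    I.far v p = I.ports v ⟨p, hp⟩ := dif_pos hp

theorem rev_eq {v : V} {p : ℕ} (hp : p < I.graph.degree v) :
    I.rev v p = (I.ports (I.ports v ⟨p, hp⟩)).symm
      ⟨v, I.graph.adj_symm (I.ports v ⟨p, hp⟩).2⟩ := dif_pos hp

theorem far_symm {v w : V} (h : I.graph.Adj w v) :
    I.far w ((I.ports w).symm ⟨v, h⟩) = v := by
  rw [far_eq (Fin.is_lt _)]; simp

theorem rev_lt {v : V} {p : ℕ} (hp : p < I.graph.degree v) :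
    I.rev v p < I.graph.degree (I.far v p) := by
  rw [far_eq hp, rev_eq hp]; exact Fin.is_lt _

theorem far_far {v : V} {p : ℕ} (hp : p < I.graph.degree v) :
    I.far (I.far v p) (I.rev v p) = v := by
  rw [far_eq hp, rev_eq hp]; exact far_symm _

theorem exists_port {v w : V} (h : I.graph.Adj v w) :
    ∃ p, p < I.graph.degree v ∧ I.far v p = w := by
  refine ⟨(I.ports v).symm ⟨w, h⟩, Fin.is_lt _, ?_⟩
  rw [far, dif_pos (Fin.is_lt _)]
  simp

theorem far_injOn {v : V} {p q : ℕ} (hp : p < I.graph.degree v) (hq : q < I.graph.degree v)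
    (h : I.far v p = I.far v q) : p = q := by
  rw [far, far, dif_pos hp, dif_pos hq] at h
  have := (I.ports v).injective (Subtype.ext h)
  simpa using this

theorem rev_rev {v : V} {p : ℕ} (hp : p < I.graph.degree v) :
    I.rev (I.far v p) (I.rev v p) = p := by
  have h := rev_lt (rev_lt hp)
  rw [far_far hp] at h
  refine far_injOn h hp ?_
  have := far_far (rev_lt hp)
  rwa [far_far hp] at this

variable (I) in
/-- The edges at the given ports are the same. -/
def SameEdge (v : V) (p : ℕ) (w : V) (q : ℕ) : Prop :=
  (v = w ∧ p = q) ∨ (I.far v p = w ∧ I.rev v p = q)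

theorem SameEdge.symm {v w : V} {p q : ℕ} (hp : p < I.graph.degree v)
    (h : I.SameEdge v p w q) : I.SameEdge w q v p := by
  rcases h with ⟨rfl, rfl⟩ | ⟨rfl, rfl⟩
  · exact .inl ⟨rfl, rfl⟩
  · exact .inr ⟨far_far hp, rev_rev hp⟩

theorem SameEdge.trans {v w z : V} {p q r : ℕ} (hp : p < I.graph.degree v)
    (h : I.SameEdge v p w q) (h' : I.SameEdge w q z r) : I.SameEdge v p z r := by
  rcases h with ⟨rfl, rfl⟩ | ⟨rfl, rfl⟩
  · exact h'
  · rcases h' with ⟨rfl, rfl⟩ | ⟨rfl, rfl⟩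
    · exact .inr ⟨rfl, rfl⟩
    · exact .inl ⟨(far_far hp).symm, (rev_rev hp).symm⟩

theorem sameEdge_rev {v : V} {p : ℕ} : I.SameEdge v p (I.far v p) (I.rev v p) :=
  .inr ⟨rfl, rfl⟩

variable (I) in
/-- The edge at port `p` of `v` is present in round `t`. -/
def Present (t : ℕ) (v : V) (p : ℕ) : Prop := (I.snapshot t).Adj v (I.far v p)

theorem SameEdge.present_iff {v w : V} {p q t : ℕ} (hp : p < I.graph.degree v)
    (h : I.SameEdge v p w q) : I.Present t v p ↔ I.Present t w q := by
  rcases h with ⟨rfl, rfl⟩ | ⟨rfl, rfl⟩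
  · rfl
  · rw [Present, Present, far_far hp]; exact SimpleGraph.adj_comm _ _ _

theorem sameEdge_of_adj {v w : V} {p q : ℕ} (hp : p < I.graph.degree v)
    (hq : q < I.graph.degree w) (h : s(v, I.far v p) = s(w, I.far w q)) : I.SameEdge v p w q := by
  rw [Sym2.eq_iff] at h
  rcases h with ⟨rfl, h⟩ | ⟨h1, h2⟩
  · exact .inl ⟨rfl, far_injOn hp hq h⟩
  · refine .inr ⟨h2, ?_⟩
    subst h2
    refine far_injOn (rev_lt hp) hq ?_
    rw [far_far hp]; exact h1

/-- At most one edge is missing. -/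
theorem sameEdge_of_missing {I : RootedInstance V 1 k} {v w : V} {p q t : ℕ}
    (hp : p < I.graph.degree v) (hq : q < I.graph.degree w) (h : ¬ I.Present t v p)
    (h' : ¬ I.Present t w q) : I.SameEdge v p w q := by
  refine sameEdge_of_adj hp hq ?_
  have hc := I.snapshot_missing t
  rw [Set.ncard_le_one (Set.toFinite _)] at hc
  exact hc _ ⟨adj_far hp, h⟩ _ ⟨adj_far hq, h'⟩

end RootedInstance

/-! ### The system of the two groups -/

/-- The orders given in a round: for each group its orders and the position of its leader. -/
structure Sys (V : Type*) where
  ldr : Bool → Ldr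
  pos : Bool → V
  board : V → Board
  clock : ℕ

namespace Sys

open RootedInstance

variable {V : Type*} [Fintype V] [DecidableEq V] {f k : ℕ} (I : RootedInstance V f k)
  (S : Sys V) (ok : Bool → Prop)

def far (g : Bool) : V := I.far (S.pos g) (S.ldr g).port
def rev (g : Bool) : ℕ := I.rev (S.pos g) (S.ldr g).port

open Classical in
/-- The leader of a group after the move, if `ok` tells whether its edge is present. -/
noncomputable def newPos (g : Bool) : V :=
  if (S.ldr g).moving ∧ ok g then S.far I g else S.pos g

-- The presence of `A` and `B` is computed here from `ok` instead of being observed: a probing `A`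
-- is absent if its edge was present; in a test `B` is absent, and `A` is back if it was not
-- destroyed, exactly if the edge was present.
open Classical in
noncomputable def ownOut (g : Bool) : Ldr × Edit :=
  own (I.graph.degree (S.newPos I ok g)) S.clock (decide ((S.ldr g).moving ∧ ok g)) (S.rev I g)
    (decide (((S.ldr g).stage = .probe → ¬ ok g) ∧
      ((S.ldr g).stage = .test → ok g ∧ S.far I g ≠ I.blackHole)))
    (decide ((S.ldr g).stage = .test → ¬ ok g)) (S.ldr g) (S.board (S.newPos I ok g))

/-- The system before the groups react to each other. -/
noncomputable def half : Sys V where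
  ldr g := (S.ownOut I ok g).1
  pos := S.newPos I ok
  board := S.board
  clock := S.clock

/-- What is seen of group `g` at node `w`. -/
def pres (g : Bool) (w : V) : Pres :=
  if (S.ldr g).stage = .found then .absent
  else if S.pos g = w then .lead (S.ldr g)
  else if (S.ldr g).split ∧ S.far I g = w then .lone (S.rev I g)
  else .absent

noncomputable def reactOut (g : Bool) : Ldr × Edit :=
  react S.clock ((S.half I ok).ldr g) ((S.half I ok).pres I (!g) ((S.half I ok).pos g))

noncomputable def edit (g : Bool) : Edit := (S.ownOut I ok g).2.comp (S.reactOut I ok g).2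

noncomputable def next : Sys V where
  ldr g := (S.reactOut I ok g).1
  pos := S.newPos I ok
  board w :=
    (if S.newPos I ok true = w then S.edit I ok true else .nil).apply
      ((if S.newPos I ok false = w then S.edit I ok false else .nil).apply (S.board w))
  clock := S.clock + 1

def SameEdge (g g' : Bool) : Prop :=
  I.SameEdge (S.pos g) (S.ldr g).port (S.pos g') (S.ldr g').port

def initial : Sys V where
  ldr := initialLdr
  pos _ := I.root
  board w := if w = I.root then initialBoard else .blank
  clock := 1

end Sys

end BHS

/-! ### Case analysis of the orders and of the reactions -/

namespace BHS

namespace Sys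

open RootedInstance

variable {V : Type*} [Fintype V] [DecidableEq V] {f k : ℕ} (I : RootedInstance V f k)
  (S : Sys V) (ok : Bool → Prop)

/-- The record of a node in the search of group `g`. -/
def nodeRec (g : Bool) (w : V) : Option NodeRec := (S.ldr g).getRec (S.board w)

/-- The possible new orders of a group. -/
inductive OwnCase (g : Bool) : Ldr × Edit → Prop
  | planSkip {par next} (hs : (S.ldr g).stage = .plan) (hp : S.newPos I ok g = S.pos g)
      (hr : S.nodeRec g (S.pos g) = some (par, next)) (hn : next < I.graph.degree (S.pos g))
      (hpar : par = some next) : OwnCase g (S.ldr g, .put (S.ldr g) (par, next + 1))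
  | planProbe {par next} (hs : (S.ldr g).stage = .plan) (hp : S.newPos I ok g = S.pos g)
      (hr : S.nodeRec g (S.pos g) = some (par, next)) (hn : next < I.graph.degree (S.pos g))
      (hpar : par ≠ some next) :
      OwnCase g ({ S.ldr g with stage := .probe, port := next, fwd := true },
        .put (S.ldr g) (par, next + 1))
  | planBack {q next} (hs : (S.ldr g).stage = .plan) (hp : S.newPos I ok g = S.pos g)
      (hr : S.nodeRec g (S.pos g) = some (some q, next))
      (hn : I.graph.degree (S.pos g) ≤ next) :
      OwnCase g ({ S.ldr g with stage := .cross, port := q, fwd := false }, .nil)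
  | planEnd {next} (hs : (S.ldr g).stage = .plan) (hp : S.newPos I ok g = S.pos g)
      (hr : S.nodeRec g (S.pos g) = some (none, next))
      (hn : I.graph.degree (S.pos g) ≤ next) (hh : (S.ldr g).hold = true) :
      OwnCase g (S.ldr g, .nil)
  | planRestart {next} (hs : (S.ldr g).stage = .plan) (hp : S.newPos I ok g = S.pos g)
      (hr : S.nodeRec g (S.pos g) = some (none, next))
      (hn : I.graph.degree (S.pos g) ≤ next) (hh : (S.ldr g).hold = false) :
      OwnCase g (.initial S.clock, .root S.clock)
  | planNone (hs : (S.ldr g).stage = .plan) (hp : S.newPos I ok g = S.pos g)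
      (hr : S.nodeRec g (S.pos g) = none) : OwnCase g (S.ldr g, .nil)
  | probeStuck (hs : (S.ldr g).stage = .probe) (hp : S.newPos I ok g = S.pos g)
      (hok : ¬ ok g) (hh : (S.ldr g).hold = true) : OwnCase g (S.ldr g, .nil)
  | probeSkip (hs : (S.ldr g).stage = .probe) (hp : S.newPos I ok g = S.pos g)
      (hok : ¬ ok g) (hh : (S.ldr g).hold = false) :
      OwnCase g ({ S.ldr g with stage := .plan }, .nil)
  | probeOk (hs : (S.ldr g).stage = .probe) (hp : S.newPos I ok g = S.pos g)
      (hok : ok g) : OwnCase g ({ S.ldr g with stage := .test }, .nil)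
  | testStuck (hs : (S.ldr g).stage = .test) (hp : S.newPos I ok g = S.pos g)
      (hok : ¬ ok g) : OwnCase g (S.ldr g, .nil)
  | testOk (hs : (S.ldr g).stage = .test) (hp : S.newPos I ok g = S.pos g)
      (hok : ok g) (hf : S.far I g ≠ I.blackHole) :
      OwnCase g ({ S.ldr g with stage := .join }, .nil)
  | testFound (hs : (S.ldr g).stage = .test) (hp : S.newPos I ok g = S.pos g)
      (hok : ok g) (hf : S.far I g = I.blackHole) :
      OwnCase g ({ S.ldr g with stage := .found }, .nil)
  | joinStuck (hs : (S.ldr g).stage = .join) (hp : S.newPos I ok g = S.pos g)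
      (hok : ¬ ok g) : OwnCase g (S.ldr g, .nil)
  | crossStuck (hs : (S.ldr g).stage = .cross) (hp : S.newPos I ok g = S.pos g)
      (hok : ¬ ok g) (hh : (S.ldr g).hold = true) : OwnCase g (S.ldr g, .nil)
  | crossRestart (hs : (S.ldr g).stage = .cross) (hp : S.newPos I ok g = S.pos g)
      (hok : ¬ ok g) (hh : (S.ldr g).hold = false) :
      OwnCase g (.initial S.clock, .root S.clock)
  | pickup {fw} (hs : (S.ldr g).stage = .join) (hp : S.newPos I ok g = S.far I g) (hok : ok g)
      (ht : (S.board (S.far I g)).tok = some (S.rev I g, fw)) :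
      OwnCase g ({ S.ldr g with stage := .cross, port := S.rev I g, fwd := fw, hold := true },
        ⟨none, none, some none⟩)
  | arriveNew (hs : (S.ldr g).moving) (hp : S.newPos I ok g = S.far I g) (hok : ok g)
      (ht : (S.ldr g).stage = .join → ∀ fw, (S.board (S.far I g)).tok ≠ some (S.rev I g, fw))
      (hf : (S.ldr g).fwd = true) (hr : S.nodeRec g (S.far I g) = none) :
      OwnCase g ({ S.ldr g with stage := .plan }, .put (S.ldr g) (some (S.rev I g), 0))
  | arriveOld {r} (hs : (S.ldr g).moving) (hp : S.newPos I ok g = S.far I g) (hok : ok g)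
      (ht : (S.ldr g).stage = .join → ∀ fw, (S.board (S.far I g)).tok ≠ some (S.rev I g, fw))
      (hf : (S.ldr g).fwd = true) (hr : S.nodeRec g (S.far I g) = some r) :
      OwnCase g ({ S.ldr g with stage := .cross, port := S.rev I g, fwd := false }, .nil)
  | arriveBack (hs : (S.ldr g).moving) (hp : S.newPos I ok g = S.far I g) (hok : ok g)
      (ht : (S.ldr g).stage = .join → ∀ fw, (S.board (S.far I g)).tok ≠ some (S.rev I g, fw))
      (hf : (S.ldr g).fwd = false) :
      OwnCase g ({ S.ldr g with stage := .plan }, .nil)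
  | found (hs : (S.ldr g).stage = .found) (hp : S.newPos I ok g = S.pos g) :
      OwnCase g (S.ldr g, .nil)

theorem newPos_of_not {g : Bool} (h : ¬ ((S.ldr g).moving ∧ ok g)) :
    S.newPos I ok g = S.pos g := if_neg h

theorem newPos_of {g : Bool} (h : (S.ldr g).moving ∧ ok g) :
    S.newPos I ok g = S.far I g := if_pos h

theorem arrive_case {g : Bool} (hs : (S.ldr g).moving) (hok : ok g)
    (ht : (S.ldr g).stage = .join → ∀ fw, (S.board (S.far I g)).tok ≠ some (S.rev I g, fw)) :
    S.OwnCase I ok g (arrive (S.rev I g) (S.ldr g) (S.board (S.far I g))) := by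
  have hp := S.newPos_of I ok ⟨hs, hok⟩
  unfold arrive
  split_ifs with hf
  · split
    · rename_i hr; exact .arriveNew hs hp hok ht hf hr
    · rename_i hr; exact .arriveOld hs hp hok ht hf hr
  · exact .arriveBack hs hp hok ht (by simpa using hf)

theorem ownCase (g : Bool) : S.OwnCase I ok g (S.ownOut I ok g) := by
  unfold ownOut own
  cases hs : (S.ldr g).stage with
  | plan =>
    have hp := S.newPos_of_not I ok (g := g) (by simp [Ldr.moving, hs])
    have hn' : ∀ {n}, n < I.graph.degree (S.newPos I ok g) ↔ n < I.graph.degree (S.pos g) := by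
      intro n; rw [hp]
    simp only [planStep, hn']
    rw [hp]
    split
    · rename_i hr; exact .planNone hs hp hr
    · rename_i par next hr
      by_cases hn : next < I.graph.degree (S.pos g)
      · rw [if_pos hn]
        split_ifs with hpar
        · exact .planSkip hs hp hr hn hpar
        · exact .planProbe hs hp hr hn hpar
      · rw [if_neg hn]
        cases par with
        | some q => exact .planBack hs hp hr (not_lt.1 hn)
        | none =>
          dsimp only
          split_ifs with hh
          · exact .planEnd hs hp hr (not_lt.1 hn) hh
          · exact .planRestart hs hp hr (not_lt.1 hn) (by simpa using hh)
  | probe =>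
    have hp := S.newPos_of_not I ok (g := g) (by simp [Ldr.moving, hs])
    by_cases hok : ok g
    · simpa [hok] using OwnCase.probeOk hs hp hok
    · cases hh : (S.ldr g).hold with
      | true => simpa [hok] using OwnCase.probeStuck hs hp hok hh
      | false => simpa [hok, hh] using OwnCase.probeSkip hs hp hok hh
  | test =>
    have hp := S.newPos_of_not I ok (g := g) (by simp [Ldr.moving, hs])
    by_cases hok : ok g
    · by_cases hf : S.far I g = I.blackHole
      · simpa [hok, hf] using OwnCase.testFound hs hp hok hf
      · simpa [hok, hf] using OwnCase.testOk hs hp hok hf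
    · simpa [hok] using OwnCase.testStuck hs hp hok
  | join =>
    have hm : (S.ldr g).moving := by simp [Ldr.moving, hs]
    by_cases hok : ok g
    · have hp := S.newPos_of I ok ⟨hm, hok⟩
      simp only [hm, hok, and_self, decide_true, if_true, joined, hp]
      cases ht : (S.board (S.far I g)).tok with
      | none => exact arrive_case I S ok hm hok (by simp [ht])
      | some t =>
        obtain ⟨q, fw⟩ := t
        by_cases hq : q = S.rev I g
        · subst hq
          simpa using OwnCase.pickup hs hp hok ht
        · simp only [hq, if_false]
          exact arrive_case I S ok hm hok (by simp [ht, hq])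
    · have hp := S.newPos_of_not I ok (g := g) (by simp [hok])
      simpa [hok] using OwnCase.joinStuck hs hp hok
  | cross =>
    have hm : (S.ldr g).moving := by simp [Ldr.moving, hs]
    by_cases hok : ok g
    · have hp := S.newPos_of I ok ⟨hm, hok⟩
      simp only [hm, hok, and_self, decide_true, if_true, hp]
      exact arrive_case I S ok hm hok (by simp [hs])
    · have hp := S.newPos_of_not I ok (g := g) (by simp [hok])
      cases hh : (S.ldr g).hold with
      | true => simpa [hok] using OwnCase.crossStuck hs hp hok hh
      | false => simpa [hok] using OwnCase.crossRestart hs hp hok hh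
  | found =>
    have hp := S.newPos_of_not I ok (g := g) (by simp [Ldr.moving, hs])
    exact .found hs hp

/-- The leaders are at the same end of the same edge. -/
def Near (g g' : Bool) : Prop := S.pos g' = S.pos g ∧ (S.ldr g').port = (S.ldr g).port

/-- The leader of `g` is at the end of its edge which is opposite to the leader of `g'`. -/
def Opp (g g' : Bool) : Prop := S.far I g' = S.pos g ∧ S.rev I g' = (S.ldr g).port

/-- The possible reactions of group `g` to the other group. -/
inductive ReactCase (g : Bool) : Ldr × Edit → Prop
  | yieldNear (hh : (S.ldr g).hold = true) (hw : (S.ldr g).wants) (hs : (S.ldr !g).split)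
      (hn : S.Near g (!g)) : ReactCase g (.initial S.clock, .root S.clock)
  | yieldFar (hh : (S.ldr g).hold = true) (hw : (S.ldr g).wants) (hs : (S.ldr !g).split)
      (hn : S.Opp I g (!g)) (hne : S.pos (!g) ≠ S.pos g) : ReactCase g (.initial S.clock,
        (Edit.root S.clock).comp ⟨none, none, some (some ((S.ldr g).port, (S.ldr g).fwd))⟩)
  | take (hh : (S.ldr g).hold = false) (hs : (S.ldr g).split) (hh' : (S.ldr !g).hold = true)
      (hw : (S.ldr !g).wants) (hn : S.Near g (!g)) :
      ReactCase g ({ S.ldr g with hold := true, fwd := (S.ldr !g).fwd }, .nil)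
  | swap (ht : (S.ldr g).stage = .test) (hs : (S.ldr !g).split) (hn : S.Opp I g (!g))
      (hne : S.pos (!g) ≠ S.pos g) :
      ReactCase g ({ S.ldr g with stage := if (S.ldr g).hold then .cross else .plan }, .nil)
  | skip (hh : (S.ldr g).hold = false) (hp : (S.ldr g).stage = .probe)
      (hn : (S.Near g (!g) ∧ (S.ldr !g).engaged) ∨ (S.Opp I g (!g) ∧ (S.ldr !g).split)) :
      ReactCase g ({ S.ldr g with stage := .plan }, .nil)
  | keep (h1 : (S.ldr g).hold = true → (S.ldr g).wants → (S.ldr !g).split →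
        ¬ S.Near g (!g) ∧ (S.pos (!g) ≠ S.pos g → ¬ S.Opp I g (!g)))
      (h2 : (S.ldr g).hold = false → (S.ldr g).split → (S.ldr !g).hold = true →
        (S.ldr !g).wants → ¬ S.Near g (!g))
      (h3 : (S.ldr g).stage = .test → (S.ldr !g).split → S.pos (!g) ≠ S.pos g →
        ¬ S.Opp I g (!g))
      (h4 : (S.ldr g).hold = false → (S.ldr g).stage = .probe →
        ((S.ldr !g).engaged → ¬ S.Near g (!g)) ∧
        ((S.ldr !g).split → S.pos (!g) ≠ S.pos g → ¬ S.Opp I g (!g))) :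
      ReactCase g (S.ldr g, .nil)

theorem reactCase (g : Bool) :
    S.ReactCase I g (react S.clock (S.ldr g) (S.pres I (!g) (S.pos g))) := by
  have keepN : (∀ L, S.pres I (!g) (S.pos g) ≠ .lead L) →
      (∀ q, S.pres I (!g) (S.pos g) ≠ .lone q) → S.ReactCase I g (S.ldr g, .nil) := by
    intro hl hq
    by_cases hf : (S.ldr !g).stage = .found
    · exact .keep (by simp [Ldr.split, hf]) (by simp [Ldr.wants, hf]) (by simp [Ldr.split, hf])
        (by simp [Ldr.engaged, Ldr.split, Ldr.wants, hf])
    · have hne : S.pos (!g) ≠ S.pos g := fun h => hl (S.ldr !g) (by simp [pres, hf, h])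
      have hne2 : (S.ldr !g).split → ¬ S.Opp I g (!g) :=
        fun h1 h2 => hq (S.rev I !g) (by simp [pres, hf, h1, h2.1, hne])
      exact .keep (fun _ _ h => ⟨fun h => hne h.1, fun _ => hne2 h⟩) (fun _ _ _ _ h => hne h.1)
        (fun _ h _ => hne2 h) (fun _ _ => ⟨fun _ h => hne h.1, fun h _ => hne2 h⟩)
  cases hP : S.pres I (!g) (S.pos g) with
  | absent => exact keepN (by simp [hP]) (by simp [hP])
  | lead M =>
    obtain ⟨hpos, rfl⟩ : S.pos (!g) = S.pos g ∧ S.ldr (!g) = M := by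
      unfold pres at hP; split_ifs at hP with h1 h2 h3; all_goals simp_all
    simp only [react]
    split_ifs with h1 h2 h3 h4
    · exact .keep (fun _ _ _ => ⟨fun h => h1 h.2, fun h => (h hpos).elim⟩)
        (fun _ _ _ _ h => h1 h.2) (fun _ _ h => (h hpos).elim)
        (fun _ _ => ⟨fun _ h => h1 h.2, fun _ h => (h hpos).elim⟩)
    · exact .yieldNear h2.1 h2.2.1 h2.2.2 ⟨hpos, not_not.1 h1⟩
    · exact .take (by simpa using h3.1) h3.2.1 h3.2.2.1 h3.2.2.2 ⟨hpos, not_not.1 h1⟩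
    · exact .skip (by simpa using h4.1) h4.2.1 (.inl ⟨⟨hpos, not_not.1 h1⟩, h4.2.2⟩)
    · exact .keep (fun a b c => (h2 ⟨a, b, c⟩).elim)
        (fun a b c d => (h3 ⟨by simpa using a, b, c, d⟩).elim) (fun _ _ h => (h hpos).elim)
        (fun a b => ⟨fun c => (h4 ⟨by simpa using a, b, c⟩).elim, fun _ h => (h hpos).elim⟩)
  | lone q =>
    obtain ⟨hpos, hs, hf, rfl⟩ : S.pos (!g) ≠ S.pos g ∧ (S.ldr !g).split ∧
        S.far I (!g) = S.pos g ∧ S.rev I (!g) = q := by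
      unfold pres at hP; split_ifs at hP with h1 h2 h3; all_goals simp_all
    simp only [react]
    by_cases h1 : S.rev I (!g) = (S.ldr g).port
    swap
    · rw [if_pos h1]
      exact .keep (fun _ _ _ => ⟨fun h => hpos h.1, fun _ h => h1 h.2⟩)
        (fun _ _ _ _ h => hpos h.1) (fun _ _ _ h => h1 h.2)
        (fun _ _ => ⟨fun _ h => hpos h.1, fun _ _ h => h1 h.2⟩)
    rw [if_neg (not_not.2 h1)]
    by_cases h2 : (S.ldr g).stage = .test
    · rw [if_pos h2]; exact .swap h2 hs ⟨hf, h1⟩ hpos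
    rw [if_neg h2]
    split_ifs with h3 h4
    · rw [h1]; exact .yieldFar h3.1 h3.2 hs ⟨hf, h1⟩ hpos
    · exact .skip (by simpa using h4.1) h4.2 (.inr ⟨⟨hf, h1⟩, hs⟩)
    · exact .keep (fun a b => (h3 ⟨a, b⟩).elim) (fun _ _ _ _ h => hpos h.1)
        (fun a => (h2 a).elim) (fun a b => (h4 ⟨by simpa using a, b⟩).elim)

end Sys

end BHS

namespace BHS

open RootedInstance

variable {V : Type*} [Fintype V] [DecidableEq V] {f k : ℕ} (I : RootedInstance V f k)

/-! ### Invariants of a single group -/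

/-- An exploring group crosses as a whole only backwards (`cross_back`), because its forward moves
go through the stages `probe`, `test` and `join`. This is why a blocked crossing means that its way
back is blocked. -/
structure LdrOk (v : V) (L : Ldr) : Prop where
  pos_ne : v ≠ I.blackHole
  port_lt : L.stage ≠ .plan → L.port < I.graph.degree v
  safe : L.moving → I.far v L.port ≠ I.blackHole
  found : L.stage = .found → I.far v L.port = I.blackHole
  probe_fwd : L.stage = .probe → L.fwd = true
  cross_back : L.stage = .cross → L.hold = false → L.fwd = false

/-- The port to the parent leads to a safe node. -/
def ParOk (w : V) (r : NodeRec) : Prop :=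
  ∀ q, r.1 = some q → q < I.graph.degree w ∧ I.far w q ≠ I.blackHole

def BoardOk (w : V) (h : Option NodeRec) (x : Option (ℕ × NodeRec)) : Prop :=
  (∀ r, h = some r → ParOk I w r) ∧ ∀ r, x = some r → ParOk I w r.2

variable {I}

theorem BoardOk.none {w : V} : BoardOk I w none none := ⟨by simp, by simp⟩

theorem BoardOk.or {w : V} {h h' : Option NodeRec} {x x' : Option (ℕ × NodeRec)}
    (h1 : BoardOk I w h x) (h2 : BoardOk I w h' x') : BoardOk I w (h <|> h') (x <|> x') := by
  constructor
  · intro r hr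
    cases h with
    | none => exact h2.1 r (by simpa using hr)
    | some a => exact h1.1 r (by simpa using hr)
  · intro r hr
    cases x with
    | none => exact h2.2 r (by simpa using hr)
    | some a => exact h1.2 r (by simpa using hr)

theorem BoardOk.put {w : V} {L : Ldr} {r : NodeRec} (h : ParOk I w r) :
    BoardOk I w (Edit.put L r).h (Edit.put L r).x := by
  unfold Edit.put
  split_ifs
  · exact ⟨by rintro _ ⟨⟩; exact h, by simp⟩
  · exact ⟨by simp, by rintro _ ⟨⟩; exact h⟩

theorem BoardOk.root {w : V} {c : ℕ} : BoardOk I w (Edit.root c).h (Edit.root c).x :=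
  ⟨by simp [Edit.root], by rintro _ ⟨⟩ _ ⟨⟩⟩

theorem LdrOk.initial {v : V} {c : ℕ} (h : v ≠ I.blackHole) : LdrOk I v (.initial c) :=
  ⟨h, by simp [Ldr.initial], by simp [Ldr.initial, Ldr.moving], by simp [Ldr.initial],
    by simp [Ldr.initial], by simp [Ldr.initial]⟩

theorem LdrOk.plan {v : V} {L : Ldr} (h : v ≠ I.blackHole) :
    LdrOk I v { L with stage := .plan } :=
  ⟨h, by simp, by simp [Ldr.moving], by simp, by simp, by simp⟩

theorem LdrOk.far_far {v : V} {L : Ldr} (h : LdrOk I v L) (hs : L.stage ≠ .plan) :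
    I.far (I.far v L.port) (I.rev v L.port) = v := RootedInstance.far_far (h.port_lt hs)

theorem LdrOk.rev_rev {v : V} {L : Ldr} (h : LdrOk I v L) (hs : L.stage ≠ .plan) :
    I.rev (I.far v L.port) (I.rev v L.port) = L.port := RootedInstance.rev_rev (h.port_lt hs)

theorem Ldr.engaged.ne_plan {L : Ldr} (h : L.engaged) : L.stage ≠ .plan := by
  intro h'; simp [engaged, wants, split, h'] at h

theorem Ldr.moving.ne_plan {L : Ldr} (h : L.moving) : L.stage ≠ .plan := by
  intro h'; simp [moving, h'] at h

theorem Ldr.split.ne_plan {L : Ldr} (h : L.split) : L.stage ≠ .plan := by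
  intro h'; simp [split, h'] at h

theorem Ldr.wants.ne_plan {L : Ldr} (h : L.wants) : L.stage ≠ .plan := by
  intro h'; simp [wants, h'] at h

namespace Sys

variable (I) (S : Sys V) (ok : Bool → Prop)

structure Wf : Prop where
  ldr : ∀ g, LdrOk I (S.pos g) (S.ldr g)
  board : ∀ w, BoardOk I w (S.board w).h (S.board w).x

variable {I S ok}

theorem Wf.rec_parOk (hS : S.Wf I) {g : Bool} {w : V} {r : NodeRec} (h : S.nodeRec g w = some r) :
    ParOk I w r := by
  unfold nodeRec Ldr.getRec at h
  split_ifs at h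
  · exact (hS.board w).1 r h
  · cases hx : (S.board w).x with
    | none => simp [hx] at h
    | some e =>
      obtain ⟨e, r'⟩ := e
      simp only [hx, Option.bind_some, Option.ite_none_right_eq_some, Option.some.injEq] at h
      obtain ⟨-, rfl⟩ := h
      exact (hS.board w).2 _ hx

/-- A leader moves only in the stages `join` and `cross`. The first requires that the scout has
returned from the far end; in the second the far end is a parent or the node just left. -/
theorem OwnCase.valid (hS : S.Wf I) {g : Bool} {r : Ldr × Edit} (h : S.OwnCase I ok g r) :
    LdrOk I (S.newPos I ok g) r.1 ∧ BoardOk I (S.newPos I ok g) r.2.h r.2.x := by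
  have hL := hS.ldr g
  cases h with
  | planSkip hs hp hr hn hpar =>
    rw [hp]; exact ⟨hL, .put fun q hq => hS.rec_parOk hr q hq⟩
  | planProbe hs hp hr hn hpar =>
    rw [hp]
    exact ⟨⟨hL.pos_ne, fun _ => hn, by simp [Ldr.moving], by simp, by simp, by simp⟩,
      .put fun q hq => hS.rec_parOk hr q hq⟩
  | planBack hs hp hr hn =>
    rw [hp]
    have := hS.rec_parOk hr _ rfl
    exact ⟨⟨hL.pos_ne, fun _ => this.1, fun _ => this.2, by simp, by simp, by simp⟩, .none⟩
  | planEnd hs hp => rw [hp]; exact ⟨hL, .none⟩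
  | planRestart hs hp => rw [hp]; exact ⟨.initial hL.pos_ne, .root⟩
  | planNone hs hp => rw [hp]; exact ⟨hL, .none⟩
  | probeStuck hs hp => rw [hp]; exact ⟨hL, .none⟩
  | probeSkip hs hp => rw [hp]; exact ⟨.plan hL.pos_ne, .none⟩
  | probeOk hs hp =>
    rw [hp]
    exact ⟨⟨hL.pos_ne, fun _ => hL.port_lt (by simp [hs]), by simp [Ldr.moving], by simp,
      by simp, by simp⟩, .none⟩
  | testStuck hs hp => rw [hp]; exact ⟨hL, .none⟩
  | testOk hs hp hok hf =>
    rw [hp]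
    exact ⟨⟨hL.pos_ne, fun _ => hL.port_lt (by simp [hs]), fun _ => hf, by simp, by simp, by simp⟩, .none⟩
  | testFound hs hp hok hf =>
    rw [hp]
    exact ⟨⟨hL.pos_ne, fun _ => hL.port_lt (by simp [hs]), by simp [Ldr.moving], fun _ => hf,
      by simp, by simp⟩, .none⟩
  | joinStuck hs hp => rw [hp]; exact ⟨hL, .none⟩
  | crossStuck hs hp => rw [hp]; exact ⟨hL, .none⟩
  | crossRestart hs hp => rw [hp]; exact ⟨.initial hL.pos_ne, .root⟩
  | pickup hs hp =>
    rw [hp]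
    have hm : (S.ldr g).moving := .inl hs
    exact ⟨⟨hL.safe hm, fun _ => rev_lt (hL.port_lt hm.ne_plan),
      fun _ => by
        have := hL.far_far hm.ne_plan
        simp only [Sys.far, Sys.rev, this]; exact hL.pos_ne, by simp, by simp, by simp⟩, .none⟩
  | arriveNew hm hp =>
    rw [hp]
    refine ⟨.plan (hL.safe hm), .put ?_⟩
    rintro q ⟨⟩
    refine ⟨rev_lt (hL.port_lt hm.ne_plan), ?_⟩
    have := hL.far_far hm.ne_plan
    simp only [Sys.far, Sys.rev, this]; exact hL.pos_ne
  | arriveOld hm hp =>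
    rw [hp]
    exact ⟨⟨hL.safe hm, fun _ => rev_lt (hL.port_lt hm.ne_plan),
      fun _ => by
        have := hL.far_far hm.ne_plan
        simp only [Sys.far, Sys.rev, this]; exact hL.pos_ne, by simp, by simp, by simp⟩, .none⟩
  | arriveBack hm hp => rw [hp]; exact ⟨.plan (hL.safe hm), .none⟩
  | found hs hp => rw [hp]; exact ⟨hL, .none⟩

theorem Wf.half (hS : S.Wf I) : (S.half I ok).Wf I :=
  ⟨fun g => ((S.ownCase I ok g).valid hS).1, hS.board⟩

theorem Wf.opp (hS : S.Wf I) {g g' : Bool} (h : S.Opp I g g') (hs : (S.ldr g').stage ≠ .plan) :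
    S.Opp I g' g := by
  obtain ⟨h1, h2⟩ := h
  unfold Opp Sys.far Sys.rev
  rw [← h1, ← h2]
  exact ⟨(hS.ldr g').far_far hs, (hS.ldr g').rev_rev hs⟩

theorem Wf.opp_ne (hS : S.Wf I) {g g' : Bool} (h : S.Opp I g g') (hs : (S.ldr g').stage ≠ .plan) :
    S.pos g' ≠ S.pos g := by
  rw [← h.1]; exact (far_ne ((hS.ldr g').port_lt hs)).symm

theorem Wf.sameEdge (hS : S.Wf I) {g g' : Bool} (h : S.SameEdge I g g')
    (hs : (S.ldr g).stage ≠ .plan) : S.Near g g' ∨ S.Opp I g g' := by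
  rcases h with h | h
  · exact .inl ⟨h.1.symm, h.2.symm⟩
  · exact .inr (hS.opp (g := g') (g' := g) h hs)

theorem Near.symm {g g' : Bool} (h : S.Near g g') : S.Near g' g := ⟨h.1.symm, h.2.symm⟩

theorem Near.sameEdge {g g' : Bool} (h : S.Near g g') : S.SameEdge I g g' :=
  .inl ⟨h.1.symm, h.2.symm⟩

theorem Opp.sameEdge {g g' : Bool} (h : S.Opp I g g') : S.SameEdge I g' g := .inr h

theorem ReactCase.valid (hS : S.Wf I) {g : Bool} {r : Ldr × Edit} (h : S.ReactCase I g r) :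
    LdrOk I (S.pos g) r.1 ∧ BoardOk I (S.pos g) r.2.h r.2.x := by
  have hL := hS.ldr g
  cases h with
  | yieldNear => exact ⟨.initial hL.pos_ne, .root⟩
  | yieldFar => exact ⟨.initial hL.pos_ne, .or .none .root⟩
  | take hh hs =>
    exact ⟨⟨hL.pos_ne, hL.port_lt, hL.safe, hL.found,
      fun h => by rcases hs with h' | h' <;> simp [h'] at h, by simp⟩, .none⟩
  | swap ht hs hn =>
    refine ⟨?_, .none⟩
    split_ifs with hh
    -- The far end is where the other leader stands, hence it is safe.
    · have h2 := hS.opp hn hs.ne_plan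
      exact ⟨hL.pos_ne, fun _ => hL.port_lt (by simp [ht]),
        fun _ => by
          have h1 : I.far (S.pos g) (S.ldr g).port = S.pos !g := h2.1
          rw [h1]; exact (hS.ldr !g).pos_ne,
        by simp, by simp, by simp [hh]⟩
    · exact .plan hL.pos_ne
  | skip => exact ⟨.plan hL.pos_ne, .none⟩
  | keep => exact ⟨hL, .none⟩

theorem reactOut_case (g : Bool) : (S.half I ok).ReactCase I g (S.reactOut I ok g) :=
  reactCase I (S.half I ok) g

theorem Wf.next (hS : S.Wf I) : (S.next I ok).Wf I := by
  have hr : ∀ g, _ := fun g => (reactOut_case (I := I) (S := S) (ok := ok) g).valid hS.half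
  have he : ∀ g, BoardOk I (S.newPos I ok g) (S.edit I ok g).h (S.edit I ok g).x :=
    fun g => .or (hr g).2 ((S.ownCase I ok g).valid hS).2
  refine ⟨fun g => (hr g).1, fun w => ?_⟩
  have hn : ∀ g, BoardOk I w (if S.newPos I ok g = w then S.edit I ok g else .nil).h
      (if S.newPos I ok g = w then S.edit I ok g else .nil).x := by
    intro g; split_ifs with h
    · exact h ▸ he g
    · exact .none
  exact .or (hn true) (.or (hn false) (hS.board w))

/-! ### Invariants of the two groups while the black hole has not been found -/

variable (I S ok)

/-- The group `h` is the holding one, or is about to become it. -/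
structure Duo (h : Bool) : Prop where
  unfound : ∀ g, (S.ldr g).stage ≠ .found
  hold : (S.ldr !h).hold = false
  tok : ((S.ldr h).hold = true ∧ ∀ w, (S.board w).tok = none) ∨
    ((S.ldr h).hold = false ∧ (S.ldr h).split ∧
      (∃ fw, (S.board (S.far I h)).tok = some (S.rev I h, fw)) ∧
      ∀ w, w ≠ S.far I h → (S.board w).tok = none)
  split_split : ∀ g, (S.ldr g).split → (S.ldr !g).split → ¬ S.SameEdge I g !g
  split_probe : ∀ g, (S.ldr g).split → (S.ldr !g).stage = .probe → ¬ S.SameEdge I g !g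
  probe_probe : ∀ g, (S.ldr g).stage = .probe → (S.ldr !g).stage = .probe → ¬ S.Near g !g
  wants_split : (S.ldr h).wants → (S.ldr !h).split → ¬ S.SameEdge I h !h

/-- Both groups notice whether an edge is present. -/
def Coherent : Prop :=
  ∀ g, (S.ldr g).engaged → (S.ldr !g).engaged → S.SameEdge I g !g → (ok g ↔ ok !g)

variable {I S ok}

theorem OwnCase.split {g : Bool} {r : Ldr × Edit} (h : S.OwnCase I ok g r) (hs : r.1.split) :
    S.newPos I ok g = S.pos g ∧ r.1.port = (S.ldr g).port ∧ r.1.hold = (S.ldr g).hold ∧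
      r.1.fwd = (S.ldr g).fwd ∧ r.2 = .nil ∧
      ((S.ldr g).stage = .probe ∧ ok g ∧ r.1.stage = .test ∨
        (S.ldr g).split ∧ (r.1.stage = (S.ldr g).stage ∧ ¬ ok g ∨
          (S.ldr g).stage = .test ∧ r.1.stage = .join ∧ ok g)) := by
  cases h <;> simp_all [Ldr.split, Ldr.initial, Edit.nil]

theorem half_split {g : Bool} (hs : ((S.half I ok).ldr g).split) :
    (S.half I ok).pos g = S.pos g ∧ ((S.half I ok).ldr g).port = (S.ldr g).port ∧
      ((S.half I ok).ldr g).hold = (S.ldr g).hold ∧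
      ((S.half I ok).ldr g).fwd = (S.ldr g).fwd ∧
      ((S.ldr g).stage = .probe ∧ ok g ∧ ((S.half I ok).ldr g).stage = .test ∨
        (S.ldr g).split ∧ (((S.half I ok).ldr g).stage = (S.ldr g).stage ∧ ¬ ok g ∨
          (S.ldr g).stage = .test ∧ ((S.half I ok).ldr g).stage = .join ∧ ok g)) := by
  obtain ⟨h1, h2, h3, h4, -, h5⟩ := (S.ownCase I ok g).split hs
  exact ⟨h1, h2, h3, h4, h5⟩

theorem half_sameEdge {g : Bool} (hs : ((S.half I ok).ldr g).split)
    (hs' : ((S.half I ok).ldr !g).split) (h : (S.half I ok).SameEdge I g !g) :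
    S.SameEdge I g !g := by
  obtain ⟨h1, h2, -⟩ := half_split hs
  obtain ⟨h1', h2', -⟩ := half_split hs'
  unfold SameEdge at *
  rwa [h1, h2, h1', h2'] at h

theorem Duo.hold_of_not_split {h : Bool} (hD : S.Duo I h) (hs : ¬ (S.ldr h).split) :
    (S.ldr h).hold = true := by
  rcases hD.tok with h1 | h1
  · exact h1.1
  · exact (hs h1.2.1).elim

/-- Two groups which become separated over the same edge come from its two ends. -/
theorem Duo.half_split_split {h : Bool} (hS : S.Wf I) (hD : S.Duo I h) {g : Bool}
    (hs : ((S.half I ok).ldr g).split) (hs' : ((S.half I ok).ldr !g).split)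
    (he : (S.half I ok).SameEdge I g !g) :
    (S.ldr g).stage = .probe ∧ (S.ldr !g).stage = .probe ∧
      ((S.half I ok).ldr g).stage = .test ∧ ((S.half I ok).ldr !g).stage = .test ∧
      ok g ∧ ok (!g) ∧ (S.half I ok).Opp I g !g := by
  have he' := half_sameEdge hs hs' he
  have hoe := (hS.half (ok := ok)).sameEdge he hs.ne_plan
  obtain ⟨h1, h2, h3, h4, h5⟩ := half_split hs
  obtain ⟨h1', h2', h3', h4', h5'⟩ := half_split hs'
  rcases h5 with ⟨p1, p2, p3⟩ | ⟨p1, -⟩ <;> rcases h5' with ⟨q1, q2, q3⟩ | ⟨q1, -⟩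
  · refine ⟨p1, q1, p3, q3, p2, q2, hoe.resolve_left fun hn => hD.probe_probe g p1 q1 ?_⟩
    unfold Near at *
    rwa [h1, h2, h1', h2'] at hn
  · refine (hD.split_probe (!g) q1 (by simpa using p1) ?_).elim
    rw [Bool.not_not]
    exact RootedInstance.SameEdge.symm ((hS.ldr g).port_lt (by simp [p1])) he'
  · exact (hD.split_probe g p1 q1 he').elim
  · exact (hD.split_split g p1 q1 he').elim

/-- A group without a token for it does not become the holding one. -/
theorem Duo.no_pickup {h : Bool} (hS : S.Wf I) (hD : S.Duo I h) {fw : Bool}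
    (hs : (S.ldr !h).split) :
    (S.board (S.far I !h)).tok ≠ some (S.rev I !h, fw) := by
  intro ht
  rcases hD.tok with ⟨-, h1⟩ | ⟨-, hsp, ⟨fw', h2⟩, h3⟩
  · simp [h1] at ht
  · have hf : S.far I (!h) = S.far I h := by
      by_contra hne; simp [h3 _ hne] at ht
    rw [hf, h2, Option.some.injEq, Prod.mk.injEq] at ht
    -- The token lies at the far end of the edge of the group it is meant for, with its port there;
    -- a second group which could pick it up would be separated over the same edge.
    refine hD.split_split h hsp hs (.inl ?_)
    have e1 := (hS.ldr h).far_far hsp.ne_plan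
    have e2 := (hS.ldr !h).far_far hs.ne_plan
    have e3 := (hS.ldr h).rev_rev hsp.ne_plan
    have e4 := (hS.ldr !h).rev_rev hs.ne_plan
    unfold Sys.far at hf
    unfold Sys.rev at ht
    rw [hf, ← ht.1] at e2 e4
    exact ⟨e1.symm.trans e2, e3.symm.trans e4⟩

theorem OwnCase.hold {g : Bool} {r : Ldr × Edit} (h : S.OwnCase I ok g r) :
    r.1.hold = (S.ldr g).hold ∨ (r.1.hold = false ∧ (S.ldr g).hold = false) ∨
      ((S.ldr g).stage = .join ∧ ∃ fw, (S.board (S.far I g)).tok = some (S.rev I g, fw)) := by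
  cases h with
  | pickup hs hp hok ht => exact .inr (.inr ⟨hs, _, ht⟩)
  | planRestart hs hp hr hn hh => exact .inr (.inl ⟨rfl, hh⟩)
  | crossRestart hs hp hok hh => exact .inr (.inl ⟨rfl, hh⟩)
  | _ => exact .inl rfl

theorem Duo.half_hold_not {h : Bool} (hS : S.Wf I) (hD : S.Duo I h) :
    ((S.half I ok).ldr !h).hold = false := by
  rcases (S.ownCase I ok !h).hold with h1 | h1 | ⟨h1, fw, h2⟩
  · exact h1.trans hD.hold
  · exact h1.1
  · exact (hD.no_pickup hS (.inr h1) h2).elim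

/-- The holding group after its own step. -/
theorem Duo.half_hold {h : Bool} (hD : S.Duo I h) :
    ((S.half I ok).ldr h).hold = true ∨ ((S.half I ok).ldr h).stage = .found ∨
      (((S.half I ok).ldr h).split ∧ ((S.half I ok).ldr h).hold = false) := by
  rcases hD.tok with ⟨h1, -⟩ | ⟨h1, h2, ⟨fw, h3⟩, -⟩
  · have := S.ownCase I ok h
    change (S.ownOut I ok h).1.hold = true ∨ _
    left
    rcases this.hold with h4 | h4 | ⟨h4, -⟩
    · exact h4.trans h1
    · simp [h1] at h4
    · generalize S.ownOut I ok h = r at this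
      cases this <;> simp_all
  · have := S.ownCase I ok h
    change (S.ownOut I ok h).1.hold = true ∨ (S.ownOut I ok h).1.stage = _ ∨
      ((S.ownOut I ok h).1.split ∧ (S.ownOut I ok h).1.hold = false)
    generalize S.ownOut I ok h = r at this
    cases this <;> simp_all [Ldr.split, Ldr.moving]

variable (I S ok) in
/-- The possible reactions of the holding group and of the other one. -/
inductive PairCase (h : Bool) : Prop
  | keep (e1 : S.reactOut I ok h = ((S.half I ok).ldr h, .nil))
      (e2 : S.reactOut I ok (!h) = ((S.half I ok).ldr !h, .nil))
      (n1 : ∀ g, ((S.half I ok).ldr g).split → ((S.half I ok).ldr !g).engaged →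
        ¬ ((S.half I ok).ldr !g).stage = .cross → ¬ (S.half I ok).SameEdge I g !g)
      (n2 : ∀ g, ((S.half I ok).ldr g).stage = .probe → ((S.half I ok).ldr !g).stage = .probe →
        ¬ (S.half I ok).Near g !g)
      (n3 : ((S.half I ok).ldr h).wants → ((S.half I ok).ldr !h).split →
        ¬ (S.half I ok).SameEdge I h !h)
  | yieldNear (hh : ((S.half I ok).ldr h).hold = true) (hw : ((S.half I ok).ldr h).wants)
      (hs : ((S.half I ok).ldr !h).split) (hn : (S.half I ok).Near h !h)
      (e1 : S.reactOut I ok h = (.initial S.clock, .root S.clock))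
      (e2 : S.reactOut I ok (!h) = ({ (S.half I ok).ldr !h with
        hold := true, fwd := ((S.half I ok).ldr h).fwd }, .nil))
  | yieldFar (hh : ((S.half I ok).ldr h).hold = true) (hw : ((S.half I ok).ldr h).wants)
      (hs : ((S.half I ok).ldr !h).split) (hn : (S.half I ok).Opp I h !h)
      (e1 : S.reactOut I ok h = (.initial S.clock, (Edit.root S.clock).comp
        ⟨none, none, some (some (((S.half I ok).ldr h).port, ((S.half I ok).ldr h).fwd))⟩))
      (e2 : S.reactOut I ok (!h) = ((S.half I ok).ldr !h, .nil))
  | swap (hh : ((S.half I ok).ldr h).hold = true) (hp : (S.ldr h).stage = .probe)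
      (hp' : (S.ldr !h).stage = .probe) (hok : ok h)
      (ht : ((S.half I ok).ldr h).stage = .test) (ht' : ((S.half I ok).ldr !h).stage = .test)
      (hn : (S.half I ok).Opp I h !h)
      (e1 : S.reactOut I ok h = ({ (S.half I ok).ldr h with stage := .cross }, .nil))
      (e2 : S.reactOut I ok (!h) = ({ (S.half I ok).ldr !h with stage := .plan }, .nil))
  | skip (he : (S.half I ok).SameEdge I h !h) (hn : ((S.half I ok).ldr h).engaged)
      (hp : ((S.half I ok).ldr !h).stage = .probe)
      (e1 : S.reactOut I ok h = ((S.half I ok).ldr h, .nil))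
      (e2 : S.reactOut I ok (!h) = ({ (S.half I ok).ldr !h with stage := .plan }, .nil))

/-- Each reaction of one group forces the matching reaction of the other, because both refer to the
same intermediate state. If neither reacts, the negated conditions of the reactions are just the
exclusions that `Duo` demands of the new state. -/
theorem Duo.pairCase {h : Bool} (hS : S.Wf I) (hD : S.Duo I h) : S.PairCase I ok h := by
  have hH := hS.half (ok := ok)
  have c1 := reactOut_case (I := I) (S := S) (ok := ok) h
  have c2 := reactOut_case (I := I) (S := S) (ok := ok) (!h)
  have hx := hD.half_hold_not hS (ok := ok)
  have hss := fun g => hD.half_split_split hS (ok := ok) (g := g)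
  have hho := hD.half_hold (ok := ok)
  have hc : (S.half I ok).clock = S.clock := rfl
  generalize r1 : S.reactOut I ok h = o1 at c1
  generalize r2 : S.reactOut I ok (!h) = o2 at c2
  cases c1 with
  | yieldNear hh hw hs hn =>
    have : ¬ ((S.half I ok).ldr h).split := by
      rcases hw with a | a <;> simp [Ldr.split, a]
    cases c2 with
    | take => exact .yieldNear hh hw hs hn r1 (by simpa using r2)
    | keep _ h2 =>
      simp only [Bool.not_not] at h2
      exact (h2 hx hs hh hw hn.symm).elim
    | skip _ hp => rcases hs with a | a <;> simp [a] at hp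
    | _ => simp_all
  | yieldFar hh hw hs hn hne =>
    have : ¬ ((S.half I ok).ldr h).split := by
      rcases hw with a | a <;> simp [Ldr.split, a]
    cases c2 with
    | keep => exact .yieldFar hh hw hs hn r1 r2
    | take _ _ _ _ hn' => exact (hne (by simpa using hn'.1.symm)).elim
    | skip _ hp => rcases hs with a | a <;> simp [a] at hp
    | _ => simp_all
  | take _ _ hh' => simp [hx] at hh'
  | swap ht hs hn hne =>
    have hsp : ((S.half I ok).ldr h).split := .inl ht
    have he : (S.half I ok).SameEdge I h !h := by
      have := hn.sameEdge.symm ((hH.ldr !h).port_lt hs.ne_plan)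
      exact this
    obtain ⟨p1, p2, p3, p4, p5, p6, p7⟩ := hss h hsp hs he
    have hh : ((S.half I ok).ldr h).hold = true := by
      rw [(half_split hsp).2.2.1]
      exact hD.hold_of_not_split (by simp [Ldr.split, p1])
    have hn' := hH.opp hn hs.ne_plan
    cases c2 with
    | swap => exact .swap hh p1 p2 p5 p3 p4 hn (by simpa [hh] using r1) (by simpa [hx] using r2)
    | keep _ _ h3 =>
      simp only [Bool.not_not] at h3
      exact (h3 p4 hsp hne.symm hn').elim
    | take _ _ _ hw => rcases hw with a | a <;> simp [p3] at a
    | skip _ hp => simp [p4] at hp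
    | _ => simp_all
  | skip hh hp =>
    rcases hho with a | a | a
    · simp [hh] at a
    · simp [hp] at a
    · rcases a.1 with b | b <;> simp [hp] at b
  | keep h1 h2 h3 h4 =>
    cases c2 with
    | yieldNear hh => simp [hx] at hh
    | yieldFar hh => simp [hx] at hh
    | take _ hs hh hw hn =>
      simp only [Bool.not_not] at hh hw hn
      exact ((h1 hh hw hs).1 hn.symm).elim
    | swap ht hs hn hne =>
      simp only [Bool.not_not] at hs hn hne
      have hs' : ((S.half I ok).ldr !h).split := .inl ht
      obtain ⟨p1, p2, p3, p4, p5, p6, p7⟩ := hss h hs hs' hn.sameEdge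
      exact (h3 p3 hs' hne.symm p7).elim
    | skip _ hp hn =>
      simp only [Bool.not_not] at hn
      refine .skip ?_ ?_ hp r1 r2
      · rcases hn with hn | hn
        · exact hn.1.symm.sameEdge
        · exact hn.1.sameEdge
      · rcases hn with hn | hn
        · exact hn.2
        · exact .inr hn.2
    | keep k1 k2 k3 k4 =>
      simp only [Bool.not_not] at k1 k2 k3 k4
      have sy : (S.half I ok).SameEdge I (!h) h → ((S.half I ok).ldr !h).stage ≠ .plan →
          (S.half I ok).SameEdge I h (!h) := fun a b => a.symm ((hH.ldr !h).port_lt b)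
      -- Two engagements on the same edge are either at the same end or at opposite ends, and in
      -- each case one of the groups would have noticed the other and reacted.
      have hA : ((S.half I ok).ldr h).split → ((S.half I ok).ldr !h).split →
          ¬ (S.half I ok).SameEdge I h !h := by
        intro a b c
        obtain ⟨p1, p2, p3, p4, p5, p6, p7⟩ := hss h a b c
        exact h3 p3 b (hH.opp_ne p7 b.ne_plan) p7
      have hB : ((S.half I ok).ldr h).wants → ((S.half I ok).ldr !h).split →
          ¬ (S.half I ok).SameEdge I h !h := by
        intro a b c
        have hh : ((S.half I ok).ldr h).hold = true := by
          rcases hho with d | d | d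
          · exact d
          · rcases a with a | a <;> simp [d] at a
          · rcases a with a | a <;> simp [Ldr.split, a] at d
        rcases hH.sameEdge c a.ne_plan with d | d
        · exact (h1 hh a b).1 d
        · exact (h1 hh a b).2 (hH.opp_ne d b.ne_plan) d
      have hC : ((S.half I ok).ldr h).split → ((S.half I ok).ldr !h).stage = .probe →
          ¬ (S.half I ok).SameEdge I h !h := by
        intro a b c
        rcases hH.sameEdge c a.ne_plan with d | d
        · exact (k4 hx b).1 (.inr a) d.symm
        · have d' := hH.opp d (by simp [b])
          exact (k4 hx b).2 a (hH.opp_ne d' a.ne_plan) d'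
      have hE : ((S.half I ok).ldr h).stage = .probe → ((S.half I ok).ldr !h).stage = .probe →
          ¬ (S.half I ok).Near h !h := fun a b c => (k4 hx b).1 (.inl (.inl a)) c.symm
      refine .keep r1 r2 ?_ ?_ hB
      · intro g a b c d
        obtain rfl | rfl : g = h ∨ g = !h := by cases g <;> cases h <;> simp
        · rcases b with (b | b) | b
          · exact hC a b d
          · exact c b
          · exact hA a b d
        · simp only [Bool.not_not] at b c d
          have d := sy d a.ne_plan
          rcases b with b | b
          · exact hB b a d
          · exact hA b a d
      · intro g a b c
        obtain rfl | rfl : g = h ∨ g = !h := by cases g <;> cases h <;> simp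
        · exact hE a b c
        · simp only [Bool.not_not] at b c
          exact hE b a c.symm

end Sys

end BHS

namespace BHS

open RootedInstance

variable {V : Type*} [Fintype V] [DecidableEq V] {f k : ℕ} {I : RootedInstance V f k}

namespace Sys

variable {S : Sys V} {ok : Bool → Prop}

/-! ### The whiteboards after a step -/

theorem next_board_h {h : Bool} (he : (S.edit I ok !h).h = none) (w : V) :
    ((S.next I ok).board w).h =
      ((if S.newPos I ok h = w then (S.edit I ok h).h else none) <|> (S.board w).h) := by
  cases h <;> simp only [Bool.not_false, Bool.not_true] at he <;>
    simp only [next, Edit.apply] <;> split_ifs <;> simp [he, Edit.nil]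

theorem next_board_x {h : Bool} (he : (S.edit I ok !h).x = none) (w : V) :
    ((S.next I ok).board w).x =
      ((if S.newPos I ok h = w then (S.edit I ok h).x else none) <|> (S.board w).x) := by
  cases h <;> simp only [Bool.not_false, Bool.not_true] at he <;>
    simp only [next, Edit.apply] <;> split_ifs <;> simp [he, Edit.nil]

theorem next_board_tok {h : Bool} (he : (S.edit I ok !h).tok = none) (w : V) :
    ((S.next I ok).board w).tok =
      (if S.newPos I ok h = w then (S.edit I ok h).tok else none).getD (S.board w).tok := by
  cases h <;> simp only [Bool.not_false, Bool.not_true] at he <;>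
    simp only [next, Edit.apply] <;> split_ifs <;> simp [he, Edit.nil]

theorem OwnCase.edit_tok {g : Bool} {r : Ldr × Edit} (h : S.OwnCase I ok g r) :
    r.2.tok = none ∨ ((S.ldr g).stage = .join ∧
      (∃ fw, (S.board (S.far I g)).tok = some (S.rev I g, fw)) ∧ r.2.tok = some none ∧
      S.newPos I ok g = S.far I g) := by
  cases h with
  | pickup hs hp hok ht => exact .inr ⟨hs, ⟨_, ht⟩, rfl, hp⟩
  | planSkip => left; simp only [Edit.put]; split_ifs <;> rfl
  | planProbe => left; simp only [Edit.put]; split_ifs <;> rfl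
  | arriveNew => left; simp only [Edit.put]; split_ifs <;> rfl
  | _ => exact .inl rfl

theorem OwnCase.edit_h {g : Bool} {r : Ldr × Edit} (h : S.OwnCase I ok g r)
    (hh : (S.ldr g).hold = false) : r.2.h = none := by
  cases h <;> simp [Edit.put, hh, Edit.nil, Edit.root]

theorem OwnCase.edit_x {g : Bool} {r : Ldr × Edit} (h : S.OwnCase I ok g r)
    (hh : (S.ldr g).hold = true) : r.2.x = none := by
  cases h <;> simp_all [Edit.put, Edit.nil]

theorem ReactCase.edit_h {g : Bool} {r : Ldr × Edit} (h : S.ReactCase I g r) : r.2.h = none := by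
  cases h <;> rfl

theorem edit_h (g : Bool) : (S.edit I ok g).h = (S.ownOut I ok g).2.h := by
  have := (reactOut_case (I := I) (S := S) (ok := ok) g).edit_h
  simp [edit, Edit.comp, this]

theorem edit_of_nil {g : Bool} (h : (S.reactOut I ok g).2 = .nil) :
    S.edit I ok g = (S.ownOut I ok g).2 := by
  simp [edit, Edit.comp, h, Edit.nil]

theorem Duo.own_tok_not {h : Bool} (hS : S.Wf I) (hD : S.Duo I h) :
    (S.ownOut I ok !h).2.tok = none := by
  rcases (S.ownCase I ok !h).edit_tok with h1 | ⟨h1, ⟨fw, h2⟩, -⟩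
  · exact h1
  · exact (hD.no_pickup hS (.inr h1) h2).elim

theorem Duo.own_x {h : Bool} (hD : S.Duo I h) : (S.ownOut I ok h).2.x = none := by
  rcases hD.tok with ⟨h1, -⟩ | ⟨h1, h2, ⟨fw, h3⟩, -⟩
  · exact (S.ownCase I ok h).edit_x h1
  · have := S.ownCase I ok h
    generalize S.ownOut I ok h = r at this
    cases this <;> simp_all [Ldr.split, Ldr.moving, Edit.nil]

theorem Duo.own_h_not {h : Bool} (hD : S.Duo I h) : (S.ownOut I ok !h).2.h = none :=
  (S.ownCase I ok !h).edit_h hD.hold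

theorem Duo.next_h {h : Bool} (hD : S.Duo I h) (w : V) :
    ((S.next I ok).board w).h =
      ((if S.newPos I ok h = w then (S.ownOut I ok h).2.h else none) <|> (S.board w).h) := by
  rw [next_board_h (h := h) (by rw [edit_h]; exact hD.own_h_not), edit_h]

/-- The token after a step without a reaction. -/
theorem Duo.next_tok {h : Bool} (hS : S.Wf I) (hD : S.Duo I h)
    (e1 : (S.reactOut I ok h).2 = .nil) (e2 : (S.reactOut I ok !h).2 = .nil)
    (hf : ((S.half I ok).ldr h).stage ≠ .found) :
    (((S.half I ok).ldr h).hold = true ∧ ∀ w, ((S.next I ok).board w).tok = none) ∨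
    (((S.half I ok).ldr h).hold = false ∧ ((S.half I ok).ldr h).split ∧
      ((S.next I ok).board (S.far I h)).tok = (S.board (S.far I h)).tok ∧
      (S.half I ok).pos h = S.pos h ∧ ((S.half I ok).ldr h).port = (S.ldr h).port ∧
      ∀ w, w ≠ S.far I h → ((S.next I ok).board w).tok = none) := by
  have ht : ∀ w, ((S.next I ok).board w).tok =
      (if S.newPos I ok h = w then (S.ownOut I ok h).2.tok else none).getD (S.board w).tok := by
    intro w
    rw [next_board_tok (h := h) (by rw [edit_of_nil e2]; exact hD.own_tok_not hS),
      edit_of_nil e1]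
  have hc := S.ownCase I ok h
  rcases hD.tok with ⟨h1, h2⟩ | ⟨h1, h2, ⟨fw, h3⟩, h4⟩
  · left
    have : (S.ownOut I ok h).2.tok = none := by
      rcases hc.edit_tok with a | ⟨-, ⟨fw, a⟩, -⟩
      · exact a
      · simp [h2] at a
    constructor
    · rcases hc.hold with a | a | ⟨-, fw, a⟩
      · exact a.trans h1
      · simp [h1] at a
      · simp [h2] at a
    · intro w; rw [ht, this]; simp [h2]
  · rcases hc.edit_tok with a | ⟨a1, -, a2, a3⟩
    · right
      have hs : ((S.half I ok).ldr h).split ∧ ((S.half I ok).ldr h).hold = false := by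
        rcases hD.half_hold (ok := ok) with b | b | b
        · have b : (S.ownOut I ok h).1.hold = true := b
          exfalso
          generalize S.ownOut I ok h = r at *
          cases hc <;> simp_all [Ldr.split, Ldr.moving]
        · exact (hf b).elim
        · exact b
      obtain ⟨p1, p2, -⟩ := half_split hs.1
      refine ⟨hs.2, hs.1, by rw [ht, a]; simp, p1, p2, fun w hw => ?_⟩
      rw [ht, a]; simp [h4 w hw]
    · left
      constructor
      · rcases hD.half_hold (ok := ok) with b | b | b
        · exact b
        · exact (hf b).elim
        · obtain ⟨q1, -⟩ := half_split b.1
          have q1 : S.newPos I ok h = S.pos h := q1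
          rw [a3] at q1
          exact (far_ne ((hS.ldr h).port_lt h2.ne_plan) q1).elim
      · intro w
        rw [ht, a2, a3]
        split_ifs with hw
        · rfl
        · exact h4 w (Ne.symm hw)

/-! ### Preservation of the invariants -/

theorem next_ldr {g : Bool} {L : Ldr} {e : Edit} (h : S.reactOut I ok g = (L, e)) :
    (S.next I ok).ldr g = L := by simp [next, h]

theorem next_pos (g : Bool) : (S.next I ok).pos g = (S.half I ok).pos g := rfl

/-- Preservation when the exploring group is not separated and does not probe. -/
theorem Duo.next_plan {h : Bool} {L : Ldr} (hS : S.Wf I) (hD : S.Duo I h)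
    (hnf : ∀ g, ((S.next I ok).ldr g).stage ≠ .found)
    (e1 : S.reactOut I ok h = (L, .nil))
    (hL : L = (S.half I ok).ldr h ∨
      L = { (S.half I ok).ldr h with stage := .cross } ∧ ((S.half I ok).ldr h).hold = true)
    (hf : ((S.half I ok).ldr h).stage ≠ .found)
    (e2 : S.reactOut I ok (!h) = ({ (S.half I ok).ldr !h with stage := .plan }, .nil)) :
    (S.next I ok).Duo I h := by
  have l1 := next_ldr e1
  have l2 := next_ldr e2
  have hx : ((S.next I ok).ldr !h).stage = .plan := by rw [l2]
  have key : ∀ g, ¬ (((S.next I ok).ldr g).stage ≠ .plan ∧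
      ((S.next I ok).ldr !g).stage ≠ .plan) := by
    intro g ⟨a, b⟩
    obtain rfl | rfl : g = h ∨ g = !h := by cases g <;> cases h <;> simp
    · exact b hx
    · exact a hx
  refine ⟨hnf, by rw [l2]; exact hD.half_hold_not hS, ?_, fun g a b => ?_, fun g a b => ?_,
    fun g a b => ?_, fun a b => ?_⟩
  · have hLh : L.hold = ((S.half I ok).ldr h).hold := by rcases hL with rfl | ⟨rfl, -⟩ <;> rfl
    rcases hD.next_tok hS (by rw [e1]) (by rw [e2]) hf with a | ⟨a1, a2, a3, a4, a5, a6⟩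
    · left; rw [l1, hLh]; exact a
    · right
      rcases hL with rfl | ⟨-, b⟩
      · rcases hD.tok with ⟨c, -⟩ | ⟨c1, c2, c3, c4⟩
        · rw [(half_split a2).2.2.1, c] at a1; cases a1
        · have hfar : (S.next I ok).far I h = S.far I h := by
            unfold Sys.far; rw [l1, next_pos, a4, a5]
          have hrev : (S.next I ok).rev I h = S.rev I h := by
            unfold Sys.rev; rw [l1, next_pos, a4, a5]
          rw [hfar, hrev, l1, a3]
          exact ⟨a1, a2, c3, a6⟩
      · rw [a1] at b; cases b
  · exact (key g ⟨a.ne_plan, b.ne_plan⟩).elim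
  · exact (key g ⟨a.ne_plan, by simp [b]⟩).elim
  · exact (key g ⟨by simp [a], by simp [b]⟩).elim
  · exact (key h ⟨a.ne_plan, b.ne_plan⟩).elim

theorem Duo.next_keep {h : Bool} (hS : S.Wf I) (hD : S.Duo I h)
    (hnf : ∀ g, ((S.next I ok).ldr g).stage ≠ .found)
    (e1 : S.reactOut I ok h = ((S.half I ok).ldr h, .nil))
    (e2 : S.reactOut I ok (!h) = ((S.half I ok).ldr !h, .nil))
    (n1 : ∀ g, ((S.half I ok).ldr g).split → ((S.half I ok).ldr !g).engaged →
      ¬ ((S.half I ok).ldr !g).stage = .cross → ¬ (S.half I ok).SameEdge I g !g)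
    (n2 : ∀ g, ((S.half I ok).ldr g).stage = .probe → ((S.half I ok).ldr !g).stage = .probe →
      ¬ (S.half I ok).Near g !g)
    (n3 : ((S.half I ok).ldr h).wants → ((S.half I ok).ldr !h).split →
      ¬ (S.half I ok).SameEdge I h !h) :
    (S.next I ok).Duo I h := by
  have l : ∀ g, (S.next I ok).ldr g = (S.half I ok).ldr g := by
    intro g
    obtain rfl | rfl : g = h ∨ g = !h := by cases g <;> cases h <;> simp
    · exact next_ldr e1
    · exact next_ldr e2
  have hse : ∀ g g', (S.next I ok).SameEdge I g g' ↔ (S.half I ok).SameEdge I g g' := by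
    intro g g'; unfold SameEdge; rw [l, l]; rfl
  refine ⟨hnf, by rw [l]; exact hD.half_hold_not hS, ?_, fun g => ?_, fun g => ?_,
    fun g => ?_, ?_⟩
  · rcases hD.next_tok hS (by rw [e1]) (by rw [e2]) (by rw [← l]; exact hnf h) with
      a | ⟨a1, a2, a3, a4, a5, a6⟩
    · left; rw [l]; exact a
    · right
      rcases hD.tok with ⟨c, -⟩ | ⟨c1, c2, c3, c4⟩
      · rw [(half_split a2).2.2.1, c] at a1; cases a1
      · have hfar : (S.next I ok).far I h = S.far I h := by
          unfold Sys.far; rw [l, next_pos, a4, a5]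
        have hrev : (S.next I ok).rev I h = S.rev I h := by
          unfold Sys.rev; rw [l, next_pos, a4, a5]
        rw [hfar, hrev, l, a3]
        exact ⟨a1, a2, c3, a6⟩
  · rw [l, l, hse]
    exact fun a b => n1 g a (.inr b) (by rcases b with b | b <;> simp [b])
  · rw [l, l, hse]
    exact fun a b => n1 g a (.inl (.inl b)) (by simp [b])
  · rw [l, l]
    intro a b
    have := n2 g a b
    unfold Near at *
    rwa [l, l]
  · rw [l, l, hse]; exact n3

/-- The group that has yielded is planning and has no edge. All clauses of `Duo` about two engaged
groups are void, and only the token needs attention. -/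
theorem next_yield {h : Bool} {L : Ldr}
    (hnf : ∀ g, ((S.next I ok).ldr g).stage ≠ .found) {e : Edit}
    (e1 : S.reactOut I ok h = (.initial S.clock, e))
    (l2 : (S.next I ok).ldr (!h) = L)
    (ht : (L.hold = true ∧ ∀ w, ((S.next I ok).board w).tok = none) ∨
      (L.hold = false ∧ L.split ∧
        (∃ fw, ((S.next I ok).board ((S.next I ok).far I !h)).tok =
          some ((S.next I ok).rev I !h, fw)) ∧
        ∀ w, w ≠ (S.next I ok).far I (!h) → ((S.next I ok).board w).tok = none)) :
    (S.next I ok).Duo I !h := by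
  have l1 := next_ldr e1
  have hx : ((S.next I ok).ldr h).stage = .plan := by rw [l1]; rfl
  have key : ∀ g, ¬ (((S.next I ok).ldr g).stage ≠ .plan ∧
      ((S.next I ok).ldr !g).stage ≠ .plan) := by
    intro g ⟨a, b⟩
    obtain rfl | rfl : g = h ∨ g = !h := by cases g <;> cases h <;> simp
    · exact a hx
    · rw [Bool.not_not] at b; exact b hx
  refine ⟨hnf, by rw [Bool.not_not, l1]; rfl, by rw [l2]; exact ht, fun g a b => ?_,
    fun g a b => ?_, fun g a b => ?_, fun a b => ?_⟩
  · exact (key g ⟨a.ne_plan, b.ne_plan⟩).elim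
  · exact (key g ⟨a.ne_plan, by simp [b]⟩).elim
  · exact (key g ⟨by simp [a], by simp [b]⟩).elim
  · exact (key _ ⟨a.ne_plan, b.ne_plan⟩).elim

/-- There is no token when the holding group, having it, yields. -/
theorem Duo.half_no_tok {h : Bool} (hS : S.Wf I) (hD : S.Duo I h)
    (hw : ((S.half I ok).ldr h).wants) (hs : ((S.half I ok).ldr !h).split)
    (he : (S.half I ok).SameEdge I h !h) :
    (S.ldr h).hold = true ∧ (∀ w, (S.board w).tok = none) ∧ (S.ownOut I ok h).2.tok = none := by
  rcases hD.tok with ⟨h1, h2⟩ | ⟨h1, h2, ⟨fw, h3⟩, -⟩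
  · refine ⟨h1, h2, ?_⟩
    rcases (S.ownCase I ok h).edit_tok with a | ⟨-, ⟨fw, a⟩, -⟩
    · exact a
    · simp [h2] at a
  -- A group that was waiting for a token and now wants an edge has just picked the token up. Its
  -- edge is the one over which it was separated, and `Duo` keeps the other group off that edge.
  · exfalso
    have hc := S.ownCase I ok h
    have hw : (S.ownOut I ok h).1.wants := hw
    have : S.newPos I ok h = S.far I h ∧ (S.ownOut I ok h).1.port = S.rev I h := by
      generalize S.ownOut I ok h = r at *
      cases hc <;> simp_all [Ldr.split, Ldr.wants, Ldr.moving]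
    have he1 : I.SameEdge (S.pos h) (S.ldr h).port (S.far I h) (S.rev I h) := sameEdge_rev
    obtain ⟨q1, q2, -, -, q3⟩ := half_split hs
    have he2 : S.SameEdge I h !h := by
      refine he1.trans ((hS.ldr h).port_lt h2.ne_plan) ?_
      have e : I.SameEdge (S.newPos I ok h) (S.ownOut I ok h).1.port
        ((S.half I ok).pos !h) ((S.half I ok).ldr !h).port := he
      rwa [this.1, this.2, q1, q2] at e
    rcases q3 with ⟨a, -⟩ | ⟨a, -⟩
    · exact hD.split_probe h h2 a he2
    · exact hD.split_split h h2 a he2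

theorem Duo.next_yieldNear {h : Bool} (hS : S.Wf I) (hD : S.Duo I h)
    (hnf : ∀ g, ((S.next I ok).ldr g).stage ≠ .found)
    (hw : ((S.half I ok).ldr h).wants)
    (hs : ((S.half I ok).ldr !h).split) (hn : (S.half I ok).Near h !h)
    (e1 : S.reactOut I ok h = (.initial S.clock, .root S.clock))
    (e2 : S.reactOut I ok (!h) = ({ (S.half I ok).ldr !h with
        hold := true, fwd := ((S.half I ok).ldr h).fwd }, .nil)) :
    (S.next I ok).Duo I !h := by
  refine next_yield hnf e1 (next_ldr e2) (.inl ⟨rfl, fun w => ?_⟩)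
  obtain ⟨-, h2, h3⟩ := hD.half_no_tok hS hw hs hn.sameEdge
  rw [next_board_tok (h := h) (by rw [edit_of_nil (by rw [e2])]; exact hD.own_tok_not hS)]
  simp [edit, e1, Edit.comp, h3, Edit.root, h2]

/-- The yielding leader stands at the far end of the edge over which the other group is separated.
Its token therefore lies where that group becomes complete and bears the port through which its
leader will enter. -/
theorem Duo.next_yieldFar {h : Bool} (hS : S.Wf I) (hD : S.Duo I h)
    (hnf : ∀ g, ((S.next I ok).ldr g).stage ≠ .found)
    (hw : ((S.half I ok).ldr h).wants)
    (hs : ((S.half I ok).ldr !h).split) (hn : (S.half I ok).Opp I h !h)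
    (e1 : S.reactOut I ok h = (.initial S.clock, (Edit.root S.clock).comp
      ⟨none, none, some (some (((S.half I ok).ldr h).port, ((S.half I ok).ldr h).fwd))⟩))
    (e2 : S.reactOut I ok (!h) = ((S.half I ok).ldr !h, .nil)) :
    (S.next I ok).Duo I (!h) ∧ ((S.next I ok).board (S.newPos I ok h)).tok =
      some (((S.half I ok).ldr h).port, ((S.half I ok).ldr h).fwd) := by
  have he : (S.half I ok).SameEdge I h !h :=
    hn.sameEdge.symm (((hS.half (ok := ok)).ldr !h).port_lt hs.ne_plan)
  obtain ⟨-, h2, h3⟩ := hD.half_no_tok hS hw hs he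
  have ht : ∀ w, ((S.next I ok).board w).tok = if S.newPos I ok h = w then
      some (((S.half I ok).ldr h).port, ((S.half I ok).ldr h).fwd) else none := by
    intro w
    rw [next_board_tok (h := h) (by rw [edit_of_nil (by rw [e2])]; exact hD.own_tok_not hS)]
    simp only [edit, e1, Edit.comp, h3, Edit.root, h2]
    split_ifs <;> rfl
  have hfar : (S.next I ok).far I (!h) = S.newPos I ok h := by
    have := hn.1
    unfold Sys.far at *; rw [next_ldr e2]; exact this
  have hrev : (S.next I ok).rev I (!h) = ((S.half I ok).ldr h).port := by
    have := hn.2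
    unfold Sys.rev at *; rw [next_ldr e2]; exact this
  refine ⟨next_yield hnf e1 (next_ldr e2) (.inr ⟨hD.half_hold_not hS, hs, ?_, ?_⟩), ?_⟩
  · rw [hfar, hrev, ht, if_pos rfl]; exact ⟨_, rfl⟩
  · intro w hw; rw [hfar] at hw; rw [ht, if_neg (Ne.symm hw)]
  · rw [ht, if_pos rfl]

end Sys

end BHS

namespace BHS

open RootedInstance

variable {V : Type*} [Fintype V] [DecidableEq V] {f k : ℕ} (I : RootedInstance V f k)

/-! ### Depth-first search -/

inductive Act where
  | plan
  | cross (p : ℕ) (fwd : Bool)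

/-- The state of a depth-first search: the records, the current node and what is done there. -/
structure Dfs (V : Type*) where
  rho : V → Option NodeRec
  x : V
  act : Act

namespace Dfs

/-- The paths from a node to the root along the ports to the parents. -/
inductive Stack (rho : V → Option NodeRec) : List V → Prop
  | root {r n} (h : rho r = some (none, n)) : Stack rho [r]
  | push {c q n l} (h : rho c = some (some q, n)) (hl : Stack rho (I.far c q :: l)) :
      Stack rho (c :: I.far c q :: l)

/-- A crossing with direction `true` explores; it ends in a new node or, by `bounce`, in a reached
one that is left at once through the same edge. A crossing with direction `false` returns and
changes no record. -/
inductive Step : Dfs V → Dfs V → Prop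
  | incPlan {rho x par n} (hr : rho x = some (par, n)) (hn : n < I.graph.degree x)
      (hp : par = some n) :
      Step ⟨rho, x, .plan⟩ ⟨Function.update rho x (some (par, n + 1)), x, .plan⟩
  | incCross {rho x par n} (hr : rho x = some (par, n)) (hn : n < I.graph.degree x) :
      Step ⟨rho, x, .plan⟩ ⟨Function.update rho x (some (par, n + 1)), x, .cross n true⟩
  | back {rho x q n} (hr : rho x = some (some q, n)) (hn : I.graph.degree x ≤ n) :
      Step ⟨rho, x, .plan⟩ ⟨rho, x, .cross q false⟩
  | pushNew {rho x p} (hp : p < I.graph.degree x) (hr : rho (I.far x p) = none) :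
      Step ⟨rho, x, .cross p true⟩
        ⟨Function.update rho (I.far x p) (some (some (I.rev x p), 0)), I.far x p, .plan⟩
  | bounce {rho x p} (hp : p < I.graph.degree x) (hr : rho (I.far x p) ≠ none) :
      Step ⟨rho, x, .cross p true⟩ ⟨rho, I.far x p, .cross (I.rev x p) false⟩
  | ret {rho x p} : Step ⟨rho, x, .cross p false⟩ ⟨rho, I.far x p, .plan⟩

/-- Giving up the edge to be tried. -/
inductive Skip : Dfs V → Dfs V → Prop
  | mk {rho x p} : Skip ⟨rho, x, .cross p true⟩ ⟨rho, x, .plan⟩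

/-- The end of the path that has to be completed. -/
def top (D : Dfs V) : V :=
  match D.act with
  | .cross p false => I.far D.x p
  | _ => D.x

/-- Reached nodes off the path to the root have no untried port. Once the path has shrunk to the
root, this makes the set of reached nodes closed under the edges tried. -/
structure Base (D : Dfs V) (s : List V) : Prop where
  stack : Stack I D.rho (D.top I :: s)
  nodup : (D.top I :: s).Nodup
  complete : ∀ v par n, D.rho v = some (par, n) → v ∉ D.top I :: s → I.graph.degree v ≤ n
  le : ∀ v par n, D.rho v = some (par, n) → n ≤ I.graph.degree v

/-- The ports tried so far lead to nodes that have been reached, or are bad. -/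
def Closed (D : Dfs V) (bad : V → ℕ → Prop) : Prop :=
  ∀ v par n, D.rho v = some (par, n) → ∀ j, j < n → j < I.graph.degree v →
    D.rho (I.far v j) ≠ none ∨ bad v j ∨ (D.x = v ∧ D.act = .cross j true)

/-- The edges to the parents are not bad. -/
structure Clean (D : Dfs V) (bad : V → ℕ → Prop) : Prop where
  closed : D.Closed I bad
  par : ∀ v q n, D.rho v = some (some q, n) → ¬ bad v q
  back : ∀ p, D.act = .cross p false → ¬ bad D.x p

def nextPort (rho : V → Option NodeRec) (v : V) : ℕ := (rho v).elim 0 Prod.snd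

/-- The coefficients make every step strictly profitable: trying a port yields 6 and pays 4 for the
crossing; these 4 pay 3 for a longer path or 1 for a bounce; shortening the path yields 3 and pays 1
for the way back. -/
def cost (D : Dfs V) (s : List V) : ℕ :=
  6 * ∑ v, (I.graph.degree v - nextPort D.rho v) + 3 * s.length +
    match D.act with
    | .plan => 0
    | .cross _ true => 4
    | .cross _ false => 1

variable {I}

theorem Stack.ne_none {rho : V → Option NodeRec} {l : List V} (h : Stack I rho l) :
    ∀ v ∈ l, rho v ≠ none := by
  induction h with
  | root h => intro v hv; simp at hv; simp [hv, h]
  | push h hl ih =>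
    intro v hv
    rcases List.mem_cons.1 hv with rfl | hv
    · simp [h]
    · exact ih v hv

theorem Stack.congr {rho rho' : V → Option NodeRec} {l : List V} (h : Stack I rho l)
    (he : ∀ v ∈ l, (rho' v).map Prod.fst = (rho v).map Prod.fst) : Stack I rho' l := by
  induction h with
  | @root r n h =>
    have := he r (by simp)
    rw [h] at this
    simp only [Option.map_some, Option.map_eq_some_iff, Prod.exists, exists_and_right,
      exists_eq_right] at this
    obtain ⟨n, hn⟩ := this
    exact .root hn
  | push h hl ih =>
    have := he _ (List.mem_cons_self ..)
    rw [h] at this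
    simp only [Option.map_some, Option.map_eq_some_iff, Prod.exists, exists_and_right,
      exists_eq_right] at this
    obtain ⟨n, hn⟩ := this
    exact .push hn (ih fun v hv => he v (List.mem_cons_of_mem _ hv))

theorem Base.top_ne_none {D : Dfs V} {s : List V} (h : D.Base I s) : D.rho (D.top I) ≠ none :=
  h.stack.ne_none _ (List.mem_cons_self ..)

theorem sum_update {rho : V → Option NodeRec} {x : V} {par : Option ℕ} {n : ℕ}
    (hr : rho x = some (par, n)) (hn : n < I.graph.degree x) :
    ∑ v, (I.graph.degree v - nextPort (Function.update rho x (some (par, n + 1))) v) + 1 =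
      ∑ v, (I.graph.degree v - nextPort rho v) := by
  rw [← Finset.add_sum_erase _ _ (Finset.mem_univ x), ← Finset.add_sum_erase
    (a := x) Finset.univ (fun v => I.graph.degree v - nextPort rho v) (Finset.mem_univ x)]
  have : ∑ v ∈ Finset.univ.erase x,
      (I.graph.degree v - nextPort (Function.update rho x (some (par, n + 1))) v) =
      ∑ v ∈ Finset.univ.erase x, (I.graph.degree v - nextPort rho v) := by
    refine Finset.sum_congr rfl fun v hv => ?_
    rw [nextPort, Function.update_of_ne (Finset.ne_of_mem_erase hv), nextPort]
  rw [this]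
  simp only [nextPort, Function.update_self, hr, Option.elim_some]
  omega

theorem update_map_fst {rho : V → Option NodeRec} {x : V} {par : Option ℕ} {n m : ℕ}
    (hr : rho x = some (par, n)) (v : V) :
    (Function.update rho x (some (par, m)) v).map Prod.fst = (rho v).map Prod.fst := by
  by_cases hv : v = x
  · subst hv; simp [hr]
  · rw [Function.update_of_ne hv]

theorem Base.inc {rho : V → Option NodeRec} {x : V} {par : Option ℕ} {n : ℕ} {s : List V}
    {a a' : Act} (h : Base I ⟨rho, x, a⟩ s) (ht : top I ⟨rho, x, a⟩ = x)
    (hr : rho x = some (par, n)) (hn : n < I.graph.degree x)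
    (ht' : ∀ rho', top I ⟨rho', x, a'⟩ = x) :
    Base I ⟨Function.update rho x (some (par, n + 1)), x, a'⟩ s := by
  refine ⟨?_, ?_, ?_, ?_⟩
  · rw [ht', ← ht]
    exact h.stack.congr fun v _ => by rw [ht]; exact update_map_fst hr v
  · rw [ht', ← ht]; exact h.nodup
  · intro v par' n' hv hs
    rw [ht'] at hs
    have hx : v ≠ x := by rintro rfl; simp at hs
    simp only [Function.update_of_ne hx] at hv
    exact h.complete v par' n' hv (by rwa [ht])
  · intro v par' n' hv
    by_cases hx : v = x
    · subst hx
      simp only [Function.update_self, Option.some.injEq, Prod.mk.injEq] at hv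
      omega
    · simp only [Function.update_of_ne hx] at hv
      exact h.le v par' n' hv

theorem Step.base {D D' : Dfs V} {s : List V} (h : Step I D D') (hD : D.Base I s) :
    ∃ s', D'.Base I s' ∧ D'.cost I s' < D.cost I s := by
  cases h with
  | incPlan hr hn hp =>
    refine ⟨s, hD.inc rfl hr hn fun _ => rfl, ?_⟩
    have := sum_update hr hn
    simp only [cost]; omega
  | incCross hr hn =>
    refine ⟨s, hD.inc rfl hr hn fun _ => rfl, ?_⟩
    have := sum_update hr hn
    simp only [cost]; omega
  | @back rho x q n hr hn =>
    have h1 : Stack I rho (x :: s) := hD.stack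
    cases h1 with
    | root h => simp [h] at hr
    | @push _ q' n' l h hl =>
      obtain rfl : q' = q := by rw [hr] at h; simp at h; exact h.1.symm
      have hnd : (x :: I.far x q' :: l).Nodup := hD.nodup
      refine ⟨l, ⟨hl, hnd.of_cons, ?_, hD.le⟩, ?_⟩
      · intro v par m hv hs
        by_cases hx : v = x
        · subst hx
          rw [show rho v = some (par, m) from hv] at hr
          simp at hr; omega
        · refine hD.complete v par m hv fun hm => ?_
          rcases List.mem_cons.1 hm with h | h
          · exact hx h
          · exact hs h
      · simp only [cost, List.length_cons]; omega
  | @pushNew rho x p hp hr =>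
    have h1 : Stack I rho (x :: s) := hD.stack
    have hne : ∀ v ∈ x :: s, v ≠ I.far x p := by
      rintro v hv rfl; exact h1.ne_none _ hv hr
    have h2 : Stack I (Function.update rho (I.far x p) (some (some (I.rev x p), 0))) (x :: s) :=
      h1.congr fun v hv => by rw [Function.update_of_ne (hne v hv)]
    have hsum : ∑ v, (I.graph.degree v - nextPort (Function.update rho (I.far x p)
        (some (some (I.rev x p), 0))) v) = ∑ v, (I.graph.degree v - nextPort rho v) := by
      refine Finset.sum_congr rfl fun v _ => ?_
      by_cases hx : v = I.far x p
      · simp [nextPort, hx, hr]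
      · rw [nextPort, Function.update_of_ne hx, nextPort]
    refine ⟨x :: s, ⟨?_, ?_, ?_, ?_⟩, ?_⟩
    · have e := far_far (I := I) hp
      have := Stack.push (I := I) (c := I.far x p) (q := I.rev x p) (n := 0) (l := s)
        (rho := Function.update rho (I.far x p) (some (some (I.rev x p), 0)))
        (by simp) (by rw [e]; exact h2)
      rw [e] at this
      exact this
    · exact List.nodup_cons.2 ⟨fun h => hne _ h rfl, hD.nodup⟩
    · intro v par n hv hs
      have hx : v ≠ I.far x p := by rintro rfl; exact hs (List.mem_cons_self ..)
      simp only [Function.update_of_ne hx] at hv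
      exact hD.complete v par n hv fun h => hs (List.mem_cons_of_mem _ h)
    · intro v par n hv
      by_cases hx : v = I.far x p
      · subst hx
        simp only [Function.update_self, Option.some.injEq, Prod.mk.injEq] at hv
        omega
      · simp only [Function.update_of_ne hx] at hv
        exact hD.le v par n hv
    · simp only [cost, hsum, List.length_cons]; omega
  | @bounce rho x p hp hr =>
    have e : top I ⟨rho, I.far x p, .cross (I.rev x p) false⟩ = x := far_far hp
    refine ⟨s, ⟨?_, ?_, ?_, hD.le⟩, ?_⟩
    · rw [e]; exact hD.stack
    · rw [e]; exact hD.nodup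
    · rw [e]; exact hD.complete
    · simp only [cost]; omega
  | ret =>
    refine ⟨s, ⟨hD.stack, hD.nodup, hD.complete, hD.le⟩, ?_⟩
    simp only [cost]; omega

theorem Skip.base {D D' : Dfs V} {s : List V} (h : Skip D D') (hD : D.Base I s) :
    D'.Base I s ∧ D'.cost I s < D.cost I s := by
  cases h
  exact ⟨⟨hD.stack, hD.nodup, hD.complete, hD.le⟩, by simp only [cost]; omega⟩

theorem Stack.parent {rho : V → Option NodeRec} {x : V} {l : List V} {q n : ℕ}
    (h : Stack I rho (x :: l)) (hr : rho x = some (some q, n)) : rho (I.far x q) ≠ none := by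
  cases h with
  | root h => simp [h] at hr
  | @push _ q' n' l h hl =>
    obtain rfl : q' = q := by rw [hr] at h; simp at h; exact h.1.symm
    exact hl.ne_none _ (List.mem_cons_self ..)

theorem Step.closed {D D' : Dfs V} {s : List V} {bad : V → ℕ → Prop} (h : Step I D D')
    (hD : D.Base I s) (hc : D.Closed I bad) : D'.Closed I bad := by
  have upd : ∀ {rho : V → Option NodeRec} {x v : V} {r : NodeRec}, rho v ≠ none →
      Function.update rho x (some r) v ≠ none := by
    intro rho x v r h
    by_cases hx : v = x
    · simp [hx]
    · rwa [Function.update_of_ne hx]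
  cases h with
  | @incPlan rho x par n hr hn hp =>
    intro v par' m hv j hj hd
    by_cases hx : v = x
    · subst hx
      simp only [Function.update_self, Option.some.injEq, Prod.mk.injEq] at hv
      obtain ⟨rfl, rfl⟩ := hv
      rcases Nat.lt_succ_iff_lt_or_eq.1 hj with hj | rfl
      · rcases hc v _ n hr j hj hd with h | h | h
        · exact .inl (upd h)
        · exact .inr (.inl h)
        · simp at h
      -- The port passed over leads to the parent, which lies on the path and has a record.
      · subst hp
        exact .inl (upd (Stack.parent hD.stack hr))
    · simp only [Function.update_of_ne hx] at hv
      rcases hc v par' m hv j hj hd with h | h | h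
      · exact .inl (upd h)
      · exact .inr (.inl h)
      · simp at h
  | @incCross rho x par n hr hn =>
    intro v par' m hv j hj hd
    by_cases hx : v = x
    · subst hx
      simp only [Function.update_self, Option.some.injEq, Prod.mk.injEq] at hv
      obtain ⟨rfl, rfl⟩ := hv
      rcases Nat.lt_succ_iff_lt_or_eq.1 hj with hj | rfl
      · rcases hc v _ n hr j hj hd with h | h | h
        · exact .inl (upd h)
        · exact .inr (.inl h)
        · simp at h
      · exact .inr (.inr ⟨rfl, rfl⟩)
    · simp only [Function.update_of_ne hx] at hv
      rcases hc v par' m hv j hj hd with h | h | h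
      · exact .inl (upd h)
      · exact .inr (.inl h)
      · simp at h
  | back hr hn =>
    intro v par' m hv j hj hd
    rcases hc v par' m hv j hj hd with h | h | h
    · exact .inl h
    · exact .inr (.inl h)
    · simp at h
  | @pushNew rho x p hp hr =>
    intro v par' m hv j hj hd
    by_cases hx : v = I.far x p
    · subst hx
      simp only [Function.update_self, Option.some.injEq, Prod.mk.injEq] at hv
      omega
    · simp only [Function.update_of_ne hx] at hv
      rcases hc v par' m hv j hj hd with h | h | ⟨h1, h2⟩
      · exact .inl (upd h)
      · exact .inr (.inl h)
      · simp only [Act.cross.injEq, and_true] at h1 h2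
        subst h1 h2
        left; simp
  | @bounce rho x p hp hr =>
    intro v par' m hv j hj hd
    rcases hc v par' m hv j hj hd with h | h | ⟨h1, h2⟩
    · exact .inl h
    · exact .inr (.inl h)
    · simp only [Act.cross.injEq, and_true] at h1 h2
      subst h1 h2
      exact .inl hr
  | ret =>
    intro v par' m hv j hj hd
    rcases hc v par' m hv j hj hd with h | h | h
    · exact .inl h
    · exact .inr (.inl h)
    · simp at h

theorem Skip.closed {rho : V → Option NodeRec} {x : V} {p : ℕ} {bad : V → ℕ → Prop}
    (hc : Closed I ⟨rho, x, .cross p true⟩ bad) (hb : bad x p) : Closed I ⟨rho, x, .plan⟩ bad := by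
  intro v par' m hv j hj hd
  rcases hc v par' m hv j hj hd with h | h | ⟨h1, h2⟩
  · exact .inl h
  · exact .inr (.inl h)
  · simp only [Act.cross.injEq, and_true] at h1 h2
    subst h1 h2
    exact .inr (.inl hb)

theorem Skip.clean {D D' : Dfs V} {bad : V → ℕ → Prop} (h : Skip D D')
    (hc : D.Clean I bad) (hb : ∀ p, D.act = .cross p true → bad D.x p) : D'.Clean I bad := by
  cases h
  exact ⟨Skip.closed hc.closed (hb _ rfl), hc.par, by simp⟩

/-- Ways back are reversals of edges crossed forward. A search that never crosses a bad edge forward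
thus never needs one in order to return. -/
theorem Step.clean {D D' : Dfs V} {s : List V} {bad : V → ℕ → Prop} (h : Step I D D')
    (hD : D.Base I s) (hc : D.Clean I bad)
    (hsym : ∀ v p, p < I.graph.degree v → bad (I.far v p) (I.rev v p) → bad v p)
    (hb : ∀ p, D.act = .cross p true → ¬ bad D.x p) : D'.Clean I bad := by
  refine ⟨h.closed hD hc.closed, ?_, ?_⟩
  · cases h with
    | @incPlan rho x par n hr hn hp =>
      intro v q m hv
      by_cases hx : v = x
      · subst hx
        simp only [Function.update_self, Option.some.injEq, Prod.mk.injEq] at hv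
        exact hc.par v q n (by rw [← hv.1]; exact hr)
      · simp only [Function.update_of_ne hx] at hv
        exact hc.par v q m hv
    | @incCross rho x par n hr hn =>
      intro v q m hv
      by_cases hx : v = x
      · subst hx
        simp only [Function.update_self, Option.some.injEq, Prod.mk.injEq] at hv
        exact hc.par v q n (by rw [← hv.1]; exact hr)
      · simp only [Function.update_of_ne hx] at hv
        exact hc.par v q m hv
    | @pushNew rho x p hp hr =>
      intro v q m hv
      by_cases hx : v = I.far x p
      · subst hx
        simp only [Function.update_self, Option.some.injEq, Prod.mk.injEq] at hv
        rw [← hv.1]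
        exact fun h => hb p rfl (hsym _ _ hp h)
      · simp only [Function.update_of_ne hx] at hv
        exact hc.par v q m hv
    | back => exact hc.par
    | bounce => exact hc.par
    | ret => exact hc.par
  · cases h with
    | @back rho x q n hr hn =>
      rintro p ⟨⟩
      exact hc.par _ _ _ hr
    | @bounce rho x p hp hr =>
      rintro p' ⟨⟩
      exact fun h => hb p rfl (hsym _ _ hp h)
    | _ => simp

/-- A completed search has reached all nodes. -/
theorem Closed.complete {D : Dfs V} {s : List V} {bad : V → ℕ → Prop} (hc : D.Closed I bad)
    (hD : D.Base I s) (ha : D.act = .plan) {n : ℕ} (hr : D.rho D.x = some (none, n))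
    (hn : I.graph.degree D.x ≤ n) {G : SimpleGraph V} (hG : G.Connected) (hle : G ≤ I.graph)
    (hbad : ∀ v p, p < I.graph.degree v → bad v p → ¬ G.Adj v (I.far v p)) (v : V) :
    D.rho v ≠ none := by
  have ht : D.top I = D.x := by simp [top, ha]
  -- The current node has no parent, so it is the whole path; hence every reached node has had all
  -- its ports tried, and reached nodes propagate along the edges of `G`.
  have hs : s = [] := by
    have h := hD.stack
    rw [ht] at h
    cases h with
    | root => rfl
    | push h => simp [h] at hr
  have hall : ∀ w par m, D.rho w = some (par, m) → I.graph.degree w ≤ m := by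
    intro w par m hw
    by_cases hx : w = D.x
    · subst hx
      rw [hr] at hw; simp at hw; omega
    · exact hD.complete w par m hw (by simp [ht, hs, hx])
  have hstep : ∀ a b, G.Adj a b → D.rho a ≠ none → D.rho b ≠ none := by
    intro a b hab ha'
    obtain ⟨⟨par, m⟩, hm⟩ := Option.ne_none_iff_exists'.1 ha'
    obtain ⟨p, hp, rfl⟩ := exists_port (I := I) (hle hab)
    rcases hc a par m hm p (hp.trans_le (hall a par m hm)) hp with h | h | h
    · exact h
    · exact (hbad a p hp h hab).elim
    · simp [ha] at h
  have hreach : G.Reachable D.x v := hG.preconnected _ _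
  obtain ⟨w⟩ := hreach
  have h0 : D.rho D.x ≠ none := by simp [hr]
  revert h0
  generalize D.x = u at w
  induction w with
  | nil => exact id
  | cons h _ ih => exact fun h0 => ih (hstep _ _ h h0)

theorem single_base (v : V) :
    Base I ⟨Function.update (fun _ => none) v (some (none, 0)), v, .plan⟩ [] := by
  refine ⟨.root (n := 0) (by simp [top]), by simp, ?_, ?_⟩
  · intro w par n hw hs
    have : w ≠ v := by rintro rfl; simp [top] at hs
    simp [Function.update_of_ne this] at hw
  · intro w par n hw
    by_cases h : w = v
    · subst h; simp at hw; omega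
    · simp [Function.update_of_ne h] at hw

theorem single_clean (v : V) (bad : V → ℕ → Prop) :
    Clean I ⟨Function.update (fun _ => none) v (some (none, 0)), v, .plan⟩ bad := by
  refine ⟨?_, ?_, by simp⟩
  · intro w par n hw j hj
    by_cases h : w = v
    · subst h; simp at hw; omega
    · simp [Function.update_of_ne h] at hw
  · intro w q n hw
    by_cases h : w = v
    · subst h; simp at hw
    · simp [Function.update_of_ne h] at hw

theorem Base.cost_le {D : Dfs V} {s : List V} (h : D.Base I s) :
    D.cost I s ≤ 12 * I.graph.edgeFinset.card + 3 * Fintype.card V + 4 := by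
  have h1 : ∑ v, (I.graph.degree v - nextPort D.rho v) ≤ 2 * I.graph.edgeFinset.card := by
    rw [← SimpleGraph.sum_degrees_eq_twice_card_edges]
    exact Finset.sum_le_sum fun v _ => Nat.sub_le _ _
  have h2 : s.length ≤ Fintype.card V := h.nodup.of_cons.length_le_card
  have h3 : (match D.act with
    | .plan => 0
    | .cross _ true => 4
    | .cross _ false => 1) ≤ 4 := by
    split <;> omega
  unfold cost
  omega

end Dfs

end BHS

/-! ### The steps of a group as steps of a depth-first search -/

namespace BHS

open RootedInstance

variable {V : Type*} [Fintype V] [DecidableEq V] {f k : ℕ} {I : RootedInstance V f k}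

/-- For the search, the stages `probe`, `test`, `join` and `cross` are one and the same crossing;
`Ldr.rank` measures the progress inside it. -/
def Ldr.act (L : Ldr) : Act := if L.stage = .plan then .plan else .cross L.port L.fwd

def Ldr.rank (L : Ldr) : ℕ :=
  match L.stage with
  | .probe => 3
  | .test => 2
  | .join => 1
  | .cross => 1
  | _ => 0

theorem Ldr.rank_le (L : Ldr) : L.rank ≤ 3 := by
  unfold rank; split <;> omega

namespace Sys

variable (I) (S : Sys V) (ok : Bool → Prop)

/-- The search of group `g`. -/
def selfDfs (g : Bool) : Dfs V := ⟨S.nodeRec g, S.pos g, (S.ldr g).act⟩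

/-- The records of group `g` after its own step. -/
noncomputable def ownRec (g : Bool) (w : V) : Option NodeRec :=
  ((S.half I ok).ldr g).getRec
    ((if S.newPos I ok g = w then (S.ownOut I ok g).2 else .nil).apply (S.board w))

noncomputable def ownDfs (g : Bool) : Dfs V :=
  ⟨S.ownRec I ok g, S.newPos I ok g, ((S.half I ok).ldr g).act⟩

/-- The own step of a group which has no token to take over, as a step of its search. -/
inductive OwnStep (g : Bool) : Prop
  | step (h : Dfs.Step I (S.selfDfs g) (S.ownDfs I ok g))
      (hok : (S.ldr g).stage ≠ .plan → ok g) (hs : (S.ldr g).stage ≠ .probe)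
      (hh : ((S.half I ok).ldr g).hold = (S.ldr g).hold)
      (hs' : ¬ ((S.half I ok).ldr g).split)
  | rank (h : S.ownDfs I ok g = S.selfDfs g) (hok : ok g)
      (hh : ((S.half I ok).ldr g).hold = (S.ldr g).hold)
      (hs : (S.ldr g).stage = .probe ∧ ((S.half I ok).ldr g).stage = .test ∨
        (S.ldr g).stage = .test ∧ ((S.half I ok).ldr g).stage = .join)
  | skip (h : Dfs.Skip (S.selfDfs g) (S.ownDfs I ok g)) (hok : ¬ ok g)
      (hs : (S.ldr g).stage = .probe) (hh : (S.ldr g).hold = false)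
      (hh' : ((S.half I ok).ldr g).hold = false)
      (hs' : ((S.half I ok).ldr g).stage = .plan)
  | stuck (h : S.ownOut I ok g = (S.ldr g, .nil)) (hp : S.newPos I ok g = S.pos g)
      (hok : ¬ ok g) (he : (S.ldr g).engaged) (hs : (S.ldr g).hold = true ∨ (S.ldr g).split)
  | finish {n} (hs : (S.ldr g).stage = .plan) (hr : S.nodeRec g (S.pos g) = some (none, n))
      (hn : I.graph.degree (S.pos g) ≤ n)
      (hh : (S.ldr g).hold = false → S.ownOut I ok g = (.initial S.clock, .root S.clock))
  | blocked (hs : (S.ldr g).stage = .cross) (hok : ¬ ok g) (hh : (S.ldr g).hold = false)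
      (h : S.ownOut I ok g = (.initial S.clock, .root S.clock))
  | found (h : ((S.half I ok).ldr g).stage = .found)

variable {I S ok}

theorem getRec_put {L : Ldr} {L' : Ldr} (hh : L'.hold = L.hold) (he : L'.epoch = L.epoch)
    (r : NodeRec) (b : Board) : L'.getRec ((Edit.put L r).apply b) = some r := by
  unfold Ldr.getRec Edit.put
  cases hL : L.hold <;> simp [hh, he, hL, Edit.apply]

theorem getRec_nil {L : Ldr} {L' : Ldr} (hh : L'.hold = L.hold) (he : L'.epoch = L.epoch)
    (b : Board) : L'.getRec (Edit.nil.apply b) = L.getRec b := by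
  unfold Ldr.getRec
  simp [hh, he, Edit.apply, Edit.nil]

theorem ownRec_put {g : Bool} {r : NodeRec} (hh : (S.ownOut I ok g).1.hold = (S.ldr g).hold)
    (he : (S.ownOut I ok g).1.epoch = (S.ldr g).epoch)
    (h2 : (S.ownOut I ok g).2 = .put (S.ldr g) r) :
    S.ownRec I ok g = Function.update (S.nodeRec g) (S.newPos I ok g) (some r) := by
  funext w
  unfold ownRec
  by_cases hw : w = S.newPos I ok g
  · subst hw
    rw [if_pos rfl, h2, Function.update_self]
    exact getRec_put hh he _ _
  · rw [if_neg (Ne.symm hw), Function.update_of_ne hw]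
    exact getRec_nil hh he _

theorem ownRec_nil {g : Bool} (hh : (S.ownOut I ok g).1.hold = (S.ldr g).hold)
    (he : (S.ownOut I ok g).1.epoch = (S.ldr g).epoch)
    (h2 : (S.ownOut I ok g).2 = .nil) : S.ownRec I ok g = S.nodeRec g := by
  funext w
  unfold ownRec
  rw [h2, ite_self]
  exact getRec_nil hh he _

theorem ownStep (hS : S.Wf I) {g : Bool} {s : List V} (hD : (S.selfDfs g).Base I s)
    (hf : (S.ldr g).stage ≠ .found)
    (ht : (S.ldr g).stage = .join → ∀ fw, (S.board (S.far I g)).tok ≠ some (S.rev I g, fw)) :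
    S.OwnStep I ok g := by
  have hc := S.ownCase I ok g
  have hput := fun r => ownRec_put (I := I) (S := S) (ok := ok) (g := g) (r := r)
  have hnil := ownRec_nil (I := I) (S := S) (ok := ok) (g := g)
  have hL : (S.half I ok).ldr g = (S.ownOut I ok g).1 := rfl
  have hself : S.selfDfs g = ⟨S.nodeRec g, S.pos g, (S.ldr g).act⟩ := rfl
  have hown : S.ownDfs I ok g = ⟨S.ownRec I ok g, S.newPos I ok g, (S.ownOut I ok g).1.act⟩ := rfl
  generalize ho : S.ownOut I ok g = o at hc hput hnil hL hown
  have hport := (hS.ldr g).port_lt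
  cases hc with
  | @planSkip par next hs hp hr hn hpar =>
    refine .step ?_ (by simp [hs]) (by simp [hs]) (by rw [hL]) (by rw [hL]; simp [Ldr.split, hs])
    rw [hself, hown, hput _ rfl rfl rfl, hp]
    simp only [Ldr.act, hs, if_true]
    exact .incPlan hr hn hpar
  | @planProbe par next hs hp hr hn hpar =>
    refine .step ?_ (by simp [hs]) (by simp [hs]) (by rw [hL]) (by rw [hL]; simp [Ldr.split])
    rw [hself, hown, hput _ rfl rfl rfl, hp]
    simp only [Ldr.act, hs, if_true, reduceCtorEq, if_false]
    exact .incCross hr hn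
  | planBack hs hp hr hn =>
    refine .step ?_ (by simp [hs]) (by simp [hs]) (by rw [hL]) (by rw [hL]; simp [Ldr.split])
    rw [hself, hown, hnil rfl rfl rfl, hp]
    simp only [Ldr.act, hs, if_true, reduceCtorEq, if_false]
    exact .back hr hn
  | planEnd hs hp hr hn hh => exact .finish hs hr hn (by simp [hh])
  | planRestart hs hp hr hn hh => exact .finish hs hr hn fun _ => ho
  | planNone hs hp hr =>
    have := hD.top_ne_none
    simp only [Dfs.top, selfDfs, Ldr.act, hs, if_true] at this
    exact (this hr).elim
  | probeStuck hs hp hok hh => exact .stuck ho hp hok (.inl (.inl hs)) (.inl hh)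
  | probeSkip hs hp hok hh =>
    refine .skip ?_ hok hs hh (by rw [hL]; exact hh) (by rw [hL])
    rw [hself, hown, hnil rfl rfl rfl, hp]
    simp only [Ldr.act, hs, (hS.ldr g).probe_fwd hs, if_true, reduceCtorEq, if_false]
    exact .mk
  | probeOk hs hp hok =>
    refine .rank ?_ hok (by rw [hL]) (.inl ⟨hs, by rw [hL]⟩)
    rw [hself, hown, hnil rfl rfl rfl, hp]
    simp [Ldr.act, hs]
  | testStuck hs hp hok => exact .stuck ho hp hok (.inr (.inl hs)) (.inr (.inl hs))
  | testOk hs hp hok hf =>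
    refine .rank ?_ hok (by rw [hL]) (.inr ⟨hs, by rw [hL]⟩)
    rw [hself, hown, hnil rfl rfl rfl, hp]
    simp [Ldr.act, hs]
  | testFound => exact .found (by rw [hL])
  | joinStuck hs hp hok => exact .stuck ho hp hok (.inr (.inr hs)) (.inr (.inr hs))
  | crossStuck hs hp hok hh => exact .stuck ho hp hok (.inl (.inr hs)) (.inl hh)
  | crossRestart hs hp hok hh => exact .blocked hs hok hh ho
  | pickup hs hp hok h => exact (ht hs _ h).elim
  | arriveNew hm hp hok ht hf hr =>
    refine .step ?_ (fun _ => hok) (by rcases hm with h | h <;> simp [h]) (by rw [hL])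
      (by rw [hL]; simp [Ldr.split])
    rw [hself, hown, hput _ rfl rfl rfl, hp]
    simp only [Ldr.act, hm.ne_plan, hf, if_true, if_false]
    exact .pushNew (hport hm.ne_plan) hr
  | arriveOld hm hp hok ht hf hr =>
    refine .step ?_ (fun _ => hok) (by rcases hm with h | h <;> simp [h]) (by rw [hL])
      (by rw [hL]; simp [Ldr.split])
    rw [hself, hown, hnil rfl rfl rfl, hp]
    simp only [Ldr.act, hm.ne_plan, hf, if_false, reduceCtorEq]
    refine .bounce (hport hm.ne_plan) ?_
    rw [show S.nodeRec g (I.far (S.pos g) (S.ldr g).port) = _ from hr]; simp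
  | arriveBack hm hp hok ht hf =>
    refine .step ?_ (fun _ => hok) (by rcases hm with h | h <;> simp [h]) (by rw [hL])
      (by rw [hL]; simp [Ldr.split])
    rw [hself, hown, hnil rfl rfl rfl, hp]
    simp only [Ldr.act, hm.ne_plan, hf, if_true, if_false]
    exact .ret
  | found hs => exact (hf hs).elim

/-! ### Epochs -/

-- Epochs in use lie in the past, so a search stamped with the current clock finds no record but its
-- own. The black hole bears no record because no leader ever stands there.
variable (I S) in
structure Epochs : Prop where
  ldr : ∀ g, (S.ldr g).epoch < S.clock
  board : ∀ w e r, (S.board w).x = some (e, r) → e < S.clock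
  blackHole_h : (S.board I.blackHole).h = none
  blackHole_x : (S.board I.blackHole).x = none

theorem OwnCase.epoch {g : Bool} {r : Ldr × Edit} (h : S.OwnCase I ok g r)
    (hE : (S.ldr g).epoch < S.clock) :
    r.1.epoch < S.clock + 1 ∧ ∀ e r', r.2.x = some (e, r') → e < S.clock + 1 := by
  have hput : ∀ r0 e r', (Edit.put (S.ldr g) r0).x = some (e, r') → e < S.clock + 1 := by
    intro r0 e r'
    unfold Edit.put
    split_ifs
    · simp
    · rintro ⟨⟩; omega
  cases h with
  | planSkip => exact ⟨by dsimp; omega, hput _⟩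
  | planProbe => exact ⟨by dsimp; omega, hput _⟩
  | arriveNew => exact ⟨by dsimp; omega, hput _⟩
  | planRestart => exact ⟨Nat.lt_succ_self _, by rintro _ _ ⟨⟩; omega⟩
  | crossRestart => exact ⟨Nat.lt_succ_self _, by rintro _ _ ⟨⟩; omega⟩
  | _ => exact ⟨by dsimp; omega, by simp [Edit.nil]⟩

theorem ReactCase.epoch {g : Bool} {r : Ldr × Edit} (h : S.ReactCase I g r)
    (hE : (S.ldr g).epoch < S.clock + 1) :
    r.1.epoch < S.clock + 1 ∧ ∀ e r', r.2.x = some (e, r') → e < S.clock + 1 := by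
  cases h with
  | yieldNear => exact ⟨Nat.lt_succ_self _, by rintro _ _ ⟨⟩; omega⟩
  | yieldFar => exact ⟨Nat.lt_succ_self _, by rintro _ _ ⟨⟩; omega⟩
  | _ => exact ⟨by dsimp; omega, by simp [Edit.nil]⟩

theorem Epochs.next (hS : S.Wf I) (hE : S.Epochs I) : (S.next I ok).Epochs I := by
  have h1 := fun g => (S.ownCase I ok g).epoch (hE.ldr g)
  have h2 := fun g => (reactOut_case (I := I) (S := S) (ok := ok) g).epoch (h1 g).1
  have he : ∀ g e r, (S.edit I ok g).x = some (e, r) → e < S.clock + 1 := by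
    intro g e r h
    simp only [edit, Edit.comp] at h
    cases hx : (S.reactOut I ok g).2.x with
    | none => exact (h1 g).2 e r (by simpa [hx] using h)
    | some a => exact (h2 g).2 e r (by simpa [hx] using h)
  have hn : ∀ g w e r, (if S.newPos I ok g = w then S.edit I ok g else .nil).x = some (e, r) →
      e < S.clock + 1 := by
    intro g w e r h
    split_ifs at h
    · exact he g e r h
    · simp [Edit.nil] at h
  have hpos : ∀ g, S.newPos I ok g ≠ I.blackHole :=
    fun g => ((S.ownCase I ok g).valid hS).1.pos_ne
  refine ⟨fun g => (h2 g).1, fun w e r h => ?_, ?_, ?_⟩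
  · simp only [Sys.next, Edit.apply] at h
    cases hx : (if S.newPos I ok true = w then S.edit I ok true else .nil).x with
    | some a => rw [hx] at h; exact hn true w e r (by simpa [hx] using h)
    | none =>
      cases hx' : (if S.newPos I ok false = w then S.edit I ok false else .nil).x with
      | some a => rw [hx, hx'] at h; exact hn false w e r (by simpa [hx'] using h)
      | none =>
        rw [hx, hx'] at h
        exact Nat.lt_succ_of_lt (hE.board w e r (by simpa using h))
  · simp [Sys.next, Edit.apply, hpos, Edit.nil, hE.blackHole_h]
  · simp [Sys.next, Edit.apply, hpos, Edit.nil, hE.blackHole_x]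

/-! ### The searches after a step -/

theorem selfDfs_hold {g : Bool} (hh : (S.ldr g).hold = true) :
    S.selfDfs g = ⟨fun w => (S.board w).h, S.pos g, (S.ldr g).act⟩ := by
  unfold selfDfs
  congr 1
  funext w
  simp [nodeRec, Ldr.getRec, hh]

theorem ownDfs_hold {g : Bool} (hh : ((S.half I ok).ldr g).hold = true) :
    S.ownDfs I ok g = ⟨fun w => (if S.newPos I ok g = w then (S.ownOut I ok g).2.h else none) <|>
      (S.board w).h, S.newPos I ok g, ((S.half I ok).ldr g).act⟩ := by
  unfold ownDfs
  congr 1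
  funext w
  simp only [ownRec, Ldr.getRec, hh, if_true, Edit.apply]
  split_ifs <;> rfl

/-- The search of the exploring group after a step in which nobody yields. -/
theorem Duo.next_rec_not {h : Bool} (hD : S.Duo I h)
    (e1 : (S.reactOut I ok h).2 = .nil) (e2 : (S.reactOut I ok !h).2 = .nil)
    (hh : ((S.half I ok).ldr !h).hold = false)
    (l1 : ((S.next I ok).ldr !h).hold = false)
    (l2 : ((S.next I ok).ldr !h).epoch = ((S.half I ok).ldr !h).epoch) :
    (S.next I ok).nodeRec (!h) = S.ownRec I ok !h := by
  funext w
  have hx := next_board_x (I := I) (S := S) (ok := ok) (h := !h)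
    (by rw [Bool.not_not, edit_of_nil e1]; exact hD.own_x) w
  rw [edit_of_nil e2] at hx
  simp only [nodeRec, ownRec, Ldr.getRec, hh, l1, l2, hx, Edit.apply]
  split_ifs <;> first | contradiction | rfl

/-- The search of a group which becomes the exploring one. -/
theorem rec_initial {g : Bool} (hE : S.Epochs I)
    (hg : (S.edit I ok !g).x = none) (hx : (S.edit I ok g).x = some (S.clock, none, 0))
    (l : (S.next I ok).ldr g = .initial S.clock) :
    (S.next I ok).selfDfs g =
      ⟨Function.update (fun _ => none) (S.newPos I ok g) (some (none, 0)), S.newPos I ok g,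
        .plan⟩ := by
  unfold selfDfs
  have h1 : (S.next I ok).nodeRec g =
      Function.update (fun _ => none) (S.newPos I ok g) (some (none, 0)) := by
    funext w
    have hb := next_board_x (I := I) (S := S) (ok := ok) (h := g) hg w
    simp only [nodeRec, Ldr.getRec, l, Ldr.initial, hb, hx]
    by_cases hw : w = S.newPos I ok g
    · subst hw; simp
    · rw [Function.update_of_ne hw, if_neg (Ne.symm hw)]
      cases hxx : (S.board w).x with
      | none => simp
      | some a =>
        obtain ⟨e, r⟩ := a
        have := (hE.board w e r hxx).ne
        simp [this]
  rw [h1, l]; rfl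

variable (I S) in
/-- The search which is continued by the group that has or will have `hold`. -/
def holdDfs (h : Bool) : Dfs V :=
  if (S.ldr h).hold then ⟨fun w => (S.board w).h, S.pos h, (S.ldr h).act⟩
  else ⟨fun w => (S.board w).h, S.far I h,
    .cross (S.rev I h) (((S.board (S.far I h)).tok.map Prod.snd).getD false)⟩

-- Taking over a token turns `join` into `cross`, which has the same rank; the additional 1 for a
-- group still without `hold` makes this count as progress.
variable (S) in
def holdRank (h : Bool) : ℕ := (S.ldr h).rank + if (S.ldr h).hold then 0 else 1

/-- How the search of the holding group is handed over when the groups react. -/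
theorem Duo.next_hold {h : Bool} (hS : S.Wf I) (hD : S.Duo I h)
    (hnf : ∀ g, ((S.next I ok).ldr g).stage ≠ .found)
    (hh : ((S.half I ok).ldr h).hold = true) :
    ∃ h', (S.next I ok).Duo I h' ∧ (S.next I ok).holdDfs I h' = S.ownDfs I ok h ∧
      (h' = h ∧ (S.next I ok).holdRank h ≤ ((S.half I ok).ldr h).rank ∨
        h' = (!h) ∧ ((S.half I ok).ldr h).wants ∧ ((S.half I ok).ldr !h).split ∧
          (S.half I ok).SameEdge I h !h ∧ (S.next I ok).ldr h = .initial S.clock ∧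
          (S.edit I ok !h).x = none ∧ (S.edit I ok h).x = some (S.clock, none, 0)) := by
  have hnh := hD.next_h (ok := ok)
  have hfun : (fun w => ((S.next I ok).board w).h) = fun w =>
    ((if S.newPos I ok h = w then (S.ownOut I ok h).2.h else none) <|> (S.board w).h) :=
    funext hnh
  have same : ∀ L, (S.next I ok).ldr h = L → L.hold = true → L.act = ((S.half I ok).ldr h).act →
      (S.next I ok).holdDfs I h = S.ownDfs I ok h := by
    intro L hL h1 h2
    rw [holdDfs, hL, if_pos h1, ownDfs_hold hh, hfun, h2]; rfl
  have xnil : ((S.half I ok).ldr !h).split → (S.reactOut I ok !h).2 = .nil →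
      (S.edit I ok !h).x = none := by
    intro hs e2
    rw [edit_of_nil e2, ((S.ownCase I ok !h).split hs).2.2.2.2.1]; rfl
  cases hD.pairCase hS (ok := ok) with
  | keep e1 e2 n1 n2 n3 =>
    refine ⟨h, hD.next_keep hS hnf e1 e2 n1 n2 n3, same _ (next_ldr e1) hh rfl, .inl ⟨rfl, ?_⟩⟩
    rw [holdRank, next_ldr e1, hh]; simp
  | skip he hn hp e1 e2 =>
    have hf : ((S.half I ok).ldr h).stage ≠ .found := by
      rw [← next_ldr e1]; exact hnf h
    refine ⟨h, hD.next_plan hS hnf e1 (.inl rfl) hf e2, same _ (next_ldr e1) hh rfl,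
      .inl ⟨rfl, ?_⟩⟩
    rw [holdRank, next_ldr e1, hh]; simp
  | swap _ hp hp' hok ht ht' hn e1 e2 =>
    refine ⟨h, hD.next_plan hS hnf e1 (.inr ⟨rfl, hh⟩) (by simp [ht]) e2,
      same _ (next_ldr e1) hh (by simp [Ldr.act, ht]), .inl ⟨rfl, ?_⟩⟩
    rw [holdRank, next_ldr e1, hh]; simp [Ldr.rank, ht]
  | yieldNear _ hw hs hn e1 e2 =>
    refine ⟨!h, hD.next_yieldNear hS hnf hw hs hn e1 e2, ?_,
      .inr ⟨rfl, hw, hs, hn.sameEdge, next_ldr e1, xnil hs (by rw [e2]), ?_⟩⟩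
    · rw [holdDfs, next_ldr e2, if_pos rfl, ownDfs_hold hh, hfun]
      have h1 : (S.next I ok).pos (!h) = S.newPos I ok h := hn.1
      have h2 : ((S.half I ok).ldr !h).port = ((S.half I ok).ldr h).port := hn.2
      simp [h1, Ldr.act, hw.ne_plan, hs.ne_plan, h2]
    · simp [edit, Edit.comp, e1, Edit.root]
  | yieldFar _ hw hs hn e1 e2 =>
    obtain ⟨d1, d2⟩ := hD.next_yieldFar hS hnf hw hs hn e1 e2
    have he : (S.half I ok).SameEdge I h !h :=
      hn.sameEdge.symm (((hS.half (ok := ok)).ldr !h).port_lt hs.ne_plan)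
    refine ⟨!h, d1, ?_,
      .inr ⟨rfl, hw, hs, he, next_ldr e1, xnil hs (by rw [e2]), ?_⟩⟩
    · have hfar : (S.next I ok).far I (!h) = S.newPos I ok h := by
        have := hn.1
        unfold Sys.far at *; rw [next_ldr e2]; exact this
      have hrev : (S.next I ok).rev I (!h) = ((S.half I ok).ldr h).port := by
        have := hn.2
        unfold Sys.rev at *; rw [next_ldr e2]; exact this
      have hx := hD.half_hold_not hS (ok := ok)
      rw [holdDfs, next_ldr e2, hx, if_neg (by simp), ownDfs_hold hh, hfun, hfar, hrev, d2]
      simp [Ldr.act, hw.ne_plan]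
    · simp [edit, Edit.comp, e1, Edit.root]

end Sys

end BHS

/-! ### One step of the exploring and of the holding group -/

namespace BHS

open RootedInstance

variable {V : Type*} [Fintype V] [DecidableEq V] {f k : ℕ} {I : RootedInstance V f k}

/-- A search which has just begun. -/
def Dfs.single (v : V) : Dfs V := ⟨Function.update (fun _ => none) v (some (none, 0)), v, .plan⟩

namespace Sys

variable {S : Sys V} {ok : Bool → Prop}

variable (I S ok) in
/-- The step of the exploring group, unless the other one yields. -/
inductive ExploreStep (h : Bool) : Prop
  | restart {v} (e : (S.next I ok).selfDfs (!h) = .single v)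
      (hr : ((S.next I ok).ldr !h).rank = 0)
      (why : ((S.ldr !h).stage = .plan ∧ ∃ n, S.nodeRec (!h) (S.pos !h) = some (none, n) ∧
        I.graph.degree (S.pos !h) ≤ n) ∨ ((S.ldr !h).stage = .cross ∧ ¬ ok !h))
  | step (e : Dfs.Step I (S.selfDfs !h) ((S.next I ok).selfDfs !h))
      (hok : (S.ldr !h).stage ≠ .plan → ok !h)
  | stepSkip {D} (e : Dfs.Step I (S.selfDfs !h) D) (hok : (S.ldr !h).stage ≠ .plan → ok !h)
      (e' : Dfs.Skip D ((S.next I ok).selfDfs !h)) (hD : D = S.ownDfs I ok !h)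
      (hs : (S.half I ok).SameEdge I h !h) (hp : ((S.half I ok).ldr !h).stage = .probe)
  | rank (e : (S.next I ok).selfDfs (!h) = S.selfDfs !h)
      (hr : ((S.next I ok).ldr !h).rank < (S.ldr !h).rank) (hok : ok !h)
  | skip (e : Dfs.Skip (S.selfDfs !h) ((S.next I ok).selfDfs !h)) (hok : ¬ ok !h)
      (hs : (S.ldr !h).stage = .probe)
  | swap (e : Dfs.Skip (S.selfDfs !h) ((S.next I ok).selfDfs !h)) (hok : ok h)
  | stuck (e : (S.next I ok).selfDfs (!h) = S.selfDfs !h) (hok : ¬ ok !h)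
      (hs : (S.ldr !h).split)

/-- The reactions admitted by `e2` either change nothing or give up a forward crossing. They add at
most one `Skip` to what the group does by itself. -/
theorem Duo.exploreStep {h : Bool} {s : List V} (hS : S.Wf I) (hE : S.Epochs I) (hD : S.Duo I h)
    (hnf : ((S.next I ok).ldr !h).stage ≠ .found) (hB : (S.selfDfs !h).Base I s)
    (e1 : (S.reactOut I ok h).2 = .nil)
    (e2 : S.reactOut I ok (!h) = ((S.half I ok).ldr !h, .nil) ∨
      S.reactOut I ok (!h) = ({ (S.half I ok).ldr !h with stage := .plan }, .nil) ∧
        (((S.half I ok).ldr !h).stage = .probe ∧ (S.half I ok).SameEdge I h !h ∨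
          ((S.half I ok).ldr !h).stage = .test ∧ (S.ldr !h).stage = .probe ∧ ok h)) :
    S.ExploreStep I ok h := by
  have hx := hD.half_hold_not hS (ok := ok)
  have e2' : (S.reactOut I ok !h).2 = .nil := by
    rcases e2 with e | e
    · rw [e]
    · rw [e.1]
  have hL : (S.half I ok).ldr (!h) = (S.ownOut I ok !h).1 := rfl
  have keep : (S.reactOut I ok (!h) = ((S.half I ok).ldr !h, .nil)) →
      (S.next I ok).selfDfs (!h) = S.ownDfs I ok !h := by
    intro e
    have l := next_ldr e
    unfold selfDfs ownDfs
    rw [hD.next_rec_not e1 e2' hx (by rw [l]; exact hx) (by rw [l]), l]; rfl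
  have plan : (S.reactOut I ok (!h) = ({ (S.half I ok).ldr !h with stage := .plan }, .nil)) →
      (S.next I ok).selfDfs (!h) = ⟨S.ownRec I ok !h, S.newPos I ok !h, .plan⟩ := by
    intro e
    have l := next_ldr e
    unfold selfDfs
    rw [hD.next_rec_not e1 e2' hx (by rw [l]; exact hx) (by rw [l]), l]; rfl
  have restart : S.ownOut I ok (!h) = (.initial S.clock, .root S.clock) →
      (S.next I ok).selfDfs (!h) = .single (S.newPos I ok !h) ∧
        ((S.next I ok).ldr !h).rank = 0 := by
    intro e
    have hp : ((S.half I ok).ldr !h) = .initial S.clock := by rw [hL, e]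
    have e3 : S.reactOut I ok (!h) = ((S.half I ok).ldr !h, .nil) := by
      rcases e2 with e2 | ⟨-, e2 | e2⟩
      · exact e2
      · simp [hp, Ldr.initial] at e2
      · simp [hp, Ldr.initial] at e2
    have l := next_ldr e3
    rw [hp] at l
    refine ⟨rec_initial hE ?_ ?_ l, by rw [l]; rfl⟩
    · rw [Bool.not_not, edit_of_nil e1]; exact hD.own_x
    · rw [edit_of_nil e2', e]; rfl
  cases ownStep hS hB (hD.unfound _) (fun a fw => hD.no_pickup hS (.inr a)) (ok := ok) with
  | step h1 hok hs hh hs' =>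
    rcases e2 with e2 | ⟨e2, ⟨e3, e4⟩ | ⟨-, e3, -⟩⟩
    · exact .step (by rw [keep e2]; exact h1) hok
    · refine .stepSkip h1 hok ?_ rfl e4 e3
      rw [plan e2]
      unfold ownDfs
      have := ((hS.half (ok := ok)).ldr !h).probe_fwd e3
      simp only [Ldr.act, e3, reduceCtorEq, if_false, this]
      exact .mk
    · exact (hs e3).elim
  | rank h1 hok hh hs =>
    rcases e2 with e2 | ⟨e2, ⟨e3, e4⟩ | ⟨e3, e4⟩⟩
    · refine .rank (by rw [keep e2, h1]) ?_ hok
      rw [next_ldr e2]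
      rcases hs with hs | hs <;> simp [Ldr.rank, hs]
    · rcases hs with hs | hs <;> simp [hs] at e3
    · obtain ⟨e4, e5⟩ := e4
      refine .swap ?_ e5
      have hfwd := (hS.ldr !h).probe_fwd e4
      have hsp : ((S.half I ok).ldr !h).split := .inl e3
      have h2 := h1
      unfold ownDfs selfDfs at h2
      simp only [Dfs.mk.injEq] at h2
      rw [plan e2, h2.1, h2.2.1]
      unfold selfDfs
      simp only [Ldr.act, e4, reduceCtorEq, if_false, hfwd]
      exact .mk
  | skip h1 hok hs hh hh' hs' =>
    rcases e2 with e2 | ⟨e2, ⟨e3, e4⟩ | ⟨e3, e4⟩⟩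
    · exact .skip (by rw [keep e2]; exact h1) hok hs
    · simp [hs'] at e3
    · simp [hs'] at e3
  | stuck h1 hp hok he hs =>
    have hs := hs.resolve_left (by simp [hD.hold])
    rw [h1] at hL
    rcases e2 with e2 | ⟨e2, ⟨e3, e4⟩ | ⟨e3, e4⟩⟩
    · refine .stuck ?_ hok hs
      rw [keep e2]
      unfold ownDfs selfDfs
      rw [hL, hp, ownRec_nil (by rw [h1]) (by rw [h1]) (by rw [h1])]
    · rw [hL] at e3; rcases hs with hs | hs <;> simp [hs] at e3
    · rcases hs with hs | hs <;> simp [hs] at e4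
  | finish hs hr hn hh =>
    obtain ⟨r1, r2⟩ := restart (hh hD.hold)
    exact .restart r1 r2 (.inl ⟨hs, _, hr, hn⟩)
  | blocked hs hok hh h1 =>
    obtain ⟨r1, r2⟩ := restart h1
    exact .restart r1 r2 (.inr ⟨hs, hok⟩)
  | found h1 =>
    rcases e2 with e2 | ⟨e2, ⟨e3, e4⟩ | ⟨e3, e4⟩⟩
    · rw [next_ldr e2] at hnf; exact (hnf h1).elim
    · simp [h1] at e3
    · simp [h1] at e3

theorem ExploreStep.base {h : Bool} {s : List V} (hX : S.ExploreStep I ok h)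
    (hB : (S.selfDfs !h).Base I s) : ∃ s', ((S.next I ok).selfDfs !h).Base I s' := by
  cases hX with
  | restart e => exact ⟨[], by rw [e]; exact Dfs.single_base _⟩
  | step e => obtain ⟨s', h, -⟩ := e.base hB; exact ⟨s', h⟩
  | stepSkip e _ e' => obtain ⟨s', h, -⟩ := e.base hB; exact ⟨s', (e'.base h).1⟩
  | rank e => exact ⟨s, by rw [e]; exact hB⟩
  | skip e => exact ⟨s, (e.base hB).1⟩
  | swap e => exact ⟨s, (e.base hB).1⟩
  | stuck e => exact ⟨s, by rw [e]; exact hB⟩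

variable (I S ok) in
/-- The step of the holding group. -/
inductive HoldStep (h : Bool) : Prop
  | progress {h'} (hD : (S.next I ok).Duo I h')
      (hd : Dfs.Step I (S.holdDfs I h) ((S.next I ok).holdDfs I h') ∨
        (S.next I ok).holdDfs I h' = S.holdDfs I h ∧
          (S.next I ok).holdRank h' < S.holdRank h)
      (hx : ∃ s, ((S.next I ok).selfDfs !h').Base I s)
  | stuck (hD : (S.next I ok).Duo I h) (he : (S.ldr h).engaged) (hok : ¬ ok h)
      (hl : (S.next I ok).ldr h = S.ldr h) (hp : (S.next I ok).pos h = S.pos h)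
      (hd : (S.next I ok).holdDfs I h = S.holdDfs I h)
      (hl' : (S.half I ok).ldr h = S.ldr h)
      (hx : S.ExploreStep I ok h)

/-- The other group cannot become separated over a missing edge. -/
theorem Duo.not_split_of_stuck {h : Bool} (hD : S.Duo I h) (hco : S.Coherent I ok)
    (he : (S.ldr h).engaged) (hok : ¬ ok h) (hs : ((S.half I ok).ldr !h).split) :
    ¬ S.SameEdge I h !h := by
  intro hse
  obtain ⟨-, -, -, -, h5⟩ := half_split hs
  have sp : (S.ldr !h).split → False := by
    intro h6
    rcases he with h7 | h7
    · exact hD.wants_split h7 h6 hse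
    · exact hD.split_split h h7 h6 hse
  rcases h5 with ⟨h6, h7, -⟩ | ⟨h6, -⟩
  · exact hok ((hco h he (.inl (.inl h6)) hse).2 h7)
  · exact sp h6

/-- Unless its edge is missing, the holding group advances its search or its rank. If the edge is
missing, the other group cannot become separated over it in this round, so the roles stay and the
orders of the holding group are unchanged. -/
theorem Duo.holdStep {h : Bool} {sh sx : List V} (hS : S.Wf I) (hE : S.Epochs I)
    (hD : S.Duo I h) (hco : S.Coherent I ok)
    (hnf : ∀ g, ((S.next I ok).ldr g).stage ≠ .found) (hB : (S.holdDfs I h).Base I sh)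
    (hC : (S.holdDfs I h).Closed I fun _ _ => False) (hG : I.graph.Connected)
    (hX : (S.selfDfs !h).Base I sx) : S.HoldStep I ok h := by
  have hH := hS.half (ok := ok)
  -- a step in which the group has `hold` afterwards and is not stuck
  have adv : ((S.half I ok).ldr h).hold = true →
      (Dfs.Step I (S.holdDfs I h) (S.ownDfs I ok h) ∨ S.ownDfs I ok h = S.holdDfs I h ∧
        ((S.half I ok).ldr h).rank < S.holdRank h ∧
        (((S.half I ok).ldr h).wants → ((S.half I ok).ldr !h).split →
          ¬ (S.half I ok).SameEdge I h !h)) → S.HoldStep I ok h := by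
    intro hh hd
    obtain ⟨h', d1, d2, d3⟩ := hD.next_hold hS hnf hh
    rcases d3 with ⟨rfl, d3⟩ | ⟨rfl, d3, d4, d5, d6, d7, d8⟩
    · refine .progress d1 ?_ ?_
      · rw [d2]
        rcases hd with hd | hd
        · exact .inl hd
        · exact .inr ⟨hd.1, d3.trans_lt hd.2.1⟩
      · refine ExploreStep.base (hD.exploreStep hS hE (hnf _) hX ?_ ?_ (ok := ok)) hX
        all_goals
          cases hD.pairCase hS (ok := ok) with
          | keep e1 e2 => simp [e1, e2]
          | skip he _ hp e1 e2 => simp [e1, e2, he, hp]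
          | swap _ _ hp hok _ ht _ e1 e2 => simp [e1, e2, hp, ht, hok]
          | yieldNear _ _ _ _ e1 e2 =>
            have h1 : (S.next I ok).ldr (!h') = _ := next_ldr e2
            have := d1.hold
            rw [h1] at this; simp at this
          | yieldFar _ hw hs hn e1 e2 =>
            have h1 : (S.next I ok).ldr h' = _ := next_ldr e1
            have h2 := (hD.next_yieldFar hS hnf hw hs hn e1 e2).1.tok
            rw [next_ldr e2, hD.half_hold_not hS] at h2
            simp only [Bool.false_eq_true, false_and, true_and, false_or] at h2
            obtain ⟨-, ⟨fw, h3⟩, -⟩ := h2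
            rcases d1.tok with ⟨-, h4⟩ | ⟨-, h4, -⟩
            · simp [h4] at h3
            · simp [h1, Ldr.initial, Ldr.split] at h4
    · refine .progress d1 ?_ ?_
      · rw [d2]
        rcases hd with hd | hd
        · exact .inl hd
        -- Roles are exchanged only if the group wants the shared edge after its own step, which is
        -- excluded when nothing but the rank has dropped. Every exchange thus comes with a genuine
        -- step of the held search.
        · exact (hd.2.2 d3 d4 d5).elim
      · rw [Bool.not_not, rec_initial hE d7 d8 d6]
        exact ⟨[], Dfs.single_base _⟩
  -- a round in which the edge is missing
  have stuck : (S.ldr h).engaged → ¬ ok h → S.ownOut I ok h = (S.ldr h, .nil) →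
      S.newPos I ok h = S.pos h → S.HoldStep I ok h := by
    intro he hok ho hp
    have hl : (S.half I ok).ldr h = S.ldr h := by
      change (S.ownOut I ok h).1 = _; rw [ho]
    have hse : ((S.half I ok).ldr !h).split → ¬ (S.half I ok).SameEdge I h !h := by
      intro hs hse
      refine hD.not_split_of_stuck hco he hok hs ?_
      obtain ⟨q1, q2, -⟩ := half_split hs
      unfold SameEdge at *
      rwa [hl, q1, q2, show (S.half I ok).pos h = S.pos h from hp] at hse
    have hd : ∀ L, (S.next I ok).ldr h = L → L = S.ldr h →
        (S.reactOut I ok h).2 = .nil → (S.reactOut I ok !h).2 = .nil →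
        (S.next I ok).holdDfs I h = S.holdDfs I h := by
      rintro _ hL rfl r1 r2
      have hb : (fun w => ((S.next I ok).board w).h) = fun w => (S.board w).h := by
        funext w; rw [hD.next_h, ho]; simp [Edit.nil]
      have hpn : (S.next I ok).pos h = S.pos h := hp
      have hfar : (S.next I ok).far I h = S.far I h := by unfold Sys.far; rw [hL, hpn]
      have hrev : (S.next I ok).rev I h = S.rev I h := by unfold Sys.rev; rw [hL, hpn]
      unfold holdDfs
      rw [hL, hb, hpn, hfar, hrev]
      cases hh : (S.ldr h).hold with
      | true => simp
      | false =>
        have hf : ((S.half I ok).ldr h).stage ≠ .found := by rw [hl]; exact hD.unfound h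
        rcases hD.next_tok hS r1 r2 hf with a | a
        · rw [hl, hh] at a; simp at a
        · rw [a.2.2.1]
    cases hD.pairCase hS (ok := ok) with
    | keep e1 e2 n1 n2 n3 =>
      have l := next_ldr e1
      refine .stuck (hD.next_keep hS hnf e1 e2 n1 n2 n3) he hok (l.trans hl) hp
        (hd _ l hl (by rw [e1]) (by rw [e2])) hl ?_
      exact hD.exploreStep hS hE (hnf _) hX (by rw [e1]) (.inl e2)
    | skip hs hn hpr e1 e2 =>
      have l := next_ldr e1
      refine .stuck (hD.next_plan hS hnf e1 (.inl rfl) (by rw [hl]; exact hD.unfound h) e2) he hok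
        (l.trans hl) hp (hd _ l hl (by rw [e1]) (by rw [e2])) hl ?_
      exact hD.exploreStep hS hE (hnf _) hX (by rw [e1]) (.inr ⟨e2, .inl ⟨hpr, hs⟩⟩)
    | swap hh hpr hpr' hok' => exact (hok hok').elim
    | yieldNear hh hw hs hn => exact (hse hs hn.sameEdge).elim
    | yieldFar hh hw hs hn =>
      exact (hse hs (hn.sameEdge.symm ((hH.ldr !h).port_lt hs.ne_plan))).elim
  cases hhold : (S.ldr h).hold with
  | true =>
    have hself : S.holdDfs I h = S.selfDfs h := by
      rw [holdDfs, if_pos hhold, selfDfs_hold hhold]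
    have htok : ∀ w, (S.board w).tok = none := by
      rcases hD.tok with a | a
      · exact a.2
      · simp [hhold] at a
    rw [hself] at hB hC adv
    cases ownStep hS hB (hD.unfound _) (fun a fw => by simp [htok]) (ok := ok) with
    | step h1 _ _ hh => exact adv (hh.trans hhold) (.inl h1)
    | rank h1 hok hh hs =>
      refine adv (hh.trans hhold) (.inr ⟨h1, ?_, ?_⟩)
      · rcases hs with hs | hs <;> simp [holdRank, Ldr.rank, hs, hhold]
      · intro hw
        rcases hs with hs | hs <;> simp [Ldr.wants, hs] at hw
    | skip _ _ _ hh => simp [hhold] at hh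
    | stuck h1 hp hok he => exact stuck he hok h1 hp
    -- A complete search without bad edges has a record at every node, but there is none at the
    -- black hole.
    | finish hs hr hn =>
      exfalso
      refine hC.complete hB (by simp [selfDfs, Ldr.act, hs]) hr hn hG le_rfl (by simp)
        I.blackHole ?_
      simp [selfDfs, nodeRec, Ldr.getRec, hhold, hE.blackHole_h]
    | blocked _ _ hh => simp [hhold] at hh
    | found h1 =>
      exfalso
      cases hD.pairCase hS (ok := ok) with
      | keep e1 => exact hnf h (by rw [next_ldr e1]; exact h1)
      | skip _ _ _ e1 => exact hnf h (by rw [next_ldr e1]; exact h1)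
      | swap _ _ _ _ ht => simp [h1] at ht
      | yieldNear _ hw => simp [Ldr.wants, h1] at hw
      | yieldFar _ hw => simp [Ldr.wants, h1] at hw
  | false =>
    obtain ⟨-, hsp, ⟨fw, ht⟩, htn⟩ : _ ∧ _ := by
      rcases hD.tok with a | a
      · simp [hhold] at a
      · exact a
    have hc := S.ownCase I ok h
    have hl : (S.half I ok).ldr h = (S.ownOut I ok h).1 := rfl
    rcases hD.half_hold (ok := ok) with hh | hh | ⟨hh, hh'⟩
    -- The pending move stored in the token is already the action of `holdDfs`, so the search is
    -- unchanged and only `holdRank` drops.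
    · -- the token is taken over
      have key : (S.ldr h).stage = .join ∧ S.newPos I ok h = S.far I h ∧
          (S.ownOut I ok h).1 = { S.ldr h with
            stage := .cross, port := S.rev I h, fwd := fw, hold := true } ∧
          (S.ownOut I ok h).2.h = none := by
        rw [hl] at hh
        generalize S.ownOut I ok h = r at *
        cases hc <;> simp_all [Ldr.split, Ldr.moving, Ldr.initial]
      obtain ⟨k1, k2, k3, k4⟩ := key
      refine adv hh (.inr ⟨?_, ?_, ?_⟩)
      · rw [ownDfs_hold hh, holdDfs, hhold, if_neg (by simp), hl, k4, k2, k3, ht]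
        simp [Ldr.act]
      · rw [hl, k3]; simp [holdRank, Ldr.rank, k1, hhold]
      · intro hw hs he
        have := (hD.half_no_tok hS hw hs he).1
        simp [hhold] at this
    · exfalso
      cases hD.pairCase hS (ok := ok) with
      | keep e1 => exact hnf h (by rw [next_ldr e1]; exact hh)
      | skip _ _ _ e1 => exact hnf h (by rw [next_ldr e1]; exact hh)
      | swap _ _ _ _ ht => simp [hh] at ht
      | yieldNear _ hw => simp [Ldr.wants, hh] at hw
      | yieldFar _ hw => simp [Ldr.wants, hh] at hw
    · have key : (¬ ok h ∧ S.ownOut I ok h = (S.ldr h, .nil) ∧ S.newPos I ok h = S.pos h) ∨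
          ((S.ldr h).stage = .test ∧
            S.ownOut I ok h = ({ S.ldr h with stage := .join }, .nil)) := by
        rw [hl] at hh hh'
        generalize S.ownOut I ok h = r at *
        cases hc <;> simp_all [Ldr.split, Ldr.moving, Ldr.initial]
      rcases key with ⟨k1, k2, k3⟩ | ⟨k1, k2⟩
      · exact stuck (.inr hsp) k1 k2 k3
      · have hln : ∀ L, S.reactOut I ok h = (L, .nil) → L = (S.half I ok).ldr h →
            (S.reactOut I ok !h).2 = .nil → (S.next I ok).Duo I h → S.ExploreStep I ok h →
            S.HoldStep I ok h := by
          rintro _ r1 rfl r2 hDn hXn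
          have l := next_ldr r1
          obtain ⟨p1, p2, -⟩ := half_split hh
          refine .progress hDn (.inr ⟨?_, ?_⟩) (hXn.base hX)
          · have hfar : (S.next I ok).far I h = S.far I h := by
              unfold Sys.far; rw [l, next_pos, p1, p2]
            have hrev : (S.next I ok).rev I h = S.rev I h := by
              unfold Sys.rev; rw [l, next_pos, p1, p2]
            have hb : (fun w => ((S.next I ok).board w).h) = fun w => (S.board w).h := by
              funext w; rw [hD.next_h, k2]; simp [Edit.nil]
            have hf : ((S.half I ok).ldr h).stage ≠ .found := by rw [hl, k2]; simp
            unfold holdDfs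
            rw [l, hh', hhold, if_neg (by simp), if_neg (by simp), hfar, hrev, hb]
            rcases hD.next_tok hS (by rw [r1]) r2 hf with a | a
            · simp [hh'] at a
            · rw [a.2.2.1]
          · rw [holdRank, holdRank, l, hl, k2]
            simp [Ldr.rank, k1, hhold]
        cases hD.pairCase hS (ok := ok) with
        | keep e1 e2 n1 n2 n3 =>
          exact hln _ e1 rfl (by rw [e2]) (hD.next_keep hS hnf e1 e2 n1 n2 n3)
            (hD.exploreStep hS hE (hnf _) hX (by rw [e1]) (.inl e2))
        | skip hs hn hpr e1 e2 =>
          exact hln _ e1 rfl (by rw [e2]) (hD.next_plan hS hnf e1 (.inl rfl)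
            (by rw [hl, k2]; simp) e2)
            (hD.exploreStep hS hE (hnf _) hX (by rw [e1]) (.inr ⟨e2, .inl ⟨hpr, hs⟩⟩))
        | swap hh => simp [hh'] at hh
        | yieldNear hh => simp [hh'] at hh
        | yieldFar hh => simp [hh'] at hh

end Sys

end BHS

/-! ### Weights, and the bound on the number of steps -/

namespace BHS

open RootedInstance

variable {V : Type*} [Fintype V] [DecidableEq V] {k : ℕ} {I : RootedInstance V 1 k}

variable (I) in
/-- An upper bound for the weight of a search. -/
def weightBound : ℕ := 4 * (12 * I.graph.edgeFinset.card + 3 * Fintype.card V + 4) + 3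

namespace Sys

variable {S : Sys V}

/-- The edges of the groups which are present in round `t`. -/
def Ok {f : ℕ} (I : RootedInstance V f k) (S : Sys V) (t : ℕ) (g : Bool) : Prop := I.Present t (S.pos g) (S.ldr g).port

variable (I S) in
/-- The search of group `g` finishes within weight `b`, or starts anew before, if the edge at port
`p` of `v` is missing for that long. -/
def Explore (g : Bool) (v : V) (p b : ℕ) : Prop :=
  ∃ s, (S.selfDfs g).Base I s ∧
    (4 * (S.selfDfs g).cost I s + (S.ldr g).rank + weightBound I + 1 ≤ b ∨
      (S.selfDfs g).Clean I (fun w q => I.SameEdge w q v p) ∧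
        4 * (S.selfDfs g).cost I s + (S.ldr g).rank ≤ b)

variable (I S) in
/-- The weights of the searches: `a` bounds what the holding group has left to do, and `b` what the
exploring group has left to do before the edge of the holding group appears. -/
structure Prog (h : Bool) (a b : ℕ) : Prop where
  wf : S.Wf I
  duo : S.Duo I h
  epochs : S.Epochs I
  hold : ∃ s, (S.holdDfs I h).Base I s ∧ 4 * (S.holdDfs I h).cost I s + S.holdRank h ≤ a
  closed : (S.holdDfs I h).Closed I fun _ _ => False
  explore : S.Explore I (!h) (S.pos h) (S.ldr h).port b

theorem Wf.coherent (hS : S.Wf I) (t : ℕ) : S.Coherent I (S.Ok I t) :=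
  fun g hg _ h => h.present_iff ((hS.ldr g).port_lt hg.ne_plan)

theorem Duo.holdRank_le {h : Bool} (hD : S.Duo I h) : S.holdRank h ≤ 3 := by
  rcases hD.tok with a | a
  · simpa [holdRank, a.1] using Ldr.rank_le _
  · rcases a.2.1 with b | b <;> simp [holdRank, a.1, Ldr.rank, b]

/-- The exploring group makes progress while the edge of the holding group is missing. -/
theorem ExploreStep.progress {h : Bool} {b t : ℕ} (hX : S.ExploreStep I (S.Ok I t) h)
    (hS : S.Wf I) (hE : S.Epochs I) (hD : S.Duo I h) (he : (S.ldr h).engaged)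
    (hok : ¬ S.Ok I t h) (hl : (S.half I (S.Ok I t)).ldr h = S.ldr h)
    (hp : (S.half I (S.Ok I t)).pos h = S.pos h)
    (hb : S.Explore I (!h) (S.pos h) (S.ldr h).port b) :
    ∃ b' < b, (S.next I (S.Ok I t)).Explore I (!h) (S.pos h) (S.ldr h).port b' := by
  obtain ⟨s, hB, hb⟩ := hb
  have hlt := (hS.ldr h).port_lt he.ne_plan
  -- it suffices that the weight decreases and cleanliness is preserved
  have key : ∀ s', ((S.next I (S.Ok I t)).selfDfs !h).Base I s' →
      4 * ((S.next I (S.Ok I t)).selfDfs !h).cost I s' + ((S.next I (S.Ok I t)).ldr !h).rank <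
        4 * (S.selfDfs !h).cost I s + (S.ldr !h).rank →
      ((S.selfDfs !h).Clean I (fun v p => I.SameEdge v p (S.pos h) (S.ldr h).port) →
        ((S.next I (S.Ok I t)).selfDfs !h).Clean I
            (fun v p => I.SameEdge v p (S.pos h) (S.ldr h).port)) →
      ∃ b' < b, (S.next I (S.Ok I t)).Explore I (!h) (S.pos h) (S.ldr h).port b' := by
    intro s' h1 h2 h3
    refine ⟨b - 1, by omega, s', h1, ?_⟩
    rcases hb with hb | ⟨hb, hb'⟩
    · left; omega
    · right; exact ⟨h3 hb, by omega⟩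
  have hr := Ldr.rank_le ((S.next I (S.Ok I t)).ldr !h)
  have hsym : ∀ v p, p < I.graph.degree v →
      I.SameEdge (I.far v p) (I.rev v p) (S.pos h) (S.ldr h).port →
      I.SameEdge v p (S.pos h) (S.ldr h).port := fun v p hvp h' => sameEdge_rev.trans hvp h'
  have present : (S.ldr !h).stage ≠ .plan → S.Ok I t (!h) →
      ¬ I.SameEdge (S.pos !h) (S.ldr !h).port (S.pos h) (S.ldr h).port := fun h1 h2 h3 =>
    hok ((h3.present_iff ((hS.ldr !h).port_lt h1)).1 h2)
  have missing : (S.ldr !h).stage ≠ .plan → ¬ S.Ok I t (!h) →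
      I.SameEdge (S.pos !h) (S.ldr !h).port (S.pos h) (S.ldr h).port := fun h1 h2 =>
    sameEdge_of_missing ((hS.ldr !h).port_lt h1) hlt h2 hok
  have act : ∀ p fw, (S.selfDfs !h).act = .cross p fw →
      (S.ldr !h).stage ≠ .plan ∧ p = (S.ldr !h).port ∧ fw = (S.ldr !h).fwd := by
    intro p fw hpf
    simp only [selfDfs, Ldr.act] at hpf
    split_ifs at hpf with h1
    simp only [Act.cross.injEq] at hpf
    exact ⟨h1, hpf.1.symm, hpf.2.symm⟩
  cases hX with
  | @restart x e hr why =>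
    -- A clean search does not start anew. If it were complete, it would be closed in the current
    -- snapshot, which is connected and lacks only the bad edge, and so it would have reached the
    -- black hole. If its way back were blocked, this edge would be the only missing one, that is,
    -- the bad one.
    have hcl : ¬ (S.selfDfs !h).Clean I
        (fun v p => I.SameEdge v p (S.pos h) (S.ldr h).port) := by
      intro hc
      rcases why with ⟨h1, n, h2, h3⟩ | ⟨h1, h2⟩
      · refine hc.closed.complete hB (by simp [selfDfs, Ldr.act, h1]) h2 h3
          (I.snapshot_connected t) (I.snapshot_le t) ?_ I.blackHole ?_
        · intro v p hvp h4 h5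
          exact hok ((h4.present_iff hvp).1 h5)
        · simp [selfDfs, nodeRec, Ldr.getRec, hD.hold, hE.blackHole_x]
      · refine hc.back (S.ldr !h).port ?_ (missing (by simp [h1]) h2)
        simp [selfDfs, Ldr.act, h1, (hS.ldr !h).cross_back h1 hD.hold]
    -- The budget thus still contains the reserve `weightBound I + 1`. It pays for the restart and
    -- for the new search, which is clean because it has tried nothing yet.
    have hb := hb.resolve_right fun h' => hcl h'.1
    refine ⟨weightBound I, by omega, [], by rw [e]; exact Dfs.single_base _, .inr ⟨?_, ?_⟩⟩
    · rw [e]; exact Dfs.single_clean _ _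
    · rw [e, hr]
      have := (Dfs.single_base (I := I) x).cost_le
      unfold weightBound
      exact (Nat.mul_le_mul_left 4 this).trans (by omega)
  | step e hok' =>
    obtain ⟨s', h1, h2⟩ := e.base hB
    refine key s' h1 (by omega) fun hc => e.clean hB hc hsym ?_
    intro p hp
    obtain ⟨h3, rfl, -⟩ := act _ _ hp
    exact present h3 (hok' h3)
  | stepSkip e hok' e' hD' hs hpr =>
    obtain ⟨s', h1, h2⟩ := e.base hB
    obtain ⟨h3, h4⟩ := e'.base h1
    refine key s' h3 (by omega) fun hc => e'.clean (e.clean hB hc hsym ?_) ?_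
    · intro p hp
      obtain ⟨h3, rfl, -⟩ := act _ _ hp
      exact present h3 (hok' h3)
    · intro p hp'
      subst hD'
      have : p = ((S.half I (S.Ok I t)).ldr !h).port := by
        simp only [ownDfs, Ldr.act] at hp'
        split_ifs at hp'
        simp only [Act.cross.injEq] at hp'
        exact hp'.1.symm
      subst this
      unfold SameEdge at hs
      rw [hl, hp] at hs
      exact hs.symm hlt
  | rank e hr' hok' => exact key s (by rw [e]; exact hB) (by rw [e]; omega) fun hc => by rwa [e]
  | skip e hok' hs =>
    obtain ⟨h3, h4⟩ := e.base hB
    refine key s h3 (by omega) fun hc => e.clean hc ?_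
    intro p hp
    obtain ⟨h3, rfl, -⟩ := act _ _ hp
    exact missing h3 hok'
  | swap e hok' => exact (hok hok').elim
  -- As only one edge is missing, the exploring group would be separated over the edge of the
  -- holding one, which `Duo` excludes.
  | stuck e hok' hs =>
    have hse := (missing hs.ne_plan hok').symm ((hS.ldr !h).port_lt hs.ne_plan)
    rcases he with h7 | h7
    · exact (hD.wants_split h7 hs hse).elim
    · exact (hD.split_split h h7 hs hse).elim

theorem Duo.explore_le {h : Bool} {s : List V} (hB : (S.selfDfs !h).Base I s) :
    4 * (S.selfDfs !h).cost I s + (S.ldr !h).rank ≤ weightBound I := by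
  have := hB.cost_le
  have := Ldr.rank_le (S.ldr !h)
  unfold weightBound
  omega

/-- The pair of weights decreases lexicographically. An advance of the held search may spoil the
exploring one, so `b` is reset: weight at most `weightBound I` for the current search, and
`weightBound I + 1` in reserve for one restart. -/
theorem Prog.next {h : Bool} {a b t : ℕ} (hS : S.Prog I h a b)
    (hnf : ∀ g, ((S.next I (S.Ok I t)).ldr g).stage ≠ .found) :
    (∃ h', ∃ a' < a, (S.next I (S.Ok I t)).Prog I h' a' (2 * weightBound I + 1)) ∨
      ∃ b' < b, (S.next I (S.Ok I t)).Prog I h a b' := by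
  obtain ⟨hW, hD, hE, ⟨sh, hB, ha⟩, hC, hX⟩ := hS
  have hG : I.graph.Connected := (I.snapshot_connected 0).mono (I.snapshot_le 0)
  cases hD.holdStep hW hE (hW.coherent t) hnf hB hC hG hX.choose_spec.1 with
  | @progress h' hD' hd hx =>
    left
    obtain ⟨s, hs⟩ := hx
    have hX' := Duo.explore_le hs
    have hr := hD'.holdRank_le
    rcases hd with hd | ⟨hd, hr'⟩
    · obtain ⟨s', h1, h2⟩ := hd.base hB
      exact ⟨h', a - 1, by omega, hW.next, hD', hE.next hW, ⟨s', h1, by omega⟩,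
        hd.closed hB hC, s, hs, .inl (by omega)⟩
    · exact ⟨h', a - 1, by omega, hW.next, hD', hE.next hW,
        ⟨sh, by rw [hd]; exact hB, by rw [hd]; omega⟩, by rw [hd]; exact hC, s, hs,
        .inl (by omega)⟩
  | stuck hD' he hok hl hp hd hl' hx =>
    right
    obtain ⟨b', h1, h2⟩ := hx.progress hW hE hD he hok hl' hp hX
    refine ⟨b', h1, hW.next, hD', hE.next hW, ⟨sh, by rw [hd]; exact hB, ?_⟩,
      by rw [hd]; exact hC, ?_⟩
    · rw [hd]; simpa [holdRank, hl] using ha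
    · rw [hl, hp]; exact h2

theorem Prog.initial (hbh : I.root ≠ I.blackHole) :
    (Sys.initial I).Prog I false (weightBound I) (2 * weightBound I + 1) := by
  have hb : (fun w => ((Sys.initial I).board w).h) =
      Function.update (fun _ => none) I.root (some (none, 0)) := by
    funext w
    by_cases hw : w = I.root
    · subst hw; simp [Sys.initial, initialBoard]
    · simp [Sys.initial, hw, Board.blank]
  have hx : (Sys.initial I).selfDfs true = .single I.root := by
    unfold selfDfs Dfs.single
    congr 1
    funext w
    by_cases hw : w = I.root
    · subst hw; simp [nodeRec, Ldr.getRec, Sys.initial, initialLdr, initialBoard]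
    · simp [nodeRec, Ldr.getRec, Sys.initial, initialLdr, hw, Board.blank]
  have hh : (Sys.initial I).holdDfs I false = .single I.root := by
    unfold holdDfs
    rw [hb]
    simp [Sys.initial, initialLdr, Ldr.act, Dfs.single]
  have hs : ∀ g, ((Sys.initial I).ldr g).stage = .plan := fun g => rfl
  have hc := (Dfs.single_base (I := I) I.root).cost_le
  refine ⟨⟨fun g => ⟨hbh, ?_, ?_, ?_, ?_, ?_⟩, fun w => ?_⟩, ⟨?_, ?_, ?_, ?_, ?_, ?_, ?_⟩,
    ⟨?_, ?_, ?_, ?_⟩, ⟨[], ?_, ?_⟩, ?_, ⟨[], ?_, .inl ?_⟩⟩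
  case refine_6 =>
    by_cases hw : w = I.root
    · subst hw
      simp only [Sys.initial, if_pos, initialBoard]
      exact ⟨by rintro _ ⟨⟩ _ ⟨⟩, by rintro _ ⟨⟩ _ ⟨⟩⟩
    · simp only [Sys.initial, if_neg hw, Board.blank]; exact .none
  case refine_9 =>
    refine .inl ⟨rfl, fun w => ?_⟩
    by_cases hw : w = I.root <;> simp [Sys.initial, hw, initialBoard, Board.blank]
  case refine_15 =>
    intro w e r h
    by_cases hw : w = I.root
    · simp only [Sys.initial, hw, if_true, initialBoard, Option.some.injEq, Prod.mk.injEq] at h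
      rw [← h.1]; exact Nat.one_pos
    · simp [Sys.initial, hw, Board.blank] at h
  case refine_18 => rw [hh]; exact Dfs.single_base _
  case refine_19 =>
    rw [hh]
    have : (Sys.initial I).holdRank false = 0 := rfl
    rw [this]
    unfold weightBound Dfs.single
    omega
  case refine_20 => rw [hh]; exact (Dfs.single_clean _ _).closed
  case refine_21 => rw [Bool.not_false, hx]; exact Dfs.single_base _
  case refine_22 =>
    rw [Bool.not_false, hx]
    have : ((Sys.initial I).ldr true).rank = 0 := rfl
    rw [this]
    unfold weightBound Dfs.single
    omega
  all_goals try simp [hs, Ldr.moving, Ldr.split, Ldr.wants]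
  · simp [Sys.initial, initialLdr]
  · simp [Sys.initial, initialLdr]
  · simp [Sys.initial, hbh.symm, Board.blank]
  · simp [Sys.initial, hbh.symm, Board.blank]

end Sys

end BHS

/-! ### Where the agents are -/

namespace BHS

open RootedInstance

variable {V : Type*} [Fintype V] [DecidableEq V] {f k : ℕ} {I : RootedInstance V f k}

namespace RootedInstance

variable (I) in
/-- Where an agent is that enters `w`. -/
def enter (w : V) : Option V := if w = I.blackHole then none else some w

theorem enter_of_ne {w : V} (h : w ≠ I.blackHole) : I.enter w = some w := if_neg h

theorem tryMove_eq {t : ℕ} {v : V} {m : List Bool} {p : ℕ} (hp : p < I.graph.degree v) :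
    (I.Present t v p ∧ I.tryMove t v m p = ⟨I.far v p, m, .arrived (I.rev v p),
      if I.far v p = I.blackHole then .destroyed else .active⟩) ∨
    (¬ I.Present t v p ∧ I.tryMove t v m p = ⟨v, m, .blocked, .active⟩) := by
  unfold tryMove Present
  simp only [hp, dif_pos, far_eq, rev_eq]
  by_cases h : (I.snapshot t).Adj v (I.ports v ⟨p, hp⟩)
  · exact .inl ⟨h, by rw [if_pos h]⟩
  · exact .inr ⟨h, by rw [if_neg h]⟩

end RootedInstance

namespace Sys

variable (I) (S : Sys V) (ok : Bool → Prop)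

/-- The member `i` of group `g` is separated from its leader. -/
def Lone (g : Bool) (i : Idx) : Prop :=
  ((S.ldr g).stage = .test ∧ i = .A) ∨ ((S.ldr g).stage = .join ∧ i = .B)

instance (g : Bool) (i : Idx) : Decidable (S.Lone g i) := by unfold Lone; infer_instance

/-- The positions of the agents when the orders are given; `none` means destroyed. -/
def pre (g : Bool) (i : Idx) : Option V :=
  if (S.ldr g).stage = .found ∧ i ≠ .C then none
  else if S.Lone g i then I.enter (S.far I g)
  else some (S.pos g)

/-- What an agent does on the orders. -/
def act (g : Bool) (i : Idx) : Action :=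
  if S.Lone g i then (if i = .A then .move (S.rev I g) else .stay) else (S.ldr g).action i

/-- A member moves together with or towards a part of its group. -/
def Goes (g : Bool) (i : Idx) : Prop :=
  ((S.ldr g).stage = .probe ∧ i = .A) ∨ ((S.ldr g).stage = .test ∧ i = .B) ∨
    ((S.ldr g).stage = .join ∧ i ≠ .B) ∨ (S.ldr g).stage = .cross

instance (g : Bool) (i : Idx) : Decidable (S.Goes g i) := by unfold Goes; infer_instance

open Classical in
/-- The positions of the agents after the orders have been executed. -/
noncomputable def place (g : Bool) (i : Idx) : Option V :=
  (S.pre I g i).bind fun w =>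
    if S.Lone g i then (if i = .A ∧ ok g then some (S.pos g) else some w)
    else if S.Goes g i ∧ ok g then I.enter (S.far I g)
    else some w

/-- A member which will be separated from its leader after the orders have been executed. -/
def Away (g : Bool) (i : Idx) : Prop :=
  (i = .A ∧ ((S.ldr g).stage = .probe ∧ ok g ∨ (S.ldr g).stage = .test ∧ ¬ ok g)) ∨
    (i = .B ∧ ((S.ldr g).stage = .test ∧ ok g ∨ (S.ldr g).stage = .join ∧ ¬ ok g))

variable {I S ok}

theorem half_lone {g : Bool} {i : Idx} (h : (S.half I ok).Lone g i) :
    S.Away ok g i ∧ (S.half I ok).rev I g = S.rev I g ∧ (S.half I ok).far I g = S.far I g := by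
  have hs : ((S.half I ok).ldr g).split := by
    rcases h with h | h
    · exact .inl h.1
    · exact .inr h.1
  obtain ⟨h1, h2, -, -, h5⟩ := half_split hs
  refine ⟨?_, by unfold Sys.rev; rw [h1, h2], by unfold Sys.far; rw [h1, h2]⟩
  unfold Away
  rcases h with ⟨h, rfl⟩ | ⟨h, rfl⟩ <;> simp_all [Ldr.split] <;> tauto

/-- The outcome of the old orders puts every member where the new orders presuppose it. This links
the physical positions with the presence of `A` and `B` computed from `ok`. -/
theorem place_eq_pre (hS : S.Wf I) (g : Bool) (i : Idx) :
    S.place I ok g i = (S.half I ok).pre I g i := by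
  have hc := S.ownCase I ok g
  have hL : (S.half I ok).ldr g = (S.ownOut I ok g).1 := rfl
  have hp : (S.half I ok).pos g = S.newPos I ok g := rfl
  have hl := hS.ldr g
  generalize S.ownOut I ok g = r at hc hL
  have hsafe : (S.ldr g).moving → I.enter (S.far I g) = some (S.far I g) :=
    fun h => enter_of_ne (hl.safe h)
  cases hc <;> cases i <;>
    simp_all [place, pre, Lone, Goes, Sys.far, Ldr.initial, Ldr.moving]
  all_goals first
    | (unfold enter; split_ifs <;> simp_all)
    | (rcases ‹(S.ldr g).stage = .join ∨ (S.ldr g).stage = .cross› with h | h <;> simp_all)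

variable (I S ok) in
/-- The groups meet in such a way that their scouts change places. -/
def Swaps (g : Bool) : Prop :=
  ((S.half I ok).ldr g).stage = .test ∧ ((S.half I ok).ldr !g).split ∧ (S.half I ok).Opp I g !g

variable (I S) in
/-- Either the black hole has been found or the invariants of two groups hold. -/
def Sound : Prop := S.Wf I ∧ ((∃ h, S.Duo I h) ∨ ∃ g, (S.ldr g).stage = .found)

theorem half_found {g : Bool} (h : (S.ldr g).stage = .found) :
    S.ownOut I ok g = (S.ldr g, .nil) := by
  have hc := S.ownCase I ok g
  generalize S.ownOut I ok g = r at hc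
  cases hc <;> simp_all [Ldr.moving]

theorem reactOut_found {g : Bool} (h : ((S.half I ok).ldr g).stage = .found) :
    S.reactOut I ok g = ((S.half I ok).ldr g, .nil) := by
  have hc := reactOut_case (I := I) (S := S) (ok := ok) g
  generalize S.reactOut I ok g = r at hc
  cases hc <;> simp_all [Ldr.wants, Ldr.split]

/-- Two groups separated over the same edge have both just probed it from its two ends. The exchange
of scouts is therefore symmetric, and afterwards both groups are complete. -/
theorem Sound.swaps (hS : S.Sound I) {g : Bool} (h : S.Swaps I ok g) :
    S.Swaps I ok (!g) ∧ ∀ i, (S.next I ok).pre I g i = some ((S.half I ok).pos g) ∧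
      ¬ (S.next I ok).Lone g i ∧ ((S.next I ok).ldr g).stage ≠ .found := by
  obtain ⟨ht, hs, ho⟩ := h
  have hH := hS.1.half (ok := ok)
  have hne := hH.opp_ne (hH.opp ho hs.ne_plan) (by simp [ht])
  rcases hS.2 with ⟨h, hD⟩ | ⟨g', hg'⟩
  · have he : (S.half I ok).SameEdge I g !g := ho.sameEdge.symm ((hH.ldr !g).port_lt hs.ne_plan)
    obtain ⟨-, -, -, h4, -⟩ := hD.half_split_split hS.1 (.inl ht) hs he
    refine ⟨⟨h4, .inl (by simpa using ht), by simpa using hH.opp ho hs.ne_plan⟩, ?_⟩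
    have hc := reactOut_case (I := I) (S := S) (ok := ok) g
    generalize ho' : S.reactOut I ok g = r at hc
    have hl := next_ldr (I := I) (S := S) (ok := ok) (g := g) ho'
    cases hc with
    | yieldNear _ hw => simp [Ldr.wants, ht] at hw
    | yieldFar _ hw => simp [Ldr.wants, ht] at hw
    | take _ _ _ hw => simp [Ldr.wants, h4] at hw
    | skip _ hp => simp [ht] at hp
    | keep _ _ h3 => exact (h3 ht hs hne.symm ho).elim
    | swap =>
      intro i
      have h1 : ((S.next I ok).ldr g).stage ≠ .found ∧ ¬ (S.next I ok).Lone g i := by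
        unfold Lone
        rw [hl]
        dsimp only
        split_ifs <;> simp
      exact ⟨by simp [pre, h1.1, h1.2, next_pos], h1.2, h1.1⟩
  · have := half_found (I := I) (ok := ok) hg'
    obtain rfl | rfl : g' = g ∨ g' = !g := by cases g <;> cases g' <;> simp
    · simp [half, this, hg'] at ht
    · simp [half, this, hg', Ldr.split] at hs

/-- Except for the exchange of scouts, a reaction may change orders and roles but moves nobody and
separates nobody. -/
theorem next_pre {g : Bool} (h : ¬ S.Swaps I ok g) (i : Idx) :
    (S.next I ok).pre I g i = (S.half I ok).pre I g i ∧
      ((S.next I ok).Lone g i ↔ (S.half I ok).Lone g i) ∧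
      ((S.half I ok).Lone g i → (S.next I ok).rev I g = (S.half I ok).rev I g) ∧
      (((S.next I ok).ldr g).stage = .found ↔ ((S.half I ok).ldr g).stage = .found) := by
  have hc := reactOut_case (I := I) (S := S) (ok := ok) g
  generalize ho' : S.reactOut I ok g = r at hc
  have hl := next_ldr (I := I) (S := S) (ok := ok) (g := g) ho'
  have hp := next_pos (I := I) (S := S) (ok := ok) g
  have hfar : ((S.next I ok).ldr g).port = ((S.half I ok).ldr g).port →
      (S.next I ok).far I g = (S.half I ok).far I g ∧
        (S.next I ok).rev I g = (S.half I ok).rev I g := by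
    intro h; unfold Sys.far Sys.rev; rw [h, hp]; exact ⟨rfl, rfl⟩
  have hsame : ((S.next I ok).ldr g).port = ((S.half I ok).ldr g).port →
      ((S.next I ok).ldr g).stage = ((S.half I ok).ldr g).stage →
      (S.next I ok).pre I g i = (S.half I ok).pre I g i ∧
      ((S.next I ok).Lone g i ↔ (S.half I ok).Lone g i) ∧
      ((S.half I ok).Lone g i → (S.next I ok).rev I g = (S.half I ok).rev I g) ∧
      (((S.next I ok).ldr g).stage = .found ↔ ((S.half I ok).ldr g).stage = .found) := by
    intro h1 h2
    have hL : (S.next I ok).Lone g i ↔ (S.half I ok).Lone g i := by unfold Lone; rw [h2]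
    refine ⟨?_, hL, fun _ => (hfar h1).2, by rw [h2]⟩
    unfold pre
    rw [h2, (hfar h1).1, hp]
    simp only [hL]
  have hplain : ¬ ((S.half I ok).ldr g).split → ¬ ((S.next I ok).ldr g).split →
      ((S.half I ok).ldr g).stage ≠ .found → ((S.next I ok).ldr g).stage ≠ .found →
      (S.next I ok).pre I g i = (S.half I ok).pre I g i ∧
      ((S.next I ok).Lone g i ↔ (S.half I ok).Lone g i) ∧
      ((S.half I ok).Lone g i → (S.next I ok).rev I g = (S.half I ok).rev I g) ∧
      (((S.next I ok).ldr g).stage = .found ↔ ((S.half I ok).ldr g).stage = .found) := by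
    intro h1 h2 h3 h4
    have hL : ∀ T : Sys V, ¬ (T.ldr g).split → ¬ T.Lone g i := by
      intro T hT h
      rcases h with h | h
      · exact hT (.inl h.1)
      · exact hT (.inr h.1)
    refine ⟨?_, by simp [hL _ h1, hL _ h2], fun h => (hL _ h1 h).elim, by simp [h3, h4]⟩
    simp [pre, h3, h4, hL _ h1, hL _ h2, hp]
  cases hc with
  | yieldNear hh hw =>
    rcases hw with a | a <;> apply hplain <;> simp [hl, a, Ldr.split, Ldr.initial]
  | yieldFar hh hw =>
    rcases hw with a | a <;> apply hplain <;> simp [hl, a, Ldr.split, Ldr.initial]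
  | take => apply hsame <;> rw [hl]
  | swap ht hs hn => exact (h ⟨ht, hs, hn⟩).elim
  | skip hh hp => apply hplain <;> simp [hl, hp, Ldr.split]
  | keep => apply hsame <;> rw [hl]

end Sys

end BHS

/-! ### Execution of the orders by single agents -/

namespace BHS

open RootedInstance

variable {V : Type*} [Fintype V] [DecidableEq V] {f k : ℕ} {I : RootedInstance V f k}

namespace Sys

variable (I) (S : Sys V) (ok : Bool → Prop)

/-- The memory of a member of a group after the outcome of the orders has been recorded. -/
structure MemOk (g : Bool) (i : Idx) (m : Mem) : Prop where
  grp : m.grp = g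
  idx : m.idx = i
  ldr : i = .C → m.ldr = S.ldr g ∧ m.clock = S.clock ∧
    (m.moved = true ↔ (S.ldr g).moving ∧ ok g) ∧ (m.moved = true → m.inp = S.rev I g)
  inp : S.Away ok g i → m.inp = S.rev I g

/-- The memory of a member of a group when the orders have been given. -/
structure OrderOk (g : Bool) (i : Idx) (m : Mem) : Prop where
  grp : m.grp = g
  idx : m.idx = i
  fresh : m.fresh = true
  ldr : i = .C → m.ldr = S.ldr g ∧ m.clock = S.clock
  inp : S.Lone g i → m.inp = S.rev I g

/-- The state of an agent agrees with the orders; `fresh` tells whether the outcome of the orders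
has still to be recorded. -/
inductive AgentOk (fresh : Bool) (g : Bool) (i : Idx) (s : AgentState V) : Prop
  | dead (h : S.place I ok g i = none) (hs : s.status = .destroyed)
  | done {m} (hf : (S.ldr g).stage = .found) (hi : i = .C) (hp : s.pos = S.pos g)
      (hs : s.status = .terminated (S.ldr g).port) (hm : s.mem = Mem.bits m) (hg : m.grp = g)
      (hc : m.idx = i) (hl : m.ldr = S.ldr g)
  | alive {m} (hf : (S.ldr g).stage ≠ .found) (h : S.place I ok g i = some s.pos)
      (hs : s.status = .active) (hm : s.mem = Mem.bits m) (hfr : m.fresh = fresh)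
      (hok : S.MemOk I ok g i (cond fresh (m.record s.sensor) m))

variable {I S}

theorem AgentOk.recorded {g : Bool} {i : Idx} {v : V} {m : Mem} {q : Sensor}
    (hf : (S.ldr g).stage ≠ .found) (h : S.place I ok g i = some v) (hm : S.OrderOk I g i m)
    (hl : i = .C → ((m.record q).moved = true ↔ (S.ldr g).moving ∧ ok g) ∧
      ((m.record q).moved = true → (m.record q).inp = S.rev I g))
    (hi : S.Away ok g i → (m.record q).inp = S.rev I g) :
    S.AgentOk I ok true g i ⟨v, m.bits, q, .active⟩ := by
  have h1 : (m.record q).grp = m.grp ∧ (m.record q).idx = m.idx ∧ (m.record q).ldr = m.ldr ∧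
      (m.record q).clock = m.clock := by cases q <;> exact ⟨rfl, rfl, rfl, rfl⟩
  refine .alive (m := m) hf h rfl (by dsimp only) hm.fresh ⟨h1.1.trans hm.grp, h1.2.1.trans hm.idx, ?_, hi⟩
  intro h
  exact ⟨h1.2.2.1.trans (hm.ldr h).1, h1.2.2.2.trans (hm.ldr h).2, hl h⟩

theorem apply_ok {t : ℕ} {g : Bool} {i : Idx} {v : V} {d : Decision} {m : Mem} (hS : S.Wf I)
    (hv : S.pre I g i = some v) (hd : d.mem = m.bits) (hm : S.OrderOk I g i m)
    (ha : d.action = S.act I g i) : S.AgentOk I (S.Ok I t) true g i (I.apply t v d) := by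
  have hl := hS.ldr g
  by_cases hf : (S.ldr g).stage = .found
  · cases i with
    | C =>
      have hn : ¬ S.Lone g .C := by simp [Lone]
      have hv' : S.pos g = v := by simpa [pre, hn] using hv
      have : I.apply t v d = ⟨v, d.mem, .idle, .terminated (S.ldr g).port⟩ := by
        simp [RootedInstance.apply, ha, act, hn, Ldr.action, hf]
      rw [this]
      exact .done hf rfl hv'.symm rfl hd hm.grp hm.idx (hm.ldr rfl).1
    | _ => simp [pre, hf] at hv
  by_cases hL : S.Lone g i
  · have hsp : (S.ldr g).stage ≠ .plan := by rcases hL with h | h <;> simp [h.1]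
    have hp := hl.port_lt hsp
    have hE : I.enter (S.far I g) = some v := by simpa [pre, hf, hL] using hv
    have hv' : S.far I g = v := by
      unfold enter at hE; split_ifs at hE; simpa using hE
    by_cases hi : i = .A
    · subst hi
      have ht : (S.ldr g).stage = .test := by simpa [Lone] using hL
      have hgo : I.apply t v d = I.tryMove t v d.mem (S.rev I g) := by
        simp [RootedInstance.apply, ha, act, hL]
      have hrl : S.rev I g < I.graph.degree (S.far I g) := rev_lt hp
      -- The returning scout uses the edge of its group from the other end, so it succeeds in the
      -- same rounds as its companion.
      have hpres : I.Present t (S.far I g) (S.rev I g) ↔ S.Ok I t g :=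
        (sameEdge_rev.present_iff hp).symm
      have hfar : I.far (S.far I g) (S.rev I g) = S.pos g := far_far hp
      rw [hgo, hd]
      subst hv'
      rcases tryMove_eq (t := t) (m := m.bits) hrl with ⟨h1, h2⟩ | ⟨h1, h2⟩
      · rw [h2, hfar, if_neg hl.pos_ne]
        refine .recorded (ok := S.Ok I t) hf ?_ hm (by simp) ?_
        · simp [place, hv, hL, hpres.1 h1]
        · simp [Away, ht, hpres.1 h1]
      · rw [h2]
        refine .recorded (ok := S.Ok I t) hf ?_ hm (by simp) ?_
        · simp [place, hv, hL, mt hpres.2 h1]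
        · intro _; exact hm.inp hL
    · have ht : (S.ldr g).stage = .join ∧ i = .B := by simpa [Lone, hi] using hL
      have hgo : I.apply t v d = ⟨v, m.bits, .idle, .active⟩ := by
        simp [RootedInstance.apply, ha, act, hL, hi, hd]
      rw [hgo]
      refine .recorded (ok := S.Ok I t) hf ?_ hm (by simp [ht.2]) fun _ => hm.inp hL
      simp [place, hv, hL, hi]
  have hv' : S.pos g = v := by simpa [pre, hf, hL] using hv
  subst hv'
  by_cases hG : S.Goes g i
  · have hsp : (S.ldr g).stage ≠ .plan := by
      rcases hG with h | h | h | h <;> simp [h]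
    have hp := hl.port_lt hsp
    have hgo : I.apply t (S.pos g) d = I.tryMove t (S.pos g) m.bits (S.ldr g).port := by
      have : (S.ldr g).action i = .move (S.ldr g).port := by
        rcases hG with h | h | h | h <;> simp [Ldr.action, h]
      simp [RootedInstance.apply, ha, act, hL, hd, this]
    rw [hgo]
    rcases tryMove_eq (t := t) (m := m.bits) hp with ⟨h1, h2⟩ | ⟨h1, h2⟩
    · rw [h2]
      by_cases hb : I.far (S.pos g) (S.ldr g).port = I.blackHole
      · refine .dead ?_ (if_pos hb)
        have : S.Ok I t g := h1
        have hb' : S.far I g = I.blackHole := hb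
        simp [place, hv, hL, hG, this, enter, hb']
      · rw [if_neg hb]
        have h1' : S.Ok I t g := h1
        refine .recorded (ok := S.Ok I t) hf ?_ hm ?_ fun _ => rfl
        · simp [place, hv, hL, hG, h1', enter_of_ne hb, Sys.far]
        · rintro rfl
          refine ⟨?_, fun _ => rfl⟩
          have : (S.ldr g).moving := by simpa [Goes, Ldr.moving] using hG
          simp [Mem.record, this, h1']
    · rw [h2]
      have h1' : ¬ S.Ok I t g := h1
      refine .recorded (ok := S.Ok I t) hf ?_ hm ?_ ?_
      · simp [place, hv, hL, h1']
      · rintro rfl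
        exact ⟨by simp [Mem.record, h1'], by simp [Mem.record]⟩
      · intro h
        refine hm.inp ?_
        rcases h with ⟨rfl, h | h⟩ | ⟨rfl, h | h⟩
        · exact (h1' h.2).elim
        · exact .inl ⟨h.1, rfl⟩
        · exact (h1' h.2).elim
        · exact .inr ⟨h.1, rfl⟩
  · have hst : (S.ldr g).action i = .stay := by
      cases hs : (S.ldr g).stage <;> cases i <;> simp_all [Ldr.action, Goes, Lone]
    have hgo : I.apply t (S.pos g) d = ⟨S.pos g, m.bits, .idle, .active⟩ := by
      simp [RootedInstance.apply, ha, act, hL, hd, hst]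
    rw [hgo]
    refine .recorded (ok := S.Ok I t) hf ?_ hm ?_ ?_
    · simp [place, hv, hL, hG]
    · rintro rfl
      have : ¬ (S.ldr g).moving := by simpa [Goes, Ldr.moving] using hG
      exact ⟨by simp [Mem.record, this], by simp [Mem.record]⟩
    · intro h
      refine (hG ?_).elim
      rcases h with ⟨rfl, h | h⟩ | ⟨rfl, h | h⟩
      · exact .inl ⟨h.1, rfl⟩
      · exact (hL (.inl ⟨h.1, rfl⟩)).elim
      · exact .inr (.inl ⟨h.1, rfl⟩)
      · exact (hL (.inr ⟨h.1, rfl⟩)).elim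

end Sys

end BHS

/-! ### What the agents at a node know -/

namespace BHS

open RootedInstance

variable {V : Type*} [Fintype V] [DecidableEq V] {f k : ℕ} {I : RootedInstance V f k}

open Classical in
/-- The memories of the agents at a node. -/
noncomputable def Config.crowd (c : Config V k) (w : V) : Finset (List Bool) :=
  (Finset.univ.filter fun a => (c.agent a).pos = w ∧ (c.agent a).status ≠ .destroyed).image
    fun a => (c.agent a).mem

theorem Config.mem_crowd {c : Config V k} {w : V} {l : List Bool} :
    l ∈ c.crowd w ↔ ∃ a, (c.agent a).pos = w ∧ (c.agent a).status ≠ .destroyed ∧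
      (c.agent a).mem = l := by
  simp [crowd, and_assoc]

/-- Together with its own memory, every agent at a node sees the same set of memories. Hence all
agents there compute with one and the same gathering. -/
theorem view_crowd {c : Config V k} {a : Fin k} (ha : (c.agent a).status ≠ .destroyed) :
    insert (I.view c a).mem ((I.view c a).others.image Prod.snd) = c.crowd (c.agent a).pos := by
  ext l
  rw [Finset.mem_insert, Finset.mem_image, Config.mem_crowd]
  constructor
  · rintro (rfl | ⟨o, ho, rfl⟩)
    · exact ⟨a, rfl, ha, rfl⟩
    · simp only [view, Finset.mem_image, Finset.mem_filter, Finset.mem_univ, true_and] at ho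
      obtain ⟨j, ⟨-, h1, h2⟩, rfl⟩ := ho
      exact ⟨j, h1, h2, rfl⟩
  · rintro ⟨j, h1, h2, rfl⟩
    by_cases hj : j = a
    · subst hj; exact .inl rfl
    · refine .inr ⟨(I.ident j, (c.agent j).mem), ?_, rfl⟩
      simp only [view, Finset.mem_image, Finset.mem_filter, Finset.mem_univ, true_and]
      exact ⟨j, ⟨hj, h1, h2⟩, rfl⟩

theorem Gathering.ofSet_some {X : Finset (List Bool)} {g : Bool} {i : Idx} {m : Mem}
    (h : Gathering.ofSet X g i = some m) : m.grp = g ∧ m.idx = i ∧ m.bits ∈ X := by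
  unfold ofSet at h
  split_ifs at h with hX
  simp only [Option.some.injEq] at h
  exact h ▸ hX.choose_spec

theorem Gathering.exists_ofSet {X : Finset (List Bool)} {m : Mem} (h : m.bits ∈ X) :
    ∃ m', Gathering.ofSet X m.grp m.idx = some m' := by
  have hX : ∃ m' : Mem, m'.grp = m.grp ∧ m'.idx = m.idx ∧ m'.bits ∈ X := ⟨m, rfl, rfl, h⟩
  exact ⟨hX.choose, by unfold ofSet; rw [dif_pos hX]⟩

/-- Observations that the abstract system does not reproduce are harmless: the entry port matters
only after a move, and the presence of the members only in the stages that ask for it. -/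
theorem own_congr {deg clock : ℕ} {moved : Bool} {inp inp' : ℕ} {a a' b b' : Bool} {L : Ldr}
    {w : Board} (hi : moved = true → inp = inp')
    (ha : L.stage = .probe ∨ L.stage = .test → a = a') (hb : L.stage = .test → b = b') :
    own deg clock moved inp a b L w = own deg clock moved inp' a' b' L w := by
  unfold own
  cases hs : L.stage with
  | plan => rfl
  | probe => simp [ha (.inl hs)]
  | test => simp [ha (.inr hs), hb hs]
  | join => cases moved with
    | false => rfl
    | true => simp [hi rfl]
  | cross => cases moved with
    | false => rfl
    | true => simp [hi rfl]
  | found => rfl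

namespace Sys

variable (I) (S : Sys V) (ok : Bool → Prop)

/-- The configuration agrees with the orders of the two groups. -/
structure SimWith (fresh : Bool) (lab : Fin k ≃ Bool × Idx) (c : Config V k) : Prop where
  agent : ∀ a, S.AgentOk I ok fresh (lab a).1 (lab a).2 (c.agent a)
  board : ∀ w, c.board w = (S.board w).bits

def Sim (fresh : Bool) (c : Config V k) : Prop := ∃ lab, S.SimWith I ok fresh lab c

variable {I S ok} {lab : Fin k ≃ Bool × Idx} {c : Config V k}

theorem SimWith.gathering_some (hS : S.Wf I) (hC : S.SimWith I ok false lab c) {w : V} {g : Bool}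
    {i : Idx} {m : Mem} (h : Gathering.ofSet (c.crowd w) g i = some m) :
    (S.half I ok).pre I g i = some w ∧
      ((S.ldr g).stage = .found → m.ldr = S.ldr g) ∧
      ((S.ldr g).stage ≠ .found → S.MemOk I ok g i m) := by
  obtain ⟨rfl, rfl, h3⟩ := Gathering.ofSet_some h
  obtain ⟨a, rfl, h2, h3⟩ := Config.mem_crowd.1 h3
  rw [← place_eq_pre hS]
  cases hC.agent a with
  | dead _ hs => exact (h2 hs).elim
  | done hf hi hp hs hm hg hc hl =>
    obtain rfl := Mem.bits_injective (hm.symm.trans h3)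
    rw [hg, hc, hi]
    refine ⟨?_, fun _ => hl, fun h => (h hf).elim⟩
    simp [place, pre, Lone, Goes, hf, hp]
  | alive hf hp hs hm hfr hok =>
    obtain rfl := Mem.bits_injective (hm.symm.trans h3)
    obtain ⟨hg, hi⟩ := And.intro hok.grp hok.idx
    simp only [cond_false] at hg hi hok
    rw [hg, hi]
    exact ⟨hp, fun h => (hf h).elim, fun _ => hok⟩

theorem SimWith.exists_gathering (hS : S.Wf I) (hC : S.SimWith I ok false lab c) {w : V}
    {g : Bool} {i : Idx} (h : (S.half I ok).pre I g i = some w) :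
    ∃ m, Gathering.ofSet (c.crowd w) g i = some m := by
  rw [← place_eq_pre hS] at h
  have ha := hC.agent (lab.symm (g, i))
  rw [Equiv.apply_symm_apply] at ha
  cases ha with
  | dead hp => simp [hp] at h
  | @done m hf hi hp hs hm hg hc hl =>
    dsimp only at hi hg hc hp
    subst hi
    have : S.pos g = w := by simpa [place, pre, Lone, Goes, hf] using h
    have := Gathering.exists_ofSet (m := m) (X := c.crowd w)
      (Config.mem_crowd.2 ⟨_, hp.trans this, by simp [hs], hm⟩)
    rwa [hg, hc] at this
  | @alive m hf hp hs hm hfr hok =>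
    simp only [cond_false] at hok
    have : _ = w := Option.some.inj (hp.symm.trans h)
    have := Gathering.exists_ofSet (m := m) (X := c.crowd w)
      (Config.mem_crowd.2 ⟨_, this, by simp [hs], hm⟩)
    rwa [hok.grp, hok.idx] at this

theorem SimWith.isSome_gathering (hS : S.Wf I) (hC : S.SimWith I ok false lab c) {w : V}
    {g : Bool} {i : Idx} :
    (Gathering.ofSet (c.crowd w) g i).isSome = true ↔ S.place I ok g i = some w := by
  rw [place_eq_pre hS, Option.isSome_iff_exists]
  exact ⟨fun ⟨m, h⟩ => (hC.gathering_some hS h).1, hC.exists_gathering hS⟩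

theorem Wf.far_ne (hS : S.Wf I) {g : Bool} (h : (S.ldr g).stage ≠ .plan) : S.far I g ≠ S.pos g :=
  RootedInstance.far_ne ((hS.ldr g).port_lt h)

theorem SimWith.ownOut (hS : S.Wf I) (hC : S.SimWith I ok false lab c) {w : V} {g : Bool} :
    Gathering.ownOut (I.graph.degree w) (S.board w) (Gathering.ofSet (c.crowd w)) g =
      if (S.ldr g).stage ≠ .found ∧ (S.half I ok).pos g = w then some (S.ownOut I ok g)
      else none := by
  have hC' : (S.half I ok).pre I g .C = some ((S.half I ok).pos g) := by simp [pre, Lone]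
  unfold Gathering.ownOut Gathering.leader
  split_ifs with h
  · obtain ⟨hf, rfl⟩ := h
    obtain ⟨m, hm⟩ := hC.exists_gathering hS hC'
    obtain ⟨-, -, h3⟩ := hC.gathering_some hS hm
    obtain ⟨-, -, h3, -⟩ := h3 hf
    obtain ⟨h4, h5, h6, h7⟩ := h3 rfl
    have h8 : ∀ inst, @decide ((S.ldr g).moving ∧ ok g) inst = m.moved := fun inst => by
      rw [Bool.eq_iff_iff, h6, decide_eq_true_iff]
    simp only [hm, Option.filter, h4, ne_eq, hf, not_false_eq_true, decide_true, if_true,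
      Option.map_some, Option.some.injEq, h5]
    unfold Sys.ownOut
    have hpos : (S.half I ok).pos g = S.newPos I ok g := rfl
    rw [hpos, h8]
    refine own_congr h7 ?_ ?_
    · intro hs
      rw [Bool.eq_iff_iff, hC.isSome_gathering hS]
      simp only [decide_eq_true_eq]
      have hfar := hS.far_ne (g := g) (by rcases hs with h | h <;> simp [h])
      have hp := S.newPos_of_not I ok (g := g)
        (by rcases hs with h | h <;> simp [h, Ldr.moving])
      rw [hp]
      by_cases hb : S.far I g = I.blackHole <;> by_cases hok : ok g <;>
        rcases hs with hs | hs <;>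
        simp_all [place, pre, Lone, Goes, enter]
    · intro hs
      rw [Bool.eq_iff_iff, hC.isSome_gathering hS]
      simp only [decide_eq_true_eq]
      have hfar := hS.far_ne (g := g) (by simp [hs])
      have hp := S.newPos_of_not I ok (g := g) (by simp [hs, Ldr.moving])
      rw [hp]
      by_cases hb : S.far I g = I.blackHole <;> by_cases hok : ok g <;>
        simp_all [place, pre, Lone, Goes, enter]
  · cases hm : Gathering.ofSet (c.crowd w) g .C with
    | none => rfl
    | some m =>
      obtain ⟨h1, h2, -⟩ := hC.gathering_some hS hm
      rw [hC', Option.some.injEq] at h1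
      have hf : (S.ldr g).stage = .found := by
        by_contra hf; exact h ⟨hf, h1⟩
      simp [h2 hf, hf]

end Sys

end BHS

/-! ### The joint computation agrees with the abstract system -/

namespace BHS

open RootedInstance

variable {V : Type*} [Fintype V] [DecidableEq V] {f k : ℕ} {I : RootedInstance V f k}

namespace Sys

variable {S : Sys V} {ok : Bool → Prop} {lab : Fin k ≃ Bool × Idx} {c : Config V k}

theorem Lone.split {g : Bool} {i : Idx} (h : S.Lone g i) : (S.ldr g).split := by
  rcases h with h | h
  · exact .inl h.1
  · exact .inr h.1

theorem Lone.unfound {g : Bool} {i : Idx} (h : S.Lone g i) : (S.ldr g).stage ≠ .found := by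
  rcases h with h | h <;> simp [h.1]

theorem pre_lone {g : Bool} {i : Idx} {w : V} (h : S.pre I g i = some w) (hw : S.pos g ≠ w) :
    S.Lone g i ∧ S.far I g = w := by
  unfold pre enter at h
  split_ifs at h with h1 h2 h3
  · exact ⟨h2, by simpa using h⟩
  · exact (hw (by simpa using h)).elim

theorem SimWith.lone (hS : S.Wf I) (hC : S.SimWith I ok false lab c) {w : V} {g : Bool}
    {i : Idx} {m : Mem} (h : Gathering.ofSet (c.crowd w) g i = some m)
    (hw : (S.half I ok).pos g ≠ w) :
    (S.half I ok).Lone g i ∧ (S.half I ok).far I g = w ∧ m.inp = (S.half I ok).rev I g := by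
  obtain ⟨h1, h2, h3⟩ := hC.gathering_some hS h
  obtain ⟨h4, h5⟩ := pre_lone h1 hw
  obtain ⟨h6, h7, -⟩ := half_lone h4
  have hf : (S.ldr g).stage ≠ .found := by
    intro hf
    exact h4.unfound (by simp [half, half_found hf, hf])
  exact ⟨h4, h5, ((h3 hf).inp h6).trans h7.symm⟩

theorem SimWith.pres (hS : S.Wf I) (hC : S.SimWith I ok false lab c) {w : V}
    (hw : w ≠ I.blackHole) (g : Bool) :
    Gathering.pres (I.graph.degree w) (S.board w) (Gathering.ofSet (c.crowd w)) g =
      (S.half I ok).pres I g w := by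
  unfold Gathering.pres Sys.pres
  rw [hC.ownOut hS]
  have hL : (S.half I ok).ldr g = (S.ownOut I ok g).1 := rfl
  by_cases hp : (S.half I ok).pos g = w
  · by_cases hf : (S.ldr g).stage = .found
    · have hA : ∀ i, i ≠ .C → Gathering.ofSet (c.crowd w) g i = none := by
        intro i hi
        by_contra h
        obtain ⟨m, hm⟩ := Option.ne_none_iff_exists'.1 h
        have := (hC.gathering_some hS hm).1
        simp [pre, half, half_found hf, hf, hi] at this
      simp [hf, hL, half_found hf, hA]
    · simp [hf, hp, hL]
  · simp only [hp, and_false, if_false]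
    by_cases h : ((S.half I ok).ldr g).split ∧ (S.half I ok).far I g = w
    · rw [if_pos h, if_neg (by rcases h.1 with h | h <;> simp [h])]
      obtain ⟨i, hi, hiC⟩ : ∃ i, (S.half I ok).Lone g i ∧ (i = .A ∨ i = .B) := by
        rcases h.1 with h | h
        · exact ⟨.A, .inl ⟨h, rfl⟩, .inl rfl⟩
        · exact ⟨.B, .inr ⟨h, rfl⟩, .inr rfl⟩
      have hpre : (S.half I ok).pre I g i = some w := by
        simp [pre, hi, hi.unfound, h.2, enter_of_ne hw]
      obtain ⟨m, hm⟩ := hC.exists_gathering hS hpre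
      cases ho : (Gathering.ofSet (c.crowd w) g .A <|> Gathering.ofSet (c.crowd w) g .B) with
      | none => rcases hiC with rfl | rfl <;> simp_all
      | some m' =>
        have : Gathering.ofSet (c.crowd w) g .A = some m' ∨
            Gathering.ofSet (c.crowd w) g .B = some m' := by
          cases hA : Gathering.ofSet (c.crowd w) g .A <;> simp_all
        rcases this with h | h <;> simp [(hC.lone hS h hp).2.2]
    · rw [if_neg h, ite_self]
      have hA : ∀ i, Gathering.ofSet (c.crowd w) g i = none := by
        intro i
        by_contra h'
        obtain ⟨m, hm⟩ := Option.ne_none_iff_exists'.1 h'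
        obtain ⟨h1, h2, -⟩ := hC.lone hS hm hp
        exact h ⟨h1.split, h2⟩
      simp [hA]

theorem SimWith.out (hS : S.Wf I) (hC : S.SimWith I ok false lab c) {w : V}
    (hw : w ≠ I.blackHole) (g : Bool) :
    Gathering.out (I.graph.degree w) (S.board w) (Gathering.ofSet (c.crowd w)) g =
      if (S.ldr g).stage ≠ .found ∧ (S.half I ok).pos g = w then
        some ((S.reactOut I ok g).1, S.edit I ok g)
      else none := by
  have ho := hC.ownOut hS (w := w) (g := g)
  unfold Gathering.out
  rw [ho]
  unfold Gathering.ownOut at ho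
  split_ifs at ho ⊢ with h
  · obtain ⟨m, hm, -⟩ := Option.map_eq_some_iff.1 ho
    have hm' := hm
    unfold Gathering.leader at hm'
    rw [Option.filter_eq_some_iff] at hm'
    obtain ⟨-, -, h3⟩ := hC.gathering_some hS hm'.1
    have hc : m.clock = S.clock := ((h3 h.1).ldr rfl).2.1
    rw [hm, hC.pres hS hw]
    simp only [Option.bind_some, Option.map_some, hc]
    obtain ⟨-, rfl⟩ := h
    rfl
  · simp

theorem edit_found {g : Bool} (h : (S.ldr g).stage = .found) : S.edit I ok g = .nil := by
  have h1 := half_found (I := I) (ok := ok) h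
  have h2 : ((S.half I ok).ldr g).stage = .found := by simp [half, h1, h]
  rw [edit_of_nil (by rw [reactOut_found h2]), h1]

theorem SimWith.newBoard (hS : S.Wf I) (hC : S.SimWith I ok false lab c) {w : V}
    (hw : w ≠ I.blackHole) :
    Gathering.newBoard (I.graph.degree w) (S.board w) (Gathering.ofSet (c.crowd w)) =
      (S.next I ok).board w := by
  have key : ∀ g, ((Gathering.out (I.graph.degree w) (S.board w)
      (Gathering.ofSet (c.crowd w)) g).map Prod.snd |>.getD .nil) =
        if S.newPos I ok g = w then S.edit I ok g else .nil := by
    intro g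
    rw [hC.out hS hw]
    by_cases hf : (S.ldr g).stage = .found
    · simp [hf, edit_found hf]
    · have : (S.half I ok).pos g = S.newPos I ok g := rfl
      by_cases hp : S.newPos I ok g = w <;> simp [hf, this, hp]
  unfold Gathering.newBoard
  rw [key, key]
  rfl

variable (S ok) in
/-- The label of a member after the groups have met. -/
noncomputable def relabel (I : RootedInstance V f k) : Equiv.Perm (Bool × Idx) :=
  open Classical in
  if S.Swaps I ok false then Equiv.swap (false, .A) (true, .A) else Equiv.refl _

theorem relabel_of {g : Bool} (hS : S.Sound I) (h : S.Swaps I ok g) (i : Idx) :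
    S.relabel ok I (g, i) = (if i = .A then !g else g, i) := by
  have h' : S.Swaps I ok false := by
    cases g with
    | false => exact h
    | true => exact (hS.swaps h).1
  unfold relabel
  rw [if_pos h']
  cases i with
  | A => cases g <;> simp
  | _ => rw [Equiv.swap_apply_of_ne_of_ne (by simp) (by simp)]; simp

theorem relabel_of_not {g : Bool} (hS : S.Sound I) (h : ¬ S.Swaps I ok g) (i : Idx) :
    S.relabel ok I (g, i) = (g, i) := by
  have h' : ¬ S.Swaps I ok false := by
    cases g with
    | false => exact h
    | true => exact fun h' => h (hS.swaps h').1
  unfold relabel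
  rw [if_neg h']; rfl

/-- Each of two exchanged scouts stands at the node of the other leader, so changing the labels puts
both into complete groups without moving anyone. -/
theorem next_pre_relabel (hS : S.Sound I) (g : Bool) (i : Idx) :
    (S.next I ok).pre I (S.relabel ok I (g, i)).1 (S.relabel ok I (g, i)).2 =
      (S.half I ok).pre I g i := by
  by_cases h : S.Swaps I ok g
  · rw [relabel_of hS h]
    have hL : (S.half I ok).Lone g i ↔ i = .A := by simp [Lone, h.1]
    by_cases hi : i = .A
    · subst hi
      have ho := (hS.swaps h).1.2.2
      rw [Bool.not_not] at ho
      have h1 : (S.half I ok).far I g = (S.half I ok).pos (!g) := ho.1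
      have h2 := ((hS.1.half (ok := ok)).ldr !g).pos_ne
      simp only [if_true]
      rw [((hS.swaps (hS.swaps h).1).2 .A).1]
      simp [pre, h.1, hL, h1, enter_of_ne h2]
    · simp only [hi, if_false]
      rw [((hS.swaps h).2 i).1]
      simp [pre, h.1, hL, hi]
  · rw [relabel_of_not hS h]; exact (next_pre h i).1

/-- The decision of a member of a group. -/
theorem SimWith.decideMem (hS : S.Sound I) (hC : S.SimWith I ok false lab c) {w : V}
    (hw : w ≠ I.blackHole) {g : Bool} {i : Idx} {m : Mem} (hm : S.MemOk I ok g i m)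
    (hf : (S.ldr g).stage ≠ .found) (hp : (S.half I ok).pre I g i = some w) :
    let r := Gathering.decideMem (I.graph.degree w) (S.board w) (Gathering.ofSet (c.crowd w)) m
    let l := S.relabel ok I (g, i)
    (S.next I ok).OrderOk I l.1 l.2 r.1 ∧ r.2 = (S.next I ok).act I l.1 l.2 := by
  have hH := hS.1.half (ok := ok)
  have hout := hC.out hS.1 hw
  intro r l
  by_cases hpos : (S.half I ok).pos g = w
  · have hnl : ¬ (S.half I ok).Lone g i := by
      intro hl
      have := hH.far_ne hl.split.ne_plan
      simp only [pre, hl, hl.unfound, false_and, if_false, if_true, enter] at hp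
      split_ifs at hp
      rw [Option.some.injEq] at hp
      exact this (hp.trans hpos.symm)
    have hnl' : ¬ (S.next I ok).Lone g i := by
      by_cases h : S.Swaps I ok g
      · exact ((hS.swaps h).2 i).2.1
      · exact fun h' => hnl ((next_pre h i).2.1.1 h')
    have hl : l = (g, i) := by
      by_cases h : S.Swaps I ok g
      · have hi : i ≠ .A := fun hi => hnl (.inl ⟨h.1, hi⟩)
        simp only [l, relabel_of hS h, hi, if_false]
      · exact relabel_of_not hS h i
    have hr : r = (if m.idx = .C then
        { m with fresh := true, ldr := (S.reactOut I ok g).1, clock := m.clock + 1 }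
        else { m with fresh := true }, (S.reactOut I ok g).1.action m.idx) := by
      simp only [r, Gathering.decideMem, hm.grp, hout, hf, hpos, ne_eq, not_false_eq_true,
        and_self, if_true]
    rw [hl, hr, hm.idx]
    refine ⟨?_, ?_⟩
    · by_cases hi : i = .C
      · rw [if_pos hi]
        refine ⟨hm.grp, rfl, rfl, fun _ => ⟨rfl, ?_⟩, fun h => (hnl' h).elim⟩
        have := (hm.ldr hi).2.1
        simp [this, Sys.next]
      · rw [if_neg hi]
        exact ⟨hm.grp, rfl, rfl, fun h => (hi h).elim, fun h => (hnl' h).elim⟩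
    · simp only [act, if_neg hnl']; rfl
  · obtain ⟨hl, hfar⟩ := pre_lone hp hpos
    obtain ⟨haw, hrev, -⟩ := half_lone hl
    have hinp : m.inp = (S.half I ok).rev I g := (hm.inp haw).trans hrev.symm
    -- The adopting leader recognises the exchange from the other end of the edge; by symmetry this
    -- is the same event as seen by the group of the adopted scout.
    have had : Gathering.adopted (I.graph.degree w) (S.board w) (Gathering.ofSet (c.crowd w)) m ↔
        S.Swaps I ok g := by
      unfold Gathering.adopted
      rw [hm.grp, hC.ownOut hS.1]
      constructor
      · rintro ⟨r, h1, h2, h3⟩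
        split_ifs at h1 with h4
        rw [Option.some.injEq] at h1
        subst h1
        have : S.Swaps I ok !g := by
          refine ⟨h2, ?_, ?_, ?_⟩
          · rw [Bool.not_not]; exact hl.split
          · rw [Bool.not_not]; exact hfar.trans h4.2.symm
          · rw [Bool.not_not]; exact hinp.symm.trans h3.symm
        simpa using (hS.swaps this).1
      · intro h
        obtain ⟨h1, h2, h3, h4⟩ := (hS.swaps h).1
        rw [Bool.not_not] at h3 h4
        refine ⟨S.ownOut I ok !g, ?_, h1, h4.symm.trans hinp.symm⟩
        have hf' : (S.ldr !g).stage ≠ .found := by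
          intro hf'
          simp [half, half_found hf', hf'] at h1
        exact if_pos ⟨hf', h3.symm.trans hfar⟩
    have hr : r = open Classical in if S.Swaps I ok g then
        ({ m with grp := !m.grp, idx := .A, fresh := true },
          ((Gathering.out (I.graph.degree w) (S.board w)
            (Gathering.ofSet (c.crowd w)) (!m.grp)).map fun r => r.1.action .A).getD .stay)
        else ({ m with fresh := true }, if m.idx = .A then .move m.inp else .stay) := by
      simp only [r, Gathering.decideMem, hm.grp, hout g, hpos, and_false, if_false]
      by_cases h : S.Swaps I ok g
      · rw [if_pos h, if_pos (had.2 h)]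
      · rw [if_neg h, if_neg (mt had.1 h)]
    rw [hr]
    by_cases h : S.Swaps I ok g
    · have hi : i = .A := by simpa [Lone, h.1] using hl
      have hl' : l = (!g, .A) := by simp only [l, relabel_of hS h, hi, if_true]
      have hs := (hS.swaps (hS.swaps h).1).2 .A
      have hfar' : (S.half I ok).pos (!g) = w := by
        have := (hS.swaps h).1.2.2.1
        rw [Bool.not_not] at this
        exact this.symm.trans hfar
      have hf' : (S.ldr !g).stage ≠ .found := by
        intro hf'
        have := (hS.swaps h).1.1
        simp [half, half_found hf', hf'] at this
      rw [if_pos h, hl', hm.grp, hout, if_pos ⟨hf', hfar'⟩]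
      refine ⟨⟨rfl, rfl, rfl, by simp, fun h => (hs.2.1 h).elim⟩, ?_⟩
      simp only [act, if_neg hs.2.1]; rfl
    · have hl' : l = (g, i) := relabel_of_not hS h i
      obtain ⟨-, h2, h3, -⟩ := next_pre h i
      have hinp' := hinp.trans (h3 hl).symm
      rw [if_neg h, hl']
      refine ⟨⟨hm.grp, hm.idx, rfl, ?_, fun _ => hinp'⟩, ?_⟩
      · rintro rfl; simp [Lone] at hl
      · simp only [act, if_pos (h2.2 hl), hm.idx, hinp']

end Sys

end BHS

/-! ### Rounds of the execution as steps of the system -/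

namespace BHS

open RootedInstance

variable {V : Type*} [Fintype V] [DecidableEq V] {f k : ℕ} {I : RootedInstance V f k}

theorem step_board_of_write {A : Algorithm} {t : ℕ} {c : Config V k} {v : V} {x : List Bool}
    (h : ∀ a, (c.agent a).status = .active → (c.agent a).pos = v →
      (A (I.view c a)).write = some x)
    (he : ∃ a, (c.agent a).status = .active ∧ (c.agent a).pos = v) :
    (I.step A t c).board v = x := by
  unfold step
  dsimp only
  obtain ⟨a, ha⟩ := he
  cases hf : (List.finRange k).findSome? _ with
  | none =>
    have := List.findSome?_eq_none_iff.1 hf a (List.mem_finRange a)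
    rw [if_pos ha, h a ha.1 ha.2] at this
    simp at this
  | some y =>
    obtain ⟨b, -, hb⟩ := List.exists_of_findSome?_eq_some hf
    split_ifs at hb with hb'
    rw [h b hb'.1 hb'.2, Option.some.injEq] at hb
    simp [hb]

theorem step_board_of_not_write {A : Algorithm} {t : ℕ} {c : Config V k} {v : V}
    (h : ∀ a, (c.agent a).status = .active → (c.agent a).pos = v →
      (A (I.view c a)).write = none) :
    (I.step A t c).board v = c.board v := by
  unfold step
  dsimp only
  rw [List.findSome?_eq_none_iff.2]
  · rfl
  · intro a _
    split_ifs with ha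
    · exact h a ha.1 ha.2
    · rfl

theorem step_agent_active {A : Algorithm} {t : ℕ} {c : Config V k} {a : Fin k}
    (h : (c.agent a).status = .active) :
    (I.step A t c).agent a = I.apply t (c.agent a).pos (A (I.view c a)) := if_pos h

theorem step_agent_not {A : Algorithm} {t : ℕ} {c : Config V k} {a : Fin k}
    (h : (c.agent a).status ≠ .active) : (I.step A t c).agent a = c.agent a := if_neg h

theorem search_fresh {v : View} {m : Mem} (hm : v.mem = m.bits) (hf : m.fresh = true) :
    search v = ⟨(m.record v.sensor).bits, none, .stay⟩ := by
  simp [search, hm, Mem.ofBits_bits, hf]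

theorem search_joint {v : View} {m : Mem} {b : Board} {deg : ℕ} {X : Finset (List Bool)}
    (hm : v.mem = m.bits) (hf : m.fresh = false) (hb : v.board = b.bits)
    (hd : v.degree = deg) (hX : insert v.mem (v.others.image Prod.snd) = X) :
    search v = ⟨((Gathering.ofSet X).decideMem deg b m).1.bits,
      some ((Gathering.ofSet X).newBoard deg b).bits,
      ((Gathering.ofSet X).decideMem deg b m).2⟩ := by
  subst hX hd
  unfold search
  rw [show Mem.ofBits v.mem = some m by rw [hm, Mem.ofBits_bits],
    show Board.ofBits v.board = b by rw [hb, Board.ofBits_bits]]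
  simp [hf]

namespace Sys

variable {S : Sys V} {ok : Bool → Prop} {lab : Fin k ≃ Bool × Idx} {c : Config V k}

theorem Wf.pre_ne (hS : S.Wf I) {g : Bool} {i : Idx} {w : V} (h : S.pre I g i = some w) :
    w ≠ I.blackHole := by
  unfold pre enter at h
  split_ifs at h with _ _ h3
  · simp only [Option.some.injEq] at h; exact h ▸ h3
  · simp only [Option.some.injEq] at h; exact h ▸ (hS.ldr g).pos_ne

theorem SimWith.active {fresh : Bool} (hC : S.SimWith I ok fresh lab c) {a : Fin k}
    (ha : (c.agent a).status = .active) : ∃ m : Mem, (S.ldr (lab a).1).stage ≠ .found ∧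
      S.place I ok (lab a).1 (lab a).2 = some (c.agent a).pos ∧ (c.agent a).mem = m.bits ∧
      m.fresh = fresh ∧
      S.MemOk I ok (lab a).1 (lab a).2 (cond fresh (m.record (c.agent a).sensor) m) := by
  cases hC.agent a with
  | dead _ hs => simp [hs] at ha
  | done _ _ _ hs => simp [hs] at ha
  | alive hf h hs hm hfr hok => exact ⟨_, hf, h, hm, hfr, hok⟩

/-- A round in which the groups give orders. -/
theorem Sim.order (hS : S.Sound I) (h : S.Sim I ok false c) (t : ℕ) :
    (S.next I ok).Sim I ((S.next I ok).Ok I t) true (I.step search t c) := by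
  obtain ⟨lab, hC⟩ := h
  have hH := hS.1.half (ok := ok)
  have hsearch : ∀ a m, (c.agent a).status = .active → (c.agent a).mem = Mem.bits m →
      m.fresh = false → search (I.view c a) = _ := fun a m ha hm hfr =>
    search_joint (v := I.view c a) (deg := I.graph.degree (c.agent a).pos) hm hfr (hC.board _) rfl (view_crowd (by simp [ha]))
  refine ⟨lab.trans (S.relabel ok I), fun a => ?_, fun w => ?_⟩
  · rw [Equiv.trans_apply]
    have hp := next_pre_relabel hS (lab a).1 (lab a).2 (ok := ok)
    rw [← place_eq_pre hS.1] at hp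
    cases hC.agent a with
    | dead h hs =>
      rw [step_agent_not (by simp [hs])]
      refine .dead ?_ hs
      unfold place
      rw [hp, h]; rfl
    | done hf hi hpos hs hm hg hc hl =>
      rw [step_agent_not (by simp [hs])]
      have hH' : ((S.half I ok).ldr (lab a).1) = S.ldr (lab a).1 := by simp [half, half_found hf]
      have hn : ¬ S.Swaps I ok (lab a).1 := fun h => by have := h.1; simp [hH', hf] at this
      have hlab : S.relabel ok I (lab a) = lab a := relabel_of_not hS hn _
      have hL : (S.next I ok).ldr (lab a).1 = S.ldr (lab a).1 := by
        rw [next_ldr (reactOut_found (by rw [hH', hf])), hH']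
      have hnp : (S.next I ok).pos (lab a).1 = S.pos (lab a).1 :=
        S.newPos_of_not I ok (by simp [Ldr.moving, hf])
      rw [hlab]
      exact .done (by rw [hL, hf]) hi (hpos.trans hnp.symm) (by rw [hL, hs]) hm hg hc
        (hl.trans hL.symm)
    | @alive m hf h hs hm hfr hok =>
      simp only [cond_false] at hok
      rw [step_agent_active hs, hsearch a m hs hm hfr]
      rw [h] at hp
      have hpre := h
      rw [place_eq_pre hS.1] at hpre
      obtain ⟨h1, h2⟩ := hC.decideMem hS (hH.pre_ne hpre) hok hf hpre
      exact apply_ok (d := ⟨_, _, _⟩) hS.1.next hp (by dsimp only) h1 h2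
  · by_cases hw : ∃ a, (c.agent a).status = .active ∧ (c.agent a).pos = w
    · refine step_board_of_write ?_ hw
      rintro a ha rfl
      obtain ⟨m, hf, hp, hm, hfr, hok⟩ := hC.active ha
      rw [place_eq_pre hS.1] at hp
      rw [hsearch a m ha hm hfr]
      exact congrArg (fun b => some (Board.bits b)) (hC.newBoard hS.1 (hH.pre_ne hp))
    · rw [step_board_of_not_write fun a h1 h2 => (hw ⟨a, h1, h2⟩).elim, hC.board]
      -- A leader at this node which has not finished would be active there, so no group edits the
      -- whiteboard.
      have : ∀ g, (if S.newPos I ok g = w then S.edit I ok g else .nil) = .nil := by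
        intro g
        split_ifs with hg
        · by_cases hf : (S.ldr g).stage = .found
          · exact edit_found hf
          · exfalso
            have ha := hC.agent (lab.symm (g, .C))
            rw [Equiv.apply_symm_apply] at ha
            have hpl : S.place I ok g .C = some w := by
              rw [place_eq_pre hS.1]
              simpa [pre, Lone] using (show (S.half I ok).pos g = w from hg)
            cases ha with
            | dead h => simp [hpl] at h
            | done h => exact hf h
            | alive _ h hs =>
              exact hw ⟨_, hs, (Option.some.inj (hpl.symm.trans h)).symm⟩
        · rfl
      simp only [Sys.next, this]
      simp [Edit.apply, Edit.nil]

/-- A round in which the outcome of the orders is recorded. -/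
theorem Sim.record (h : S.Sim I ok true c) (t : ℕ) :
    S.Sim I ok false (I.step search t c) := by
  obtain ⟨lab, hC⟩ := h
  refine ⟨lab, fun a => ?_, fun w => ?_⟩
  · cases hC.agent a with
    | dead h hs => rw [step_agent_not (by simp [hs])]; exact .dead h hs
    | done hf hi hpos hs hm hg hc hl =>
      rw [step_agent_not (by simp [hs])]; exact .done hf hi hpos hs hm hg hc hl
    | @alive m hf h hs hm hfr hok =>
      rw [step_agent_active hs, search_fresh (v := I.view c a) hm hfr]
      have he : I.apply t (c.agent a).pos ⟨(m.record (c.agent a).sensor).bits, none, .stay⟩ =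
        ⟨(c.agent a).pos, (m.record (c.agent a).sensor).bits, .idle, .active⟩ := by
        simp only [RootedInstance.apply]
      rw [show (I.view c a).sensor = (c.agent a).sensor from rfl, he]
      refine .alive (m := m.record (c.agent a).sensor) hf h rfl (by dsimp only) ?_
        (by simpa only [cond_true, cond_false] using hok)
      · cases (c.agent a).sensor <;> rfl
  · rw [step_board_of_not_write, hC.board]
    intro a ha _
    obtain ⟨m, -, -, hm, hfr, -⟩ := hC.active ha
    rw [search_fresh (v := I.view c a) hm hfr]

end Sys

end BHS

namespace BHS

open RootedInstance

/-! ### The first round -/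

def labels : Fin 6 ≃ Bool × Idx where
  toFun r := initialLabel r
  invFun l := match l with
    | (false, .A) => 0
    | (false, .B) => 1
    | (false, .C) => 2
    | (true, .A) => 3
    | (true, .B) => 4
    | (true, .C) => 5
  left_inv r := by fin_cases r <;> rfl
  right_inv := by rintro ⟨_ | _, _ | _ | _⟩ <;> rfl

theorem Mem.ofBits_nil : Mem.ofBits [] = none := by
  unfold ofBits
  rw [dif_neg]
  rintro ⟨m, hm⟩
  exact m.bits_ne_nil hm

section Rank

variable {V : Type*} [Fintype V] [DecidableEq V] {f k : ℕ} (I : RootedInstance V f k)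

/-- The number of agents with smaller identifiers. -/
def rank (a : Fin k) : ℕ := (Finset.univ.filter fun b => I.ident b < I.ident a).card

theorem rank_lt (a : Fin k) : rank I a < k := by
  have : (Finset.univ.filter fun b => I.ident b < I.ident a) ⊂ Finset.univ := by
    rw [Finset.ssubset_univ_iff]
    intro h
    have := h.symm ▸ Finset.mem_univ a
    simp at this
  simpa [rank] using Finset.card_lt_card this

theorem rank_strictMono {a b : Fin k} (h : I.ident a < I.ident b) : rank I a < rank I b := by
  refine Finset.card_lt_card ?_
  rw [Finset.ssubset_iff_of_subset]
  · exact ⟨a, by simpa using h, by simp⟩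
  · intro x hx
    simp only [Finset.mem_filter, Finset.mem_univ, true_and] at hx ⊢
    exact hx.trans h

theorem rank_injective : Function.Injective fun a => (⟨rank I a, rank_lt I a⟩ : Fin k) := by
  intro a b h
  simp only [Fin.mk.injEq] at h
  refine I.ident_injective (le_antisymm ?_ ?_)
  · by_contra hlt; exact (rank_strictMono I (not_le.1 hlt)).ne h.symm
  · by_contra hlt; exact (rank_strictMono I (not_le.1 hlt)).ne h

noncomputable def rankEquiv : Fin k ≃ Fin k :=
  Equiv.ofBijective _ (Finite.injective_iff_bijective.1 (rank_injective I))

theorem card_smaller (a : Fin k) :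
    ((I.view I.init a).others.filter fun o => o.1 < (I.view I.init a).ident).card = rank I a := by
  have : (I.view I.init a).others.filter (fun o => o.1 < (I.view I.init a).ident) =
      (Finset.univ.filter fun b => I.ident b < I.ident a).image fun b => (I.ident b, []) := by
    ext o
    rw [Finset.mem_filter, view, Finset.mem_image, Finset.mem_image]
    simp only [init, Finset.mem_filter, Finset.mem_univ, true_and]
    constructor
    · rintro ⟨⟨j, h1, rfl⟩, h2⟩
      exact ⟨j, h2, rfl⟩
    · rintro ⟨j, h1, rfl⟩
      exact ⟨⟨j, (@Finset.mem_filter _ _ (_) _ _).2 ⟨Finset.mem_univ _, by rintro rfl; exact h1.false, rfl,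
        by simp⟩, rfl⟩, h1⟩
  rw [this, Finset.card_image_of_injective]
  · rfl
  · intro x y h
    simp only [Prod.mk.injEq, and_true] at h
    exact I.ident_injective h

end Rank

section Run

variable {V : Type*} [Fintype V] [DecidableEq V] {f : ℕ} (I : RootedInstance V f 6)

theorem search_init (a : Fin 6) :
    search (I.view I.init a) =
      ⟨(initialMem (labels (rankEquiv I a))).bits, some initialBoard.bits, .stay⟩ := by
  have h : Mem.ofBits (I.view I.init a).mem = none := Mem.ofBits_nil
  unfold search
  rw [h]
  dsimp only
  rw [card_smaller]
  rfl

theorem sim_initial (ok : Bool → Prop) : (Sys.initial I).Sim I ok false (I.run search 1) := by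
  refine ⟨(rankEquiv I).trans labels, fun a => ?_, fun w => ?_⟩
  · change Sys.AgentOk I _ ok false _ _ ((I.step search 0 I.init).agent a)
    rw [step_agent_active rfl, search_init, Equiv.trans_apply]
    generalize labels (rankEquiv I a) = l
    have he : I.apply 0 (I.init.agent a).pos ⟨(initialMem l).bits, some initialBoard.bits, .stay⟩ =
      ⟨I.root, (initialMem l).bits, .idle, .active⟩ := by
      simp only [RootedInstance.apply, init]
    have hs : ((Sys.initial I).ldr l.1).stage = .plan := rfl
    rw [he]
    refine .alive (m := initialMem l) (by simp [hs]) ?_ rfl (by dsimp only) rfl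
      ⟨rfl, rfl, fun _ => ⟨rfl, rfl, ?_, ?_⟩, ?_⟩
    · simp only [Sys.place, Sys.pre, Sys.Lone, Sys.Goes, hs]
      simp [Sys.initial, initialLdr]
    · simp [initialMem, Ldr.moving, hs]
    · simp [initialMem]
    · simp [Sys.Away, hs]
  · change (I.step search 0 I.init).board w = _
    by_cases hw : w = I.root
    · subst hw
      rw [step_board_of_write (x := initialBoard.bits)]
      · simp [Sys.initial]
      · intro a _ _; rw [search_init]
      · exact ⟨0, rfl, rfl⟩
    · rw [step_board_of_not_write]
      · simp [Sys.initial, hw, Board.bits_blank, init]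
      · intro a _ h
        exact (hw h.symm).elim

/-- The orders given in the course of the execution. -/
noncomputable def sys : ℕ → Sys V
  | 0 => Sys.initial I
  | j + 1 => (sys j).next I ((sys j).Ok I (2 * j - 1))

end Run

/-! ### Correctness and running time of the whole execution -/

variable {V : Type*} [Fintype V] [DecidableEq V] {I : RootedInstance V 1 6}

/-- Since a reset sets `b` to 2W + 1, the number a(2W + 2) + b expresses the lexicographic order and
drops by at least one in every step until the black hole is found. -/
theorem sys_found_or {j : ℕ} :
    (sys I j).Wf I ∧ ((∃ g, ((sys I j).ldr g).stage = .found) ∨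
      ∃ h a b, (sys I j).Prog I h a b ∧ a * (2 * weightBound I + 2) + b + j ≤
        weightBound I * (2 * weightBound I + 2) + (2 * weightBound I + 1)) := by
  induction j with
  | zero =>
    have := Sys.Prog.initial I.root_safe
    exact ⟨this.wf, .inr ⟨_, _, _, this, by omega⟩⟩
  | succ j ih =>
    obtain ⟨hW, ih⟩ := ih
    refine ⟨hW.next, ?_⟩
    by_cases hnf : ∃ g, ((sys I (j + 1)).ldr g).stage = .found
    · exact .inl hnf
    · right
      have hnf' : ∀ g, ((sys I (j + 1)).ldr g).stage ≠ .found := fun g hg => hnf ⟨g, hg⟩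
      rcases ih with ⟨g, hg⟩ | ⟨h, a, b, hP, hab⟩
      · have h1 : (((sys I j).half I ((sys I j).Ok I (2 * j - 1))).ldr g).stage = .found := by
          simp [Sys.half, Sys.half_found hg, hg]
        exact (hnf' g (by rw [sys, Sys.next_ldr (Sys.reactOut_found h1), h1])).elim
      · rcases hP.next hnf' with ⟨h', a', ha', hP'⟩ | ⟨b', hb', hP'⟩
        · refine ⟨h', a', _, hP', ?_⟩
          have := Nat.mul_le_mul_right (2 * weightBound I + 2) (Nat.succ_le_of_lt ha')
          rw [Nat.succ_mul] at this
          omega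
        · exact ⟨h, a, b', hP', by omega⟩

theorem sys_sound (j : ℕ) : (sys I j).Sound I := by
  obtain ⟨h1, h2⟩ := sys_found_or (I := I) (j := j)
  refine ⟨h1, ?_⟩
  rcases h2 with h2 | ⟨h, _, _, h2, -⟩
  · exact .inr h2
  · exact .inl ⟨h, h2.duo⟩

/-- For positive `j` the orders of `sys I j` are given and executed in round 2j - 1, and their
outcome is recorded in round 2j. For j = 0 the truncated subtraction is harmless, because nobody is
ordered to move. -/
theorem sim_run (j : ℕ) :
    (sys I j).Sim I ((sys I j).Ok I (2 * j - 1)) false (I.run search (2 * j + 1)) := by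
  induction j with
  | zero => exact sim_initial I _
  | succ j ih => exact (ih.order (sys_sound j) (2 * j + 1)).record (2 * j + 2)

theorem sim_run_even (j : ℕ) : (sys I (j + 1)).Sim I ((sys I (j + 1)).Ok I (2 * j + 1)) true
    (I.run search (2 * j + 2)) :=
  (sim_run j).order (sys_sound j) (2 * j + 1)

theorem Sys.Sim.leadsToBlackHole {S : Sys V} {ok : Bool → Prop} {fresh : Bool} {c : Config V 6}
    (hS : S.Wf I) (h : S.Sim I ok fresh c) {a : Fin 6} {p : ℕ}
    (ha : (c.agent a).status = .terminated p) : I.LeadsToBlackHole (c.agent a).pos p := by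
  obtain ⟨lab, hC⟩ := h
  cases hC.agent a with
  | dead _ hs => simp [hs] at ha
  | alive _ _ hs => simp [hs] at ha
  | done hf hi hp hs =>
    rw [hs, Status.terminated.injEq] at ha
    subst ha
    have hL := hS.ldr (lab a).1
    have hlt := hL.port_lt (by simp [hf])
    rw [hp]
    exact ⟨hlt, by rw [← far_eq hlt]; exact hL.found hf⟩

theorem announcement_correct {t : ℕ} {a : Fin 6} {p : ℕ}
    (ha : ((I.run search t).agent a).status = .terminated p) :
    I.LeadsToBlackHole ((I.run search t).agent a).pos p := by
  obtain ⟨j, rfl | rfl⟩ := Nat.even_or_odd' t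
  · cases j with
    | zero => simp [run, init] at ha
    | succ j => exact (sim_run_even j).leadsToBlackHole (sys_sound _).1 ha
  · exact (sim_run j).leadsToBlackHole (sys_sound _).1 ha

theorem exists_terminated :
    ∃ τ ≤ 4 * (weightBound I + 1) ^ 2 + 1, ∃ a p,
      ((I.run search τ).agent a).status = .terminated p := by
  obtain ⟨P, hP⟩ : ∃ P, P = (weightBound I + 1) ^ 2 := ⟨_, rfl⟩
  rw [← hP]
  -- With N = `weightBound I` the potential starts at 2N² + 4N + 1, which is less than 2(N + 1)². It
  -- is exhausted after that many steps, each of which takes two rounds.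
  obtain ⟨-, h⟩ := sys_found_or (I := I) (j := 2 * P)
  refine ⟨2 * (2 * P) + 1, by omega, ?_⟩
  rcases h with ⟨g, hg⟩ | ⟨h, a, b, -, hab⟩
  · obtain ⟨lab, hC⟩ := sim_run (I := I) (2 * P)
    have ha := hC.agent (lab.symm (g, .C))
    rw [Equiv.apply_symm_apply] at ha
    cases ha with
    | dead h => simp [Sys.place, Sys.pre, Sys.Lone, Sys.Goes, hg] at h
    | done _ _ _ hs => exact ⟨_, _, hs⟩
    | alive hf => exact (hf hg).elim
  · exfalso
    generalize weightBound I = N at *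
    subst hP
    have := Nat.zero_le (a * (2 * N + 2))
    nlinarith

end BHS

namespace BHS

/-! ### The size of the memories and whiteboards -/

def Ldr.Small (K : ℕ) (L : Ldr) : Prop := L.port ≤ K ∧ L.epoch ≤ K

def NodeRecSmall (K : ℕ) (r : NodeRec) : Prop := (∀ q, r.1 = some q → q ≤ K) ∧ r.2 ≤ K

structure Mem.Small (K : ℕ) (m : Mem) : Prop where
  inp : m.inp ≤ K
  ldr : m.ldr.Small K
  clock : m.clock ≤ K

structure Board.Small (K : ℕ) (b : Board) : Prop where
  h : ∀ r, b.h = some r → NodeRecSmall K r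
  x : ∀ r, b.x = some r → r.1 ≤ K ∧ NodeRecSmall K r.2
  tok : ∀ q, b.tok = some q → q.1 ≤ K

structure Edit.Small (K : ℕ) (e : Edit) : Prop where
  h : ∀ r, e.h = some r → NodeRecSmall K r
  x : ∀ r, e.x = some r → r.1 ≤ K ∧ NodeRecSmall K r.2
  tok : ∀ q, e.tok = some (some q) → q.1 ≤ K

theorem Ldr.Small.mono {K K' : ℕ} {L : Ldr} (h : L.Small K) (hK : K ≤ K') : L.Small K' :=
  ⟨h.1.trans hK, h.2.trans hK⟩

theorem NodeRecSmall.mono {K K' : ℕ} {r : NodeRec} (h : NodeRecSmall K r) (hK : K ≤ K') :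
    NodeRecSmall K' r :=
  ⟨fun q hq => (h.1 q hq).trans hK, h.2.trans hK⟩

theorem Mem.Small.mono {K K' : ℕ} {m : Mem} (h : m.Small K) (hK : K ≤ K') : m.Small K' :=
  ⟨h.1.trans hK, h.2.mono hK, h.3.trans hK⟩

theorem Board.Small.mono {K K' : ℕ} {b : Board} (h : b.Small K) (hK : K ≤ K') : b.Small K' :=
  ⟨fun r hr => (h.1 r hr).mono hK, fun r hr => ⟨(h.2 r hr).1.trans hK, (h.2 r hr).2.mono hK⟩,
    fun q hq => (h.3 q hq).trans hK⟩

theorem Edit.Small.nil {K : ℕ} : Edit.nil.Small K := ⟨by simp [Edit.nil], by simp [Edit.nil],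
  by simp [Edit.nil]⟩

theorem Edit.Small.apply {K : ℕ} {e : Edit} {b : Board} (he : e.Small K) (hb : b.Small K) :
    (e.apply b).Small K := by
  refine ⟨fun r hr => ?_, fun r hr => ?_, fun q hq => ?_⟩
  · cases h : e.h with
    | none => exact hb.1 r (by simpa [Edit.apply, h] using hr)
    | some a => exact he.1 r (by simpa [Edit.apply, h] using hr)
  · cases h : e.x with
    | none => exact hb.2 r (by simpa [Edit.apply, h] using hr)
    | some a => exact he.2 r (by simpa [Edit.apply, h] using hr)
  · cases h : e.tok with
    | none => exact hb.3 q (by simpa [Edit.apply, h] using hq)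
    | some a => exact he.3 q (by simpa [Edit.apply, h] using hq)

theorem Edit.Small.comp {K : ℕ} {e f : Edit} (he : e.Small K) (hf : f.Small K) :
    (e.comp f).Small K := by
  refine ⟨fun r hr => ?_, fun r hr => ?_, fun q hq => ?_⟩
  · cases h : f.h with
    | none => exact he.1 r (by simpa [Edit.comp, h] using hr)
    | some a => exact hf.1 r (by simpa [Edit.comp, h] using hr)
  · cases h : f.x with
    | none => exact he.2 r (by simpa [Edit.comp, h] using hr)
    | some a => exact hf.2 r (by simpa [Edit.comp, h] using hr)
  · cases h : f.tok with
    | none => exact he.3 q (by simpa [Edit.comp, h] using hq)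
    | some a => exact hf.3 q (by simpa [Edit.comp, h] using hq)

theorem Edit.Small.put {K : ℕ} {L : Ldr} {r : NodeRec} (hL : L.Small K) (hr : NodeRecSmall K r) :
    (Edit.put L r).Small K := by
  unfold Edit.put
  split_ifs
  · exact ⟨by rintro _ ⟨⟩; exact hr, by simp, by simp⟩
  · exact ⟨by simp, by rintro _ ⟨⟩; exact ⟨hL.2, hr⟩, by simp⟩

theorem Edit.Small.root {K c : ℕ} (hc : c ≤ K) : (Edit.root c).Small K :=
  ⟨by simp [Edit.root], by rintro _ ⟨⟩; exact ⟨hc, by simp [NodeRecSmall]⟩, by simp [Edit.root]⟩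

theorem Ldr.Small.initial {K c : ℕ} (hc : c ≤ K) : (Ldr.initial c).Small K :=
  ⟨Nat.zero_le _, hc⟩

theorem Ldr.Small.getRec {K : ℕ} {L : Ldr} {b : Board} {r : NodeRec} (hb : b.Small K)
    (h : L.getRec b = some r) : NodeRecSmall K r := by
  unfold Ldr.getRec at h
  split_ifs at h
  · exact hb.1 r h
  · cases hx : b.x with
    | none => simp [hx] at h
    | some a =>
      simp only [hx, Option.bind_some, Option.ite_none_right_eq_some, Option.some.injEq] at h
      exact h.2 ▸ (hb.2 a hx).2

section Own

variable {K deg clock inp : ℕ} {L : Ldr} {w : Board} (hd : deg ≤ K) (hc : clock ≤ K)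
  (hi : inp ≤ K) (hL : L.Small K) (hw : w.Small K)

include hd hc hL hw in
theorem planStep_small : (planStep deg clock L w).1.Small K ∧ (planStep deg clock L w).2.Small K := by
  unfold planStep
  split
  · exact ⟨hL, .nil⟩
  · rename_i par next hr
    have hr := Ldr.Small.getRec hw hr
    by_cases hn : next < deg
    · rw [if_pos hn]
      split_ifs
      · exact ⟨hL, .put hL ⟨hr.1, by dsimp; omega⟩⟩
      · exact ⟨⟨by dsimp; omega, hL.2⟩, .put hL ⟨hr.1, by dsimp; omega⟩⟩
    · rw [if_neg hn]
      cases par with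
      | some q => exact ⟨⟨hr.1 _ rfl, hL.2⟩, .nil⟩
      | none =>
        dsimp only
        split_ifs
        · exact ⟨hL, .nil⟩
        · exact ⟨.initial hc, .root hc⟩

include hi hL in
theorem arrive_small : (arrive inp L w).1.Small K ∧ (arrive inp L w).2.Small K := by
  unfold arrive
  split_ifs
  · split
    · refine ⟨hL, .put hL ⟨?_, Nat.zero_le _⟩⟩
      rintro q ⟨⟩; exact hi
    · exact ⟨⟨hi, hL.2⟩, .nil⟩
  · exact ⟨hL, .nil⟩

include hi hL in
theorem joined_small : (joined inp L w).1.Small K ∧ (joined inp L w).2.Small K := by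
  unfold joined
  split
  · split_ifs
    · exact ⟨⟨hi, hL.2⟩, by simp, by simp, by simp⟩
    · exact arrive_small hi hL
  · exact arrive_small hi hL

include hd hc hi hL hw in
theorem own_small {moved a b : Bool} : (own deg clock moved inp a b L w).1.Small K ∧
    (own deg clock moved inp a b L w).2.Small K := by
  unfold own
  split
  · exact planStep_small hd hc hL hw
  · split_ifs <;> exact ⟨hL, .nil⟩
  · split_ifs <;> exact ⟨hL, .nil⟩
  · split_ifs
    · exact joined_small hi hL
    · exact ⟨hL, .nil⟩
  · split_ifs
    · exact arrive_small hi hL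
    · exact ⟨hL, .nil⟩
    · exact ⟨.initial hc, .root hc⟩
  · exact ⟨hL, .nil⟩

include hc hL in
theorem react_small {P : Pres} (hP : ∀ q, P = .lone q → q ≤ K) :
    (react clock L P).1.Small K ∧ (react clock L P).2.Small K := by
  unfold react
  split
  · exact ⟨hL, .nil⟩
  · split_ifs
    · exact ⟨hL, .nil⟩
    · exact ⟨.initial hc, .root hc⟩
    all_goals exact ⟨hL, .nil⟩
  · rename_i q
    have hr : ((Edit.root clock).comp ⟨none, none, some (some (q, L.fwd))⟩).Small K :=
      .comp (.root hc) ⟨by simp, by simp, by rintro q' ⟨⟩; exact hP _ rfl⟩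
    split_ifs
    all_goals first
      | exact ⟨hL, .nil⟩
      | exact ⟨.initial hc, hr⟩

end Own

namespace Gathering

variable {K deg : ℕ} {b : Board} {J : Gathering} (hd : deg ≤ K) (hb : b.Small K)
  (hJ : ∀ g i m, J g i = some m → m.Small K)

include hJ in
theorem leader_small {g : Bool} {m : Mem} (h : J.leader g = some m) : m.Small K :=
  hJ _ _ _ (Option.filter_eq_some_iff.1 h).1

include hd hb hJ in
theorem ownOut_small {g : Bool} {r : Ldr × Edit} (h : J.ownOut deg b g = some r) :
    r.1.Small K ∧ r.2.Small K := by
  obtain ⟨m, hm, rfl⟩ := Option.map_eq_some_iff.1 h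
  have := leader_small hJ hm
  exact own_small hd this.clock this.inp this.ldr hb

include hd hb hJ in
theorem out_small {g : Bool} {r : Ldr × Edit} (h : J.out deg b g = some r) :
    r.1.Small K ∧ r.2.Small K := by
  obtain ⟨m, hm, h⟩ := Option.bind_eq_some_iff.1 h
  obtain ⟨r', hr', rfl⟩ := Option.map_eq_some_iff.1 h
  have h1 := leader_small hJ hm
  have h2 := ownOut_small hd hb hJ hr'
  have h3 := react_small (P := J.pres deg b !g) h1.clock h2.1 (by
    intro q hq
    unfold pres at hq
    split at hq
    · split_ifs at hq
    · split at hq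
      · rename_i m' hm'
        obtain rfl : m'.inp = q := by simpa using hq
        cases hA : J (!g) .A with
        | none => exact (hJ _ _ _ (by simpa [hA] using hm')).inp
        | some m'' =>
          obtain rfl : m'' = m' := by simpa [hA] using hm'
          exact (hJ _ _ _ hA).inp
      · simp at hq)
  exact ⟨h3.1, h2.2.comp h3.2⟩

include hd hb hJ in
theorem newBoard_small : (J.newBoard deg b).Small K := by
  have key : ∀ g, ((J.out deg b g).map Prod.snd |>.getD .nil).Small K := by
    intro g
    cases h : J.out deg b g with
    | none => exact .nil
    | some r => exact (out_small hd hb hJ h).2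
  exact (key true).apply ((key false).apply hb)

include hd hb hJ in
-- The bound grows by one because of the clock; all other numbers are copied, or are ports bounded
-- by the degree.
theorem decideMem_small {m : Mem} (hm : m.Small K) : (J.decideMem deg b m).1.Small (K + 1) := by
  have hm' := hm.mono (Nat.le_succ K)
  unfold decideMem
  split
  · rename_i r hr
    dsimp only
    split_ifs
    · exact ⟨hm'.1, (out_small hd hb hJ hr).1.mono (Nat.le_succ K), Nat.succ_le_succ hm.clock⟩
    · exact ⟨hm'.1, hm'.2, hm'.3⟩
  · split_ifs <;> exact ⟨hm'.1, hm'.2, hm'.3⟩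

end Gathering

section Run

variable {V : Type*} [Fintype V] [DecidableEq V] {f k : ℕ} {I : RootedInstance V f k}

open RootedInstance

def MemSmall (K : ℕ) (l : List Bool) : Prop := l = [] ∨ ∃ m : Mem, m.Small K ∧ l = m.bits

def BoardSmall (K : ℕ) (l : List Bool) : Prop := ∃ b : Board, b.Small K ∧ l = b.bits

def SensorSmall (K : ℕ) (s : Sensor) : Prop := ∀ q, s = .arrived q → q ≤ K

theorem search_small {v : View} {K : ℕ} (hm : MemSmall K v.mem) (hs : SensorSmall K v.sensor)
    (hd : v.degree ≤ K) (hb : BoardSmall K v.board) (ho : ∀ o ∈ v.others, MemSmall K o.2) :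
    MemSmall (K + 1) (search v).mem ∧
      ∀ b, (search v).write = some b → BoardSmall (K + 1) b := by
  rcases hm with hm | ⟨m, hmK, hm⟩
  · have h : Mem.ofBits v.mem = none := by rw [hm, Mem.ofBits_nil]
    have he : search v = ⟨(initialMem (initialLabel
        (v.others.filter fun o => o.1 < v.ident).card)).bits, some initialBoard.bits, .stay⟩ := by
      unfold search
      rw [h]
    rw [he]
    dsimp only
    refine ⟨.inr ⟨_, ⟨?_, ?_, ?_⟩, rfl⟩, ?_⟩
    · simp [initialMem]
    · simp [initialMem, initialLdr, Ldr.Small]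
    · simp [initialMem]
    · rintro b ⟨⟩
      refine ⟨initialBoard, ⟨?_, ?_, ?_⟩, rfl⟩
      · rintro _ ⟨⟩; simp [NodeRecSmall]
      · rintro _ ⟨⟩; simp [NodeRecSmall]
      · simp [initialBoard]
  · cases hf : m.fresh with
    | true =>
      rw [search_fresh hm hf]
      dsimp only
      refine ⟨.inr ⟨_, Mem.Small.mono ?_ (Nat.le_succ K), rfl⟩, by simp⟩
      cases hq : v.sensor with
      | arrived q => exact ⟨hs q hq, hmK.2, hmK.3⟩
      | _ => exact ⟨hmK.1, hmK.2, hmK.3⟩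
    | false =>
      obtain ⟨b, hbK, hb⟩ := hb
      rw [search_joint hm hf hb rfl rfl]
      have hJ : ∀ g i m', Gathering.ofSet (insert v.mem (v.others.image Prod.snd)) g i = some m' →
          m'.Small K := by
        intro g i m' h
        obtain ⟨-, -, h3⟩ := Gathering.ofSet_some h
        have hsm : MemSmall K m'.bits := by
          rcases Finset.mem_insert.1 h3 with h3 | h3
          · rw [h3]; exact .inr ⟨m, hmK, hm⟩
          · obtain ⟨o, ho', h4⟩ := Finset.mem_image.1 h3
            exact h4 ▸ ho o ho'
        rcases hsm with h4 | ⟨m'', h4, h5⟩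
        · exact (m'.bits_ne_nil h4).elim
        · exact Mem.bits_injective h5 ▸ h4
      dsimp only
      refine ⟨.inr ⟨_, Gathering.decideMem_small hd hbK hJ hmK, rfl⟩, ?_⟩
      intro b' hb'
      simp only [Option.some.injEq] at hb'
      exact ⟨_, (Gathering.newBoard_small hd hbK hJ).mono (Nat.le_succ K), hb'.symm⟩

theorem apply_small {t K : ℕ} {v : V} {d : Decision} (hK : Fintype.card V ≤ K)
    (hd : MemSmall K d.mem) :
    MemSmall K (I.apply t v d).mem ∧ SensorSmall K (I.apply t v d).sensor := by
  unfold RootedInstance.apply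
  split
  · exact ⟨hd, by simp [SensorSmall]⟩
  · rename_i p _
    unfold tryMove
    by_cases hp : p < I.graph.degree v
    · rw [dif_pos hp]
      dsimp only
      by_cases ha : (I.snapshot t).Adj v (I.ports v ⟨p, hp⟩)
      · rw [if_pos ha]
        refine ⟨hd, ?_⟩
        rintro q ⟨⟩
        exact (Fin.is_lt _).le.trans ((I.graph.degree_lt_card_verts _).le.trans hK)
      · rw [if_neg ha]
        exact ⟨hd, by simp [SensorSmall]⟩
    · rw [dif_neg hp]
      exact ⟨hd, by simp [SensorSmall]⟩
  · exact ⟨hd, by simp [SensorSmall]⟩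

/-- Ports are bounded by the number of nodes, and the clock, from which the epochs are taken,
advances by at most one per round. -/
theorem run_small (t : ℕ) :
    (∀ a, MemSmall (Fintype.card V + t) ((I.run search t).agent a).mem ∧
      SensorSmall (Fintype.card V + t) ((I.run search t).agent a).sensor) ∧
    ∀ v, BoardSmall (Fintype.card V + t) ((I.run search t).board v) := by
  have mono : ∀ {K l}, MemSmall K l → MemSmall (K + 1) l := by
    rintro K l (h | ⟨m, h1, h2⟩)
    · exact .inl h
    · exact .inr ⟨m, h1.mono (Nat.le_succ _), h2⟩
  induction t with
  | zero =>
    refine ⟨fun a => ⟨.inl rfl, by rintro q ⟨⟩⟩, fun v => ⟨.blank, ⟨?_, ?_, ?_⟩, ?_⟩⟩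
    · simp [Board.blank]
    · simp [Board.blank]
    · simp [Board.blank]
    · rw [Board.bits_blank]; rfl
  | succ t ih =>
    obtain ⟨h1, h2⟩ := ih
    have hs : ∀ a, _ := fun a => search_small (v := I.view (I.run search t) a) (h1 a).1 (h1 a).2
      ((I.graph.degree_lt_card_verts _).le.trans (Nat.le_add_right _ _)) (h2 _) (by
        intro o ho
        rw [view, Finset.mem_image] at ho
        obtain ⟨j, -, rfl⟩ := ho
        exact (h1 j).1)
    refine ⟨fun a => ?_, fun v => ?_⟩
    · change MemSmall _ ((I.step search t (I.run search t)).agent a).mem ∧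
        SensorSmall _ ((I.step search t (I.run search t)).agent a).sensor
      by_cases ha : ((I.run search t).agent a).status = .active
      · rw [step_agent_active ha]
        exact apply_small (by omega) (hs a).1
      · rw [step_agent_not ha]
        exact ⟨mono (h1 a).1, fun q hq => ((h1 a).2 q hq).trans (by omega)⟩
    · change BoardSmall _ ((I.step search t (I.run search t)).board v)
      unfold step
      dsimp only
      cases hf : (List.finRange k).findSome? _ with
      | none =>
        obtain ⟨b, h3, h4⟩ := h2 v
        exact ⟨b, h3.mono (by omega), h4⟩
      | some y =>
        obtain ⟨a, -, ha⟩ := List.exists_of_findSome?_eq_some hf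
        split_ifs at ha
        exact (hs a).2 y ha

end Run

end BHS

namespace BHS

/-! ### Lengths of the encodings -/

/-- Pairing at most doubles the number of bits. -/
theorem pair_lt_two_pow {a b p q r : ℕ} (ha : a < 2 ^ p) (hb : b < 2 ^ q) (hp : p ≤ r)
    (hq : q ≤ r) : Nat.pair a b < 2 ^ (2 * r) := by
  have h1 : a < 2 ^ r := ha.trans_le (Nat.pow_le_pow_right (by norm_num) hp)
  have h2 : b < 2 ^ r := hb.trans_le (Nat.pow_le_pow_right (by norm_num) hq)
  calc Nat.pair a b < (max a b + 1) ^ 2 := Nat.pair_lt_max_add_one_sq a b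
    _ ≤ (2 ^ r) ^ 2 := Nat.pow_le_pow_left (max_lt h1 h2) 2
    _ = 2 ^ (2 * r) := by rw [← pow_mul, mul_comm]

theorem succ_lt_two_pow {a p : ℕ} (ha : a < 2 ^ p) (hp : 0 < p) : a + 1 < 2 ^ (p + 1) := by
  have : 1 < 2 ^ p := Nat.one_lt_two_pow hp.ne'
  rw [pow_succ]; omega

theorem encode_bool_lt (b : Bool) {s : ℕ} (hs : 0 < s) : Encodable.encode b < 2 ^ s := by
  have h : Encodable.encode b < 2 ^ 1 := by cases b <;> decide
  exact h.trans_le (Nat.pow_le_pow_right (by norm_num) hs)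

theorem encode_option_lt {α : Type*} [Encodable α] {o : Option α} {p : ℕ} (hp : 0 < p)
    (h : ∀ a, o = some a → Encodable.encode a < 2 ^ p) : Encodable.encode o < 2 ^ (p + 1) := by
  cases o with
  | none => simp
  | some a => rw [Encodable.encode_some]; exact succ_lt_two_pow (h a rfl) hp

theorem length_bits_le {a p : ℕ} (ha : a < 2 ^ p) : a.bits.length ≤ p := by
  rw [Nat.size_eq_bits_len]; exact Nat.size_le.2 ha

/-- The eleven components are joined by ten nested pairings, each doubling the length, which gives
1024 s bits; the successor in `Mem.code` costs one more. -/
theorem Mem.Small.length_le {K s : ℕ} {m : Mem} (hm : m.Small K) (hK : K < 2 ^ s) (hs : 3 ≤ s) :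
    m.bits.length ≤ 1025 * s := by
  have h8 : 8 ≤ 2 ^ s := by
    calc 8 = 2 ^ 3 := by norm_num
      _ ≤ 2 ^ s := Nat.pow_le_pow_right (by norm_num) hs
  have hi : m.idx.code < 2 ^ s := by cases m.idx <;> simp only [Idx.code] <;> omega
  have hst : m.ldr.stage.code < 2 ^ s := by
    cases m.ldr.stage <;> simp only [Stage.code] <;> omega
  have hb : ∀ b : Bool, Encodable.encode b < 2 ^ s := fun b => encode_bool_lt b (by omega)
  have hn : ∀ n, n ≤ K → n < 2 ^ s := fun n h => h.trans_lt hK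
  have h1 := pair_lt_two_pow (r := s) (hn _ hm.ldr.2) (hn _ hm.clock) le_rfl le_rfl
  have h2 := pair_lt_two_pow (r := 2 * s) (hb m.ldr.hold) h1 (by omega) (by omega)
  have h3 := pair_lt_two_pow (r := 4 * s) (hb m.ldr.fwd) h2 (by omega) (by omega)
  have h4 := pair_lt_two_pow (r := 8 * s) (hn _ hm.ldr.1) h3 (by omega) (by omega)
  have h5 := pair_lt_two_pow (r := 16 * s) hst h4 (by omega) (by omega)
  have h6 := pair_lt_two_pow (r := 32 * s) (hn _ hm.inp) h5 (by omega) (by omega)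
  have h7 := pair_lt_two_pow (r := 64 * s) (hb m.moved) h6 (by omega) (by omega)
  have h8 := pair_lt_two_pow (r := 128 * s) (hb m.fresh) h7 (by omega) (by omega)
  have h9 := pair_lt_two_pow (r := 256 * s) hi h8 (by omega) (by omega)
  have h10 := pair_lt_two_pow (r := 512 * s) (hb m.grp) h9 (by omega) (by omega)
  have h11 := succ_lt_two_pow h10 (by omega)
  have : m.code < 2 ^ (2 * (512 * s) + 1) := by
    simp only [Mem.code, Encodable.encode_prod_val, Encodable.encode_nat]
    exact h11
  exact (length_bits_le this).trans (by omega)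

theorem encode_nodeRec_lt {K s : ℕ} {r : NodeRec} (hr : NodeRecSmall K r) (hK : K < 2 ^ s)
    (hs : 0 < s) : Encodable.encode r < 2 ^ (2 * (s + 1)) :=
  pair_lt_two_pow (r := s + 1)
    (encode_option_lt (p := s) hs fun q hq => ((hr.1 q hq).trans_lt hK : q < 2 ^ s))
    (show r.2 < 2 ^ s from hr.2.trans_lt hK) le_rfl (by omega)

theorem Board.Small.length_le {K s : ℕ} {b : Board} (hb : b.Small K) (hK : K < 2 ^ s)
    (hs : 3 ≤ s) : b.bits.length ≤ 1025 * s := by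
  have h1 : Encodable.encode b.h < 2 ^ (2 * (s + 1) + 1) :=
    encode_option_lt (by omega) fun r hr => encode_nodeRec_lt (hb.h r hr) hK (by omega)
  have h2 : Encodable.encode b.x < 2 ^ (2 * (2 * (s + 1)) + 1) :=
    encode_option_lt (by omega) fun r hr => pair_lt_two_pow
      (show r.1 < 2 ^ s from (hb.x r hr).1.trans_lt hK)
      (encode_nodeRec_lt (hb.x r hr).2 hK (by omega)) (by omega) le_rfl
  have h3 : Encodable.encode b.tok < 2 ^ (2 * s + 1) :=
    encode_option_lt (by omega) fun q hq => pair_lt_two_pow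
      (show q.1 < 2 ^ s from (hb.tok q hq).trans_lt hK) (encode_bool_lt q.2 (s := s) (by omega))
      le_rfl le_rfl
  have h4 := pair_lt_two_pow (r := 8 * s) h2 h3 (by omega) (by omega)
  have h5 := pair_lt_two_pow (r := 16 * s) h1 h4 (by omega) (by omega)
  have : b.code < 2 ^ (2 * (16 * s)) := h5
  exact (length_bits_le this).trans (by omega)

/-! ### Numerical bounds -/

section Bounds

variable {V : Type*} [Fintype V] [DecidableEq V] {k : ℕ} (I : RootedInstance V 1 k)

include I in
theorem one_lt_card : 1 < Fintype.card V :=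
  Fintype.one_lt_card_iff.2 ⟨_, _, I.root_safe⟩

theorem card_le_edges : Fintype.card V ≤ 2 * I.graph.edgeFinset.card := by
  have hG : I.graph.Connected := (I.snapshot_connected 0).mono (I.snapshot_le 0)
  have h := hG.card_vert_le_card_edgeSet_add_one
  rw [Nat.card_eq_fintype_card, Nat.card_eq_fintype_card, ← SimpleGraph.edgeFinset_card] at h
  have := one_lt_card I
  omega

theorem rounds_le : 4 * (weightBound I + 1) ^ 2 + 1 ≤ 33857 * I.graph.edgeFinset.card ^ 2 := by
  have h1 := card_le_edges I
  have h2 := one_lt_card I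
  -- The left-hand side is 48|E| + 12n + 20, where n ≤ 2|E| and |E| ≥ 1. Then 33857 = 4 · 92² + 1.
  have h3 : weightBound I + 1 ≤ 92 * I.graph.edgeFinset.card := by
    unfold weightBound; omega
  have h4 := Nat.pow_le_pow_left h3 2
  have h5 : 1 ≤ I.graph.edgeFinset.card ^ 2 := Nat.one_le_pow _ _ (by omega)
  rw [mul_pow] at h4
  generalize I.graph.edgeFinset.card ^ 2 = E at *
  generalize (weightBound I + 1) ^ 2 = P at *
  omega

theorem edges_le : I.graph.edgeFinset.card ≤ Fintype.card V ^ 2 := by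
  have := I.graph.card_edgeFinset_le_card_choose_two
  refine this.trans ?_
  rw [Nat.choose_two_right]
  calc Fintype.card V * (Fintype.card V - 1) / 2 ≤ Fintype.card V * (Fintype.card V - 1) :=
        Nat.div_le_self _ _
    _ ≤ Fintype.card V * Fintype.card V := Nat.mul_le_mul_left _ (Nat.sub_le _ _)
    _ = Fintype.card V ^ 2 := (sq _).symm

theorem numbers_lt : Fintype.card V + (4 * (weightBound I + 1) ^ 2 + 1) <
    2 ^ (27 * Nat.log 2 (Fintype.card V)) := by
  have h1 := rounds_le I
  have h2 := one_lt_card I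
  have h3 := Nat.pow_le_pow_left (edges_le I) 2
  rw [← pow_mul] at h3
  have h4 : Fintype.card V < 2 ^ (Nat.log 2 (Fintype.card V) + 1) :=
    Nat.lt_pow_succ_log_self (by norm_num) _
  have h5 : 1 ≤ Nat.log 2 (Fintype.card V) := Nat.log_pos (by norm_num) h2
  generalize Nat.log 2 (Fintype.card V) = l at *
  generalize Fintype.card V = n at *
  have h6 : n ≤ n ^ 4 := Nat.le_self_pow (by norm_num) n
  have h7 : n ^ 4 < (2 ^ (l + 1)) ^ 4 := Nat.pow_lt_pow_left h4 (by norm_num)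
  -- Here |E|² ≤ n⁴ and 33857 + 1 ≤ 2^16. The final exponent 20 + 4l is at most 27l because l ≥ 1.
  calc n + (4 * (weightBound I + 1) ^ 2 + 1) ≤ 2 ^ 16 * n ^ 4 := by
        have : 33857 + 1 ≤ 2 ^ 16 := by norm_num
        norm_num at h3 ⊢
        omega
    _ < 2 ^ 16 * (2 ^ (l + 1)) ^ 4 := Nat.mul_lt_mul_of_pos_left h7 (by norm_num)
    _ = 2 ^ (16 + (l + 1) * 4) := by rw [← pow_mul, ← pow_add]
    _ ≤ 2 ^ (27 * l) := Nat.pow_le_pow_right (by norm_num) (by omega)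

end Bounds

/-- The constant is 27675 = 1025 · 27: numbers below 2^(27 log n) are stored, and s-bit numbers lead
to encodings of at most 1025 s bits. -/
theorem solvedWithin_search {V : Type*} [Fintype V] [DecidableEq V] (I : RootedInstance V 1 6) :
    I.SolvedWithin search (33857 * I.graph.edgeFinset.card ^ 2)
      (27675 * Nat.log 2 (Fintype.card V)) := by
  refine ⟨fun t a p h => announcement_correct h, ?_⟩
  obtain ⟨τ, hτ, a, p, ha⟩ := exists_terminated (I := I)
  have hl : 1 ≤ Nat.log 2 (Fintype.card V) := Nat.log_pos (by norm_num) (one_lt_card I)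
  refine ⟨τ, hτ.trans (rounds_le I), ⟨a, p, ha⟩, fun t ht => ?_⟩
  have hK : Fintype.card V + t < 2 ^ (27 * Nat.log 2 (Fintype.card V)) :=
    lt_of_le_of_lt (by omega) (numbers_lt I)
  obtain ⟨h1, h2⟩ := run_small (I := I) t
  refine ⟨fun i => ?_, fun v => ?_⟩
  · rcases (h1 i).1 with h | ⟨m, h3, h4⟩
    · simp [h]
    · rw [h4]; exact (h3.length_le hK (by omega)).trans (by omega)
  · obtain ⟨b, h3, h4⟩ := h2 v
    rw [h4]; exact (h3.length_le hK (by omega)).trans (by omega)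

end BHS

theorem mainTheorem3 :
    ∃ (A : BHS.Algorithm) (T : ℕ), ∀ c : ℕ, ∃ M : ℕ,
      ∀ (V : Type*) [Fintype V] [DecidableEq V] (I : BHS.RootedInstance V 1 6),
        (∀ i, 1 ≤ I.ident i ∧ I.ident i ≤ Fintype.card V ^ c) →
          I.SolvedWithin A (T * I.graph.edgeFinset.card ^ 2) (M * Nat.log 2 (Fintype.card V)) :=
  ⟨BHS.search, 33857, fun _ => ⟨27675, fun _ _ _ I _ => BHS.solvedWithin_search I⟩⟩
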